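/- Logarithms are to base $2$ unless written $\ln$. **Channel.** Let $\mu_T,\mu_E$ be probability laws on $[0,\infty)$, $\mu_T$ of bounded support and $\int h^2\,d\mu_E<\infty$; let $\sigma_E>0$ and $P\ge 0$. The main-channel gains $H_{T,1},H_{T,2},\dots$ are i.i.d. of law $\mu_T$ and known to the transmitter; the eavesdropper's gains $H_{E,t}$ are i.i.d. of law $\mu_E$ and independent of the $H_{T,t}$. On input $s_t$ the eavesdropper observes $Z_t=H_{E,t}s_t+U_t$, where the $U_t$ are i.i.d. $\mathcal N(0,\sigma_E^2)$ and independent of all else; she also knows $H_T^n$ and $H_E^n$. **Multiplexing scheme.** Choose $h_1<\dots<h_{d+1}$ with $\mu_T([h_1,h_{d+1}))=1$, put $I_i=[h_i,h_{i+1})$ and $p_i=\mu_T(I_i)$, and choose powers $\gamma_i\ge0$ with $\sum_i p_i\gamma_i\le P$. The step power allocation is $\gamma_S(h)=\gamma_i$ for $h\in I_i$. Let $n_i=n_i(n)$ be nonnegative integers with $n_i/n\to p_i$ as $n\to\infty$ (write $n_i=p_in-\varepsilon_i$ with $\varepsilon_i=o(n)$). An admissible codebook at block length $n$ consists of nonempty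 finite sets $\mathcal C^i\subset\mathbb R^{n_i}$ $(1\le i\le d)$ with $\|x\|^2\le n_i\gamma_i$ for all $x\in\mathcal C^i$; the input $X^n$ is uniform on $\mathcal C=\prod_i\mathcal C^i$. At time $t$, if $H_{T,t}\in I_i$, the next symbol of the $i$-th codeword is sent, and $0$ is sent once that codeword is finished. **Smooth max-information.** Let $\omega$ denote densities with respect to the product of Lebesgue measure (for $z^n$) and the laws of $H_T^n$ and $H_E^n$. A set $\mathcal T$ of tuples $(x^n,z^n,h_T^n,h_E^n)$ with measurable sections in $(z^n,h_T^n,h_E^n)$ for each $x^n$ is $(1-\epsilon)$-typical if $\Pr[(X^n,Z^n,H_T^n,H_E^n)\in\mathcal T\mid X^n=x^n]\ge1-\epsilon$ for all $x^n\in\mathcal C$. Put $$I_\infty^{\mathcal T}(X^n;Z^n,H_T^n,H_E^n)=\log|\mathcal C|+\log\int\omega(z^n,h_T^n,h_E^n)\max_{x^n\in\mathcal C}\big(\omega(x^n\mid z^n,h_T^n,h_E^n)\,\mathbf 1_{\mathcal T}\big)\in[-\infty,\infty),$$ and let $I_\infty^{\epsilon}$ be the infimum of $I_\infty^{\mathcal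 T}$ over all $(1-\epsilon)$-typical sets $\mathcal T$. **Product typical set.** For $\delta,\delta',\delta''>0$ let $\mathcal T'_n$ be the set of tuples for which, for every $i$, with $A_i$ the set of times at which a symbol of the $i$-th codeword is sent (the first $\min(N_i,n_i)$ uses of subchannel $i$, where $N_i$ is the number of $t\le n$ with $h_{T,t}\in I_i$) and $s_t$ the symbol sent at time $t$, $$\sum_{t\in A_i}\frac{z_t^2}{\sigma_E^2+h_{E,t}^2\gamma_i}\le|A_i|(1+\delta),\qquad \sum_{t\in A_i}(z_t-h_{E,t}s_t)^2\ge|A_i|\sigma_E^2(1-\delta'),$$ $$\Big|\sum_{t\in A_i}\log\Big(1+\frac{h_{E,t}^2\gamma_i}{\sigma_E^2}\Big)-|A_i|\,\mathbb E\log\Big(1+\frac{H_E^2\gamma_i}{\sigma_E^2}\Big)\Big|\le|A_i|\delta''.$$ For $\gamma:[0,\infty)\to[0,\infty)$ put $B(\gamma)=\frac12\mathbb E_{H_T,H_E}\big[\log(1+\gamma(H_T)H_E^2/\sigma_E^2)\big]$. **Theorem.** 1. For every partition with powers as above and every choice of the lengths $n_i(n)$: (a) For every $\eta>0$ there is $c>0$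 such that, for all sufficiently large $n$ and all admissible codebooks at block length $n$, $\frac1nI_\infty^{\epsilon_n}(X^n;Z^n,H_T^n,H_E^n)\le B(\gamma_S)+\eta$ with $\epsilon_n=e^{-cn}$. (b) For every sequence $\epsilon_n>0$ with $\frac1n\ln\epsilon_n\to0$ and every $\eta>0$, for all sufficiently large $n$ and all admissible codebooks, $\frac1nI_\infty^{\epsilon_n}(X^n;Z^n,H_T^n,H_E^n)\le B(\gamma_S)+\eta$. (c) For all $\delta,\delta',\delta''>0$ and $\eta>0$, for all sufficiently large $n$ and all admissible codebooks, $\frac1nI_\infty^{\mathcal T'_n}(X^n;Z^n,H_T^n,H_E^n)\le B(\gamma_S)+\frac12\log\big((1+\delta)e^{\delta'}\big)+\frac12\delta''+\eta$. Moreover, for every $a$ there is $c>0$ such that, for all sufficiently large $n$ and all admissible codebooks whose codeword symbols are at most $a$ in absolute value, $\mathcal T'_n$ is $(1-e^{-cn})$-typical. 2. Let $\gamma:[0,\infty)\to[0,\infty)$ be measurable and let $S_1,S_2,\dots$ be partitions with powers as above (with common $P$) such that $\gamma_{S_k}\to\gamma$ in $\mu_T$-measure. For every $\eta>0$ and all sufficiently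 large $k$, for all lengths $n_i(n)$ for $S_k$ there is $c>0$ such that, for all sufficiently large $n$ and all admissible codebooks, $\frac1nI_\infty^{\epsilon_n}(X^n;Z^n,H_T^n,H_E^n)\le B(\gamma)+\eta$ with $\epsilon_n=e^{-cn}$. 3. For every measurable $\gamma:[0,\infty)\to[0,\infty)$ with $\mathbb E[\gamma(H_T)]\le P$ there is such a sequence $S_k$ whose largest interval length tends to $0$. -/

import Mathlib

open MeasureTheory ProbabilityTheory Filter Topology
open scoped NNReal ENNReal

noncomputable section

namespace FadingWiretap

/-! ### Smooth max-information of a channel with finite input alphabet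

`M` is the finite input alphabet, carrying a uniformly distributed input, `Ω` the output alphabet with
reference measure `μ`, and `w m z` the transition density at output `z` given input `m`. -/

section Information

variable {M Ω : Type*} [Fintype M] [MeasurableSpace Ω]

/-- Base-`2` logarithm with values in the extended reals, so that `log 0 = -∞`. -/
def log2 (a : ℝ≥0∞) : EReal := ENNReal.log a / ((Real.log 2 : ℝ) : EReal)

/-- Density of the output when the input is uniform. -/
def outDensity (w : M → Ω → ℝ≥0∞) (z : Ω) : ℝ≥0∞ :=
  ∑ m, (Fintype.card M : ℝ≥0∞)⁻¹ * w m z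

/-- Conditional probability of the input `m` given the output `z`. -/
def inputPosterior (w : M → Ω → ℝ≥0∞) (m : M) (z : Ω) : ℝ≥0∞ :=
  (Fintype.card M : ℝ≥0∞)⁻¹ * w m z / outDensity w z

/-- The posterior restricted to the set `T` of input-output pairs. -/
def posteriorOn (w : M → Ω → ℝ≥0∞) (T : Set (M × Ω)) (m : M) (z : Ω) : ℝ≥0∞ :=
  T.indicator (fun q => inputPosterior w q.1 q.2) (m, z)

/-- Conditional min-entropy of the uniform input given the output, restricted to `T`. -/
def condMinEntropyOn (μ : Measure Ω) (w : M → Ω → ℝ≥0∞) (T : Set (M × Ω)) : EReal :=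
  -log2 (∫⁻ z, outDensity w z * ⨆ m, posteriorOn w T m z ∂μ)

/-- Max-information between the uniform input and the output, evaluated on `T`. -/
def maxInfoOn (μ : Measure Ω) (w : M → Ω → ℝ≥0∞) (T : Set (M × Ω)) : EReal :=
  log2 (Fintype.card M : ℝ≥0∞) - condMinEntropyOn μ w T

/-- `T` is a `(1 - ε)`-typical set: whatever the input, the input-output pair lies in `T` with
probability at least `1 - ε`. -/
def IsTypical (μ : Measure Ω) (w : M → Ω → ℝ≥0∞) (ε : ℝ) (T : Set (M × Ω)) : Prop :=
  (∀ m, MeasurableSet {z | (m, z) ∈ T}) ∧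
    ∀ m, ENNReal.ofReal (1 - ε) ≤ ∫⁻ z in {z | (m, z) ∈ T}, w m z ∂μ

/-- `ε`-smooth max-information between the uniform input and the output. -/
def smoothMaxInfo (μ : Measure Ω) (w : M → Ω → ℝ≥0∞) (ε : ℝ) : EReal :=
  ⨅ (T : Set (M × Ω)) (_ : IsTypical μ w ε T), maxInfoOn μ w T

end Information

/-! ### The multiplexing scheme -/

/-- A partition of the range of the main-channel gain (with law `μT`) into the `d` intervals
`[edge i, edge (i+1))`, with a transmit power for each interval, under the average power
constraint `P`. -/
structure PowerPartition (μT : Measure ℝ≥0) (P : ℝ≥0) where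
  d : ℕ
  edge : Fin (d + 1) → ℝ≥0
  edge_strictMono : StrictMono edge
  covers : ∀ᵐ h ∂μT, h ∈ Set.Ico (edge 0) (edge (Fin.last d))
  power : Fin d → ℝ≥0
  power_le : ∑ i, μT (Set.Ico (edge i.castSucc) (edge i.succ)) * (power i : ℝ≥0∞) ≤ (P : ℝ≥0∞)

namespace PowerPartition

variable {μT : Measure ℝ≥0} {P : ℝ≥0} (S : PowerPartition μT P)

/-- The `i`-th interval of main-channel gains. -/
def interval (i : Fin S.d) : Set ℝ≥0 := Set.Ico (S.edge i.castSucc) (S.edge i.succ)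

/-- The probability that the main-channel gain lies in the `i`-th interval. -/
def prob (i : Fin S.d) : ℝ := μT.real (S.interval i)

/-- The power allocation as a function of the main-channel gain: `power i` on the `i`-th interval. -/
def alloc (h : ℝ≥0) : ℝ≥0 := ∑ i, (S.interval i).indicator (fun _ => S.power i) h

/-- Planned lengths `len n i` of the `i`-th codeword at block length `n`: they are
`n * prob i - o(n)`. -/
def IsPlan (len : ℕ → Fin S.d → ℕ) : Prop :=
  ∀ i, Tendsto (fun n => (len n i : ℝ) / n) atTop (𝓝 (S.prob i))

/-- Codebooks for the `d` subchannels: nonempty finite sets of words of length `L i`, each word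
`x` with average power `‖x‖² / L i` at most `power i`. -/
def IsCodebook {L : Fin S.d → ℕ} (C : (i : Fin S.d) → Finset (Fin (L i) → ℝ)) : Prop :=
  ∀ i, (C i).Nonempty ∧ ∀ x ∈ C i, ∑ j, x j ^ 2 ≤ (L i : ℝ) * S.power i

open Classical in
/-- Number of uses of subchannel `i` before time `t`. -/
def uses {n : ℕ} (hT : Fin n → ℝ≥0) (i : Fin S.d) (t : Fin n) : ℕ :=
  (Finset.univ.filter fun s => s < t ∧ hT s ∈ S.interval i).card

open Classical in
/-- The times at which a symbol of the `i`-th codeword is sent: the first `L i` uses of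
subchannel `i` (all of them if there are fewer). -/
def active {n : ℕ} (L : Fin S.d → ℕ) (hT : Fin n → ℝ≥0) (i : Fin S.d) : Finset (Fin n) :=
  Finset.univ.filter fun t => hT t ∈ S.interval i ∧ S.uses hT i t < L i

open Classical in
/-- The symbol that the multiplexer transmits at time `t`: the next symbol of the codeword of the
subchannel that occurs at time `t`, and `0` if that codeword has been sent completely. -/
def symbol {n : ℕ} {L : Fin S.d → ℕ} (x : (i : Fin S.d) → Fin (L i) → ℝ) (hT : Fin n → ℝ≥0)
    (t : Fin n) : ℝ :=
  ∑ i, if h : hT t ∈ S.interval i ∧ S.uses hT i t < L i then x i ⟨S.uses hT i t, h.2⟩ else 0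

end PowerPartition

/-- The eavesdropper's output `(zⁿ, h_Tⁿ, h_Eⁿ)`: the received word and both sequences of channel
gains. -/
abbrev EveOutput (n : ℕ) : Type := (Fin n → ℝ) × (Fin n → ℝ≥0) × (Fin n → ℝ≥0)

/-- Reference measure on the eavesdropper's outputs: Lebesgue measure for the received word, and
the laws of the independent, i.i.d. gain sequences. -/
def refMeasure (μT μE : Measure ℝ≥0) (n : ℕ) : Measure (EveOutput n) :=
  (volume : Measure (Fin n → ℝ)).prod
    ((Measure.pi fun _ : Fin n => μT).prod (Measure.pi fun _ : Fin n => μE))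

section Scheme

variable {μT : Measure ℝ≥0} {P : ℝ≥0} (S : PowerPartition μT P) (σE : ℝ≥0) {n : ℕ}
  {L : Fin S.d → ℕ} (C : (i : Fin S.d) → Finset (Fin (L i) → ℝ))

/-- The overall codebook: one codeword for each subchannel. -/
abbrev Codeword : Type := (i : Fin S.d) → C i

/-- Transition density of the eavesdropper's channel: given the codewords `x` and the gains,
`z t = hE t * symbol t + U t` with i.i.d. noise `U t` of law `N(0, σE²)`. -/
def eveDensity (x : Codeword S C) (q : EveOutput n) : ℝ≥0∞ :=
  ∏ t, gaussianPDF ((q.2.2 t : ℝ) * S.symbol (fun i => (x i).1) q.2.1 t) (σE ^ 2) (q.1 t)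

/-- The single-block typical set of the fast-fading channel with noise variance `σ²`, power `p`,
on the block of times `A`: conditions on the output power, on the noise power, and on the
empirical mean of `log (1 + h² p / σ²)`. -/
def BlockTypical (μE : Measure ℝ≥0) (σ p : ℝ≥0) (δ δ' δ'' : ℝ) (A : Finset (Fin n))
    (s : Fin n → ℝ) (h : Fin n → ℝ≥0) (z : Fin n → ℝ) : Prop :=
  ∑ t ∈ A, z t ^ 2 / ((σ : ℝ) ^ 2 + (h t : ℝ) ^ 2 * p) ≤ A.card * (1 + δ) ∧
  A.card * ((σ : ℝ) ^ 2 * (1 - δ')) ≤ ∑ t ∈ A, (z t - h t * s t) ^ 2 ∧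
  |∑ t ∈ A, Real.logb 2 (1 + (h t : ℝ) ^ 2 * p / (σ : ℝ) ^ 2) -
      A.card * ∫ g, Real.logb 2 (1 + (g : ℝ) ^ 2 * p / (σ : ℝ) ^ 2) ∂μE| ≤ A.card * δ''

/-- The product typical set: every subchannel's block lies in its own typical set. -/
def productTypicalSet (μE : Measure ℝ≥0) (δ δ' δ'' : ℝ) : Set (Codeword S C × EveOutput n) :=
  {q | ∀ i, BlockTypical μE σE (S.power i) δ δ' δ'' (S.active L q.2.2.1 i)
    (S.symbol (fun j => (q.1 j).1) q.2.2.1) q.2.2.2 q.2.1}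

end Scheme

/-- `(1/2) E[log₂ (1 + γ(H_T) H_E² / σE²)]` for independent gains `H_T ~ μT`, `H_E ~ μE`. -/
def fadingRate (μT μE : Measure ℝ≥0) (σE : ℝ≥0) (γ : ℝ≥0 → ℝ≥0) : ℝ :=
  1 / 2 * ∫ h, Real.logb 2 (1 + (γ h.1 : ℝ) * (h.2 : ℝ) ^ 2 / (σE : ℝ) ^ 2) ∂(μT.prod μE)

end FadingWiretap

end

open FadingWiretap

noncomputable section

namespace FadingWiretap

/-! ### General bounds on the smooth max-information -/

section Typical

variable {M Ω : Type*} [MeasurableSpace Ω]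

/-! Multiplying the output density by the posterior gives the transition density divided by the
number of codewords. Hence the max-information on `T` is governed by the integral over outputs of
the largest transition density among the inputs that `T` allows there. If on `T` the transition
density is at most `K` times a subprobability density `Q` of the output, the max-information is at
most `log K` (`maxInfoOn_le_logb`). It remains to choose `Q` and `T`.

For the smooth bounds, `Q` is a product over time and `T` is the event that the log-likelihood ratio
of the channel against `Q` is at most a number `E`. The natural factor of `Q` is the Gaussian output
density of variance `σ² + h²γ`. The power constraint limits only the energy of a codeword, so a
single symbol `s` may be huge, and the term `h²s²/(σ² + h²γ)` of the Gaussian log-ratio then has no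
exponential moments uniform in `s`. A Cauchy component of small weight is therefore mixed into `Q`:
it caps the log-ratio at a constant plus `log(1+s²) + log(1+h²/σ²)`, which for large `s` costs less
than `τs²` and is paid for by the energy budget. The outcome is `exists_info_mgf_bound`, which needs
only a second moment of the eavesdropper's gain. With `r(γ)` the rate in nats and `m(γ)` the mean
normalised gain, a use with symbol `s` contributes at most `r(γ) + (s²-γ)m(γ)/2 + τ(1+s²)`. Since
`γm(γ)/2 ≤ r(γ)`, summing over the slots of the `i`-th codeword gives at most `nᵢ(r(γᵢ) + τγᵢ)`,
plus `τ` per slot, even if the codeword is cut short (`sum_active_rate_le`). This holds for each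
sequence of main-channel gains, so no concentration of these gains enters `exists_smoothMaxInfo_le`;
the limits `nᵢ/n → pᵢ` then produce the fading rate.

On the product typical sets, `Q` is Gaussian with variance inflated by `1+δ`, and the defining
inequalities bound the log-ratio pointwise (`maxInfoOn_productTypicalSet_le`). Their typicality for
bounded symbols follows from Chernoff bounds on each block (`expSmall_blockExcess`), together with
the fact that a subchannel of positive probability is exponentially unlikely to be used much less
than expected.

The passage to a limiting power allocation rests on the sublinearity of the logarithm: bounded mean
power on sets of vanishing measure contributes little, so the fading rate is upper semicontinuous
(`eventually_fadingRate_le`). Step allocations are obtained from the density of bounded continuous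
functions in `L¹`, followed by a rescaling that restores the power constraint. -/

lemma IsTypical.mono {μ : Measure Ω} {w : M → Ω → ℝ≥0∞} {ε ε' : ℝ} (h : ε ≤ ε')
    {T : Set (M × Ω)} (hT : IsTypical μ w ε T) : IsTypical μ w ε' T :=
  ⟨hT.1, fun m => (ENNReal.ofReal_le_ofReal (by linarith)).trans (hT.2 m)⟩

lemma isTypical_of_compl {μ : Measure Ω} {w : M → Ω → ℝ≥0∞} {ε : ℝ} (hε : 0 ≤ ε)
    {T : Set (M × Ω)} (hT : ∀ m, MeasurableSet {z | (m, z) ∈ T}) (hw : ∀ m, ∫⁻ z, w m z ∂μ = 1)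
    (h : ∀ m, ∫⁻ z in {z | (m, z) ∉ T}, w m z ∂μ ≤ ENNReal.ofReal ε) : IsTypical μ w ε T := by
  refine ⟨hT, fun m => ?_⟩
  have h1 := lintegral_add_compl (w m) (μ := μ) (hT m)
  rw [hw m] at h1
  rw [ENNReal.ofReal_sub _ hε, ENNReal.ofReal_one, tsub_le_iff_right, ← h1]
  gcongr
  exact h m

end Typical

section MaxInfo

variable {M Ω : Type*} [Fintype M] [MeasurableSpace Ω]

lemma log2_ofReal {K : ℝ} (hK : 0 < K) :
    log2 (ENNReal.ofReal K) = ((Real.logb 2 K : ℝ) : EReal) := by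
  rw [log2, ENNReal.log_ofReal_of_pos hK, Real.logb, EReal.coe_div]

lemma log2_mono {a b : ℝ≥0∞} (h : a ≤ b) : log2 a ≤ log2 b := by
  refine EReal.div_le_div_right_of_nonneg ?_ (ENNReal.log_monotone h)
  exact_mod_cast (Real.log_pos one_lt_two).le

lemma log2_mul {a b : ℝ≥0∞} : log2 (a * b) = log2 a + log2 b := by
  unfold log2
  rw [ENNReal.log_mul_add]
  simp only [div_eq_mul_inv, ← EReal.coe_inv]
  rw [EReal.right_distrib_of_nonneg_of_ne_top] 
  · exact_mod_cast inv_nonneg.2 (Real.log_pos one_lt_two).le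
  · exact EReal.coe_ne_top _

/-- If the transition densities are dominated on `T` by `K` times a subprobability density `Q`,
the max-information on `T` is at most `log K`. -/
lemma maxInfoOn_le_logb [Nonempty M] {μ : Measure Ω} {w : M → Ω → ℝ≥0∞} {T : Set (M × Ω)}
    {K : ℝ} (hK : 0 < K) {Q : Ω → ℝ≥0∞} (hQ : ∫⁻ z, Q z ∂μ ≤ 1)
    (h : ∀ m z, (m, z) ∈ T → w m z ≤ ENNReal.ofReal K * Q z) :
    maxInfoOn μ w T ≤ ((Real.logb 2 K : ℝ) : EReal) := by
  have hc0 : (Fintype.card M : ℝ≥0∞) ≠ 0 := by simp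
  have hct : (Fintype.card M : ℝ≥0∞) ≠ ⊤ := by simp
  have key : (Fintype.card M : ℝ≥0∞) * ∫⁻ z, outDensity w z * ⨆ m, posteriorOn w T m z ∂μ
      ≤ ENNReal.ofReal K := by
    have hpt : ∀ z, outDensity w z * ⨆ m, posteriorOn w T m z ≤
        (Fintype.card M : ℝ≥0∞)⁻¹ * (ENNReal.ofReal K * Q z) := by
      intro z
      rw [ENNReal.mul_iSup]
      refine iSup_le fun m => ?_
      unfold posteriorOn
      by_cases hm : (m, z) ∈ T
      · rw [Set.indicator_of_mem hm]
        -- An inequality suffices here, so outputs of zero density need no separate treatment.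
        refine ENNReal.mul_div_le.trans ?_
        gcongr
        exact h m z hm
      · rw [Set.indicator_of_notMem hm]
        simp
    calc _ ≤ (Fintype.card M : ℝ≥0∞) *
          ∫⁻ z, (Fintype.card M : ℝ≥0∞)⁻¹ * (ENNReal.ofReal K * Q z) ∂μ := by
          exact mul_le_mul_right (lintegral_mono hpt) _
      _ = ENNReal.ofReal K * ∫⁻ z, Q z ∂μ := by
          rw [lintegral_const_mul' _ _ (ENNReal.inv_ne_top.2 hc0),
            lintegral_const_mul' _ _ ENNReal.ofReal_ne_top, ← mul_assoc,
            ENNReal.mul_inv_cancel hc0 hct, one_mul]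
      _ ≤ ENNReal.ofReal K * 1 := by gcongr
      _ = _ := mul_one _
  rw [maxInfoOn, condMinEntropyOn, sub_eq_add_neg, neg_neg, ← log2_mul, ← log2_ofReal hK]
  exact log2_mono key

lemma smoothMaxInfo_le_maxInfoOn {μ : Measure Ω} {w : M → Ω → ℝ≥0∞} {ε : ℝ} {T : Set (M × Ω)}
    (hT : IsTypical μ w ε T) : smoothMaxInfo μ w ε ≤ maxInfoOn μ w T :=
  iInf₂_le T hT

lemma smoothMaxInfo_anti {μ : Measure Ω} {w : M → Ω → ℝ≥0∞} {ε ε' : ℝ} (h : ε ≤ ε') :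
    smoothMaxInfo μ w ε' ≤ smoothMaxInfo μ w ε :=
  le_iInf₂ fun _ hT => smoothMaxInfo_le_maxInfoOn (hT.mono h)

lemma div_natCast_le {a : EReal} {b r : ℝ} {n : ℕ} (hn : 0 < n) (ha : a ≤ (b : EReal))
    (hb : b ≤ n * r) : a / (n : EReal) ≤ (r : EReal) := by
  rw [EReal.div_le_iff_le_mul (by exact_mod_cast hn) (EReal.natCast_ne_top n)]
  refine ha.trans ?_
  have : ((n : EReal)) = ((n : ℝ) : EReal) := by simp
  rw [this, ← EReal.coe_mul]
  exact_mod_cast hb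

end MaxInfo

/-! ### Product integrals and exponential moments -/

lemma lintegral_pi_prod {E : Type*} [MeasurableSpace E] (μ : Measure E) [SigmaFinite μ] {n : ℕ}
    (f : Fin n → E → ℝ≥0∞) (hf : ∀ i, Measurable (f i)) :
    ∫⁻ x, ∏ i, f i (x i) ∂(Measure.pi fun _ : Fin n => μ) = ∏ i, ∫⁻ x, f i x ∂μ := by
  induction n with
  | zero => simp
  | succ n ih =>
    have hp := (measurePreserving_piFinSuccAbove (fun _ : Fin (n + 1) => μ) 0).symm
    rw [← hp.lintegral_comp_emb (MeasurableEquiv.measurableEmbedding _)]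
    simp_rw [MeasurableEquiv.piFinSuccAbove_symm_apply, Fin.insertNthEquiv,
      Fin.prod_univ_succ, Equiv.coe_fn_mk, Fin.insertNth_zero]
    simp only [Fin.cons_zero, Fin.cons_succ]
    rw [← ih (fun i => f i.succ) (fun i => hf _)]
    exact lintegral_prod_mul (hf 0).aemeasurable
      (Finset.measurable_prod _ fun i _ => (hf _).comp (measurable_pi_apply i)).aemeasurable

/-- Taylor remainder of order two. Keeping the linear term exact makes the later exponential moment
estimates sharp to first order in the Chernoff parameter. -/
lemma exp_le_one_add_add_sq_mul_exp_abs (x : ℝ) :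
    Real.exp x ≤ 1 + x + x ^ 2 * Real.exp |x| := by
  have h := Complex.norm_exp_sub_sum_le_norm_mul_exp (x : ℂ) 2
  simp only [Finset.sum_range_succ, Finset.sum_range_zero] at h
  norm_num at h
  have h2 : ‖Complex.exp (x : ℂ) - (1 + x)‖ = |Real.exp x - (1 + x)| := by
    rw [← Real.norm_eq_abs, ← Complex.norm_real]
    push_cast
    rfl
  rw [h2] at h
  linarith [le_abs_self (Real.exp x - (1 + x))]

/-- Uniform second-order bound on the exponential moments of all random variables that are
dominated by a variable with an exponential moment. -/
lemma exists_mgf_bound {Ω : Type*} [MeasurableSpace Ω] (μ : Measure Ω) [IsProbabilityMeasure μ]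
    {F : Ω → ℝ} {θ : ℝ} (hθ : 0 < θ) (hF0 : ∀ ω, 0 ≤ F ω) (hFm : Measurable F)
    (hF : Integrable (fun ω => Real.exp (θ * F ω)) μ) :
    Integrable F μ ∧ ∃ V : ℝ, 0 ≤ V ∧ ∀ l : ℝ, 0 ≤ l → l ≤ θ / 2 → ∀ f : Ω → ℝ, Measurable f →
      (∀ ω, |f ω| ≤ F ω) → 
      ∫⁻ ω, ENNReal.ofReal (Real.exp (l * f ω)) ∂μ
        ≤ ENNReal.ofReal (Real.exp (l * ∫ ω, f ω ∂μ + l ^ 2 * V)) := by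
  have hFi : Integrable F μ := by
    refine Integrable.mono' (hF.const_mul θ⁻¹) hFm.aestronglyMeasurable (ae_of_all _ fun ω => ?_)
    rw [Real.norm_of_nonneg (hF0 ω), inv_mul_eq_div, le_div_iff₀ hθ]
    linarith [Real.add_one_le_exp (θ * F ω)]
  refine ⟨hFi, 8 / θ ^ 2 * ∫ ω, Real.exp (θ * F ω) ∂μ,
    mul_nonneg (by positivity) (integral_nonneg fun ω => (Real.exp_pos _).le), ?_⟩
  intro l hl hlθ f hfm hf
  have hfi : Integrable f μ := hFi.mono' hfm.aestronglyMeasurable (ae_of_all _ hf)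
  -- As `l ≤ θ/2`, the remainder uses only half of the available exponent `θF`; the other half
  -- absorbs the factor `F²`.
  have hpt : ∀ ω, Real.exp (l * f ω) ≤
      1 + l * f ω + l ^ 2 * (8 / θ ^ 2 * Real.exp (θ * F ω)) := by
    intro ω
    have h1 := exp_le_one_add_add_sq_mul_exp_abs (l * f ω)
    have h2 : |l * f ω| ≤ θ / 2 * F ω := by
      rw [abs_mul, abs_of_nonneg hl]
      exact mul_le_mul hlθ (hf ω) (abs_nonneg _) (by positivity)
    have h3 : f ω ^ 2 ≤ F ω ^ 2 := sq_le_sq' (abs_le.1 (hf ω)).1 (abs_le.1 (hf ω)).2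
    have h4 : (θ / 2 * F ω) ^ 2 / 2 ≤ Real.exp (θ / 2 * F ω) := by
      have := Real.quadratic_le_exp_of_nonneg (x := θ / 2 * F ω)
        (mul_nonneg (by positivity) (hF0 ω))
      nlinarith [mul_nonneg (by positivity : 0 ≤ θ / 2) (hF0 ω)]
    have h5 : F ω ^ 2 ≤ 8 / θ ^ 2 * Real.exp (θ / 2 * F ω) := by
      rw [div_mul_eq_mul_div, le_div_iff₀ (by positivity)]
      nlinarith
    have h6 : (l * f ω) ^ 2 * Real.exp |l * f ω| ≤
        l ^ 2 * (8 / θ ^ 2 * Real.exp (θ * F ω)) := by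
      have h7 : Real.exp (θ * F ω) = Real.exp (θ / 2 * F ω) * Real.exp (θ / 2 * F ω) := by
        rw [← Real.exp_add]; congr 1; ring
      rw [h7, mul_pow, mul_assoc, ← mul_assoc (8 / θ ^ 2)]
      gcongr
      exact h3.trans h5
    linarith
  have hi1 : Integrable (fun ω => 1 + l * f ω) μ := (integrable_const 1).add (hfi.const_mul l)
  have hi2 : Integrable (fun ω => l ^ 2 * (8 / θ ^ 2 * Real.exp (θ * F ω))) μ :=
    (hF.const_mul _).const_mul _
  have hei : Integrable (fun ω => Real.exp (l * f ω)) μ := by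
    refine (hi1.add hi2).mono' (by fun_prop) (ae_of_all _ fun ω => ?_)
    rw [Real.norm_of_nonneg (Real.exp_pos _).le]
    exact hpt ω
  rw [← ofReal_integral_eq_lintegral_ofReal hei (ae_of_all _ fun ω => (Real.exp_pos _).le)]
  refine ENNReal.ofReal_le_ofReal ?_
  calc ∫ ω, Real.exp (l * f ω) ∂μ
      ≤ ∫ ω, (1 + l * f ω + l ^ 2 * (8 / θ ^ 2 * Real.exp (θ * F ω))) ∂μ :=
        integral_mono hei (hi1.add hi2) hpt
    _ = l * ∫ ω, f ω ∂μ + l ^ 2 * (8 / θ ^ 2 * ∫ ω, Real.exp (θ * F ω) ∂μ) + 1 := by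
        rw [integral_add hi1 hi2, integral_add (integrable_const 1) (hfi.const_mul l),
          integral_const_mul, integral_const_mul, integral_const_mul]
        simp
        ring
    _ ≤ _ := Real.add_one_le_exp _

/-! ### Exponentially small families -/

/-- The quantities `v n x` decay exponentially in `n`, uniformly in the parameter `x`. -/
def ExpSmall {β : ℕ → Type*} (v : (n : ℕ) → β n → ℝ≥0∞) : Prop :=
  ∃ c > (0 : ℝ), ∀ᶠ n : ℕ in atTop, ∀ x : β n, v n x ≤ ENNReal.ofReal (Real.exp (-c * n))

section ExpSmall

variable {β : ℕ → Type*} {v v' : (n : ℕ) → β n → ℝ≥0∞}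

lemma ExpSmall.mono (h : ExpSmall v) (hv : ∀ᶠ n in atTop, ∀ x, v' n x ≤ v n x) :
    ExpSmall v' := by
  obtain ⟨c, hc, h⟩ := h
  exact ⟨c, hc, (h.and hv).mono fun n hn x => (hn.2 x).trans (hn.1 x)⟩

lemma ExpSmall.zero : ExpSmall (fun n (_ : β n) => 0) :=
  ⟨1, one_pos, Eventually.of_forall fun _ _ => zero_le⟩

lemma ExpSmall.add (h : ExpSmall v) (h' : ExpSmall v') :
    ExpSmall (fun n x => v n x + v' n x) := by
  obtain ⟨c, hc, h⟩ := h
  obtain ⟨c', hc', h'⟩ := h'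
  have hm : 0 < min c c' := lt_min hc hc'
  have hlim : Tendsto (fun n : ℕ => min c c' / 2 * (n : ℝ)) atTop atTop :=
    tendsto_natCast_atTop_atTop.const_mul_atTop (by positivity)
  -- Halving the smaller rate absorbs the factor 2 for large `n`.
  refine ⟨min c c' / 2, by positivity, ?_⟩
  filter_upwards [h, h', hlim.eventually_ge_atTop (Real.log 2)] with n h1 h2 h3 x
  refine (add_le_add (h1 x) (h2 x)).trans ?_
  rw [← ENNReal.ofReal_add (Real.exp_pos _).le (Real.exp_pos _).le]
  refine ENNReal.ofReal_le_ofReal ?_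
  have e1 : Real.exp (-c * n) ≤ Real.exp (-(min c c') * n) := by
    gcongr; exact min_le_left _ _
  have e2 : Real.exp (-c' * n) ≤ Real.exp (-(min c c') * n) := by
    gcongr; exact min_le_right _ _
  have e3 : 2 * Real.exp (-(min c c') * n) ≤ Real.exp (-(min c c' / 2) * n) := by
    rw [← Real.exp_log (show (0 : ℝ) < 2 by norm_num), ← Real.exp_add, Real.exp_le_exp,
      Real.exp_log two_pos]
    linarith
  linarith

lemma ExpSmall.sum {ι : Type*} (s : Finset ι) {w : ι → (n : ℕ) → β n → ℝ≥0∞}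
    (h : ∀ i ∈ s, ExpSmall (w i)) : ExpSmall (fun n x => ∑ i ∈ s, w i n x) := by
  classical
  induction s using Finset.induction_on with
  | empty => simpa using ExpSmall.zero
  | insert a s ha ih =>
    simp only [Finset.sum_insert ha]
    exact (h a (by simp)).add (ih fun i hi => h i (by simp [hi]))

end ExpSmall

/-! ### Combinatorics of the multiplexer -/

namespace PowerPartition

variable {μT : Measure ℝ≥0} {P : ℝ≥0} (S : PowerPartition μT P)

lemma eq_of_mem_interval {i j : Fin S.d} {h : ℝ≥0} (hi : h ∈ S.interval i)
    (hj : h ∈ S.interval j) : i = j := by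
  have key : ∀ a b : Fin S.d, a < b → h ∈ S.interval a → h ∈ S.interval b → False := by
    intro a b hab ha hb
    have : S.edge a.succ ≤ S.edge b.castSucc := S.edge_strictMono.monotone (by
      rw [Fin.le_def]; simpa using hab)
    exact absurd (ha.2.trans_le this) (not_lt.2 hb.1)
  rcases lt_trichotomy i j with h1 | h1 | h1
  · exact (key i j h1 hi hj).elim
  · exact h1
  · exact (key j i h1 hj hi).elim

lemma measurableSet_interval (i : Fin S.d) : MeasurableSet (S.interval i) := measurableSet_Ico

lemma alloc_of_mem {i : Fin S.d} {h : ℝ≥0} (hi : h ∈ S.interval i) : S.alloc h = S.power i := by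
  unfold alloc
  rw [Finset.sum_eq_single i]
  · rw [Set.indicator_of_mem hi]
  · intro j _ hj
    exact Set.indicator_of_notMem (fun hj' => hj (S.eq_of_mem_interval hj' hi)) _
  · simp

lemma alloc_of_notMem {h : ℝ≥0} (hi : ∀ i, h ∉ S.interval i) : S.alloc h = 0 := by
  unfold alloc
  exact Finset.sum_eq_zero fun i _ => Set.indicator_of_notMem (hi i) _

lemma measurable_alloc : Measurable S.alloc := by
  unfold alloc
  exact Finset.measurable_sum _ fun i _ => measurable_const.indicator (S.measurableSet_interval i)

lemma lintegral_alloc : ∫⁻ h, (S.alloc h : ℝ≥0∞) ∂μT =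
    ∑ i, μT (Set.Ico (S.edge i.castSucc) (S.edge i.succ)) * (S.power i : ℝ≥0∞) := by
  have h1 : ∀ h, (S.alloc h : ℝ≥0∞) =
      ∑ i, (S.interval i).indicator (fun _ => (S.power i : ℝ≥0∞)) h := by
    intro h
    unfold alloc
    push_cast
    refine Finset.sum_congr rfl fun i _ => ?_
    by_cases hi : h ∈ S.interval i <;> simp [hi]
  simp_rw [h1]
  rw [lintegral_finsetSum _ fun i _ => measurable_const.indicator (S.measurableSet_interval i)]
  refine Finset.sum_congr rfl fun i _ => ?_
  rw [lintegral_indicator_const (S.measurableSet_interval i), mul_comm]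
  rfl

lemma lintegral_alloc_le : ∫⁻ h, (S.alloc h : ℝ≥0∞) ∂μT ≤ P :=
  S.lintegral_alloc.trans_le S.power_le

lemma sum_prob_le_one [IsProbabilityMeasure μT] : ∑ i, S.prob i ≤ 1 := by
  have : ∑ i, S.prob i = μT.real (⋃ i ∈ (Finset.univ : Finset (Fin S.d)), S.interval i) := by
    rw [measureReal_biUnion_finset]
    · rfl
    · intro i _ j _ hij
      exact Set.disjoint_left.2 fun h hi hj => hij (S.eq_of_mem_interval hi hj)
    · exact fun i _ => S.measurableSet_interval i
  rw [this]
  exact measureReal_le_one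

lemma prob_nonneg (i : Fin S.d) : 0 ≤ S.prob i := measureReal_nonneg

variable {n : ℕ} {L : Fin S.d → ℕ} {hT : Fin n → ℝ≥0}

lemma mem_active {i : Fin S.d} {t : Fin n} :
    t ∈ S.active L hT i ↔ hT t ∈ S.interval i ∧ S.uses hT i t < L i := by
  simp [active]

lemma eq_of_mem_active {i j : Fin S.d} {t : Fin n} (hi : t ∈ S.active L hT i)
    (hj : t ∈ S.active L hT j) : i = j :=
  S.eq_of_mem_interval (S.mem_active.1 hi).1 (S.mem_active.1 hj).1

open Classical in
lemma uses_strictMonoOn (i : Fin S.d) {s t : Fin n} (hs : hT s ∈ S.interval i) (hst : s < t) :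
    S.uses hT i s < S.uses hT i t := by
  unfold uses
  refine Finset.card_lt_card (Finset.ssubset_iff_of_subset ?_ |>.2 ⟨s, ?_, ?_⟩)
  · intro r hr
    simp only [Finset.mem_filter, Finset.mem_univ, true_and] at hr ⊢
    exact ⟨hr.1.trans hst, hr.2⟩
  · simp [hs, hst]
  · simp

lemma uses_injOn (i : Fin S.d) {s t : Fin n} (hs : hT s ∈ S.interval i)
    (ht : hT t ∈ S.interval i) (h : S.uses hT i s = S.uses hT i t) : s = t := by
  rcases lt_trichotomy s t with h1 | h1 | h1
  · exact absurd h (S.uses_strictMonoOn i hs h1).ne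
  · exact h1
  · exact absurd h (S.uses_strictMonoOn i ht h1).ne'

open Classical in
/-- The number of uses of a subchannel. -/
def totalUses (hT : Fin n → ℝ≥0) (i : Fin S.d) : ℕ :=
  (Finset.univ.filter fun s => hT s ∈ S.interval i).card

-- The counter of earlier uses is injective on the use times and stays below their number, so it
-- enumerates them as `0, 1, 2, …`; the active times are those whose count is below the codeword
-- length.
open Classical in
lemma card_active (i : Fin S.d) :
    (S.active L hT i).card = min (S.totalUses hT i) (L i) := by
  set U := Finset.univ.filter fun s => hT s ∈ S.interval i with hU
  have hinj : Set.InjOn (S.uses hT i) U := fun s hs t ht h =>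
    S.uses_injOn i (by simpa [hU] using hs) (by simpa [hU] using ht) h
  have himg : U.image (S.uses hT i) = Finset.range U.card := by
    refine Finset.eq_of_subset_of_card_le ?_ ?_
    · intro k hk
      obtain ⟨t, ht, rfl⟩ := Finset.mem_image.1 hk
      rw [Finset.mem_range]
      refine Finset.card_lt_card (Finset.ssubset_iff_of_subset ?_ |>.2 ⟨t, ht, by simp⟩)
      intro r hr
      simp only [Finset.mem_filter, Finset.mem_univ, true_and, hU] at hr ⊢
      exact hr.2
    · rw [Finset.card_range, Finset.card_image_of_injOn hinj]
  have hA : S.active L hT i = U.filter fun t => S.uses hT i t < L i := by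
    ext t
    simp [mem_active, hU]
  have himgA : (S.active L hT i).image (S.uses hT i) = Finset.range (min U.card (L i)) := by
    ext k
    rw [hA, Finset.mem_image, Finset.mem_range, lt_min_iff, ← Finset.mem_range, ← himg,
      Finset.mem_image]
    constructor
    · rintro ⟨t, ht, rfl⟩
      rw [Finset.mem_filter] at ht
      exact ⟨⟨t, ht.1, rfl⟩, ht.2⟩
    · rintro ⟨⟨t, ht, rfl⟩, hk⟩
      exact ⟨t, Finset.mem_filter.2 ⟨ht, hk⟩, rfl⟩
  have hinjA : Set.InjOn (S.uses hT i) (S.active L hT i) := hinj.mono (by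
    intro t ht
    rw [Finset.mem_coe, hA] at ht
    exact (Finset.mem_filter.1 ht).1)
  rw [← Finset.card_image_of_injOn hinjA, himgA, Finset.card_range]
  rfl

lemma card_active_le (i : Fin S.d) : (S.active L hT i).card ≤ L i := by
  rw [S.card_active]; exact min_le_right _ _

variable {x : (i : Fin S.d) → Fin (L i) → ℝ}

lemma symbol_of_mem {i : Fin S.d} {t : Fin n} (ht : t ∈ S.active L hT i) :
    S.symbol x hT t = x i ⟨S.uses hT i t, (S.mem_active.1 ht).2⟩ := by
  classical
  unfold symbol
  rw [Finset.sum_eq_single i]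
  · rw [dif_pos (S.mem_active.1 ht)]
  · intro j _ hj
    exact dif_neg fun h => hj (S.eq_of_mem_active (S.mem_active.2 h) ht)
  · simp

lemma symbol_of_notMem {t : Fin n} (ht : ∀ i, t ∉ S.active L hT i) : S.symbol x hT t = 0 := by
  classical
  unfold symbol
  exact Finset.sum_eq_zero fun i _ => dif_neg fun h => ht i (S.mem_active.2 h)

/-- Distinct active times carry distinct positions of the codeword, so a truncated transmission
spends no more than the energy of the whole word. -/
lemma sum_symbol_sq_le (i : Fin S.d) :
    ∑ t ∈ S.active L hT i, S.symbol x hT t ^ 2 ≤ ∑ j, x i j ^ 2 := by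
  classical
  have h1 : ∑ t ∈ S.active L hT i, S.symbol x hT t ^ 2 =
      ∑ t ∈ (S.active L hT i).attach,
        x i ⟨S.uses hT i t, (S.mem_active.1 t.2).2⟩ ^ 2 := by
    rw [← Finset.sum_attach]
    exact Finset.sum_congr rfl fun t _ => by rw [S.symbol_of_mem t.2]
  rw [h1, ← Finset.sum_image (f := fun j => x i j ^ 2)
    (g := fun t : S.active L hT i => (⟨S.uses hT i t, (S.mem_active.1 t.2).2⟩ : Fin (L i)))]
  · exact Finset.sum_le_sum_of_subset_of_nonneg (Finset.subset_univ _) fun _ _ _ => sq_nonneg _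
  · intro s _ t _ h
    exact Subtype.ext (S.uses_injOn i (S.mem_active.1 s.2).1 (S.mem_active.1 t.2).1
      (by simpa using h))

open Classical in
/-- The power assigned to the subchannel whose codeword is being sent at time `t`, `0` if no
codeword is being sent. -/
def slotPower (L : Fin S.d → ℕ) (hT : Fin n → ℝ≥0) (t : Fin n) : ℝ≥0 :=
  ∑ i, if t ∈ S.active L hT i then S.power i else 0

lemma slotPower_of_mem {i : Fin S.d} {t : Fin n} (ht : t ∈ S.active L hT i) :
    S.slotPower L hT t = S.power i := by
  classical
  unfold slotPower
  rw [Finset.sum_eq_single i]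
  · rw [if_pos ht]
  · intro j _ hj
    exact if_neg fun h => hj (S.eq_of_mem_active h ht)
  · simp

lemma slotPower_of_notMem {t : Fin n} (ht : ∀ i, t ∉ S.active L hT i) :
    S.slotPower L hT t = 0 := by
  classical
  unfold slotPower
  exact Finset.sum_eq_zero fun i _ => if_neg (ht i)

/-- The active sets are disjoint: each slot is charged `c`, and each active slot additionally the
term of its own subchannel. -/
lemma sum_le_of_active {Φ : Fin n → ℝ} {ψ : Fin S.d → Fin n → ℝ} {c : ℝ}
    (h1 : ∀ i, ∀ t ∈ S.active L hT i, Φ t ≤ c + ψ i t)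
    (h2 : ∀ t, (∀ i, t ∉ S.active L hT i) → Φ t ≤ c) :
    ∑ t, Φ t ≤ n * c + ∑ i, ∑ t ∈ S.active L hT i, ψ i t := by
  classical
  have h3 : ∀ t, Φ t ≤ c + ∑ i, if t ∈ S.active L hT i then ψ i t else 0 := by
    intro t
    by_cases h : ∃ i, t ∈ S.active L hT i
    · obtain ⟨i, hi⟩ := h
      rw [Finset.sum_eq_single i]
      · rw [if_pos hi]; exact h1 i t hi
      · intro j _ hj
        exact if_neg fun h => hj (S.eq_of_mem_active h hi)
      · simp
    · rw [not_exists] at h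
      rw [Finset.sum_eq_zero fun i _ => if_neg (h i), add_zero]
      exact h2 t h
  refine (Finset.sum_le_sum fun t _ => h3 t).trans (le_of_eq ?_)
  rw [Finset.sum_add_distrib, Finset.sum_comm]
  congr 1
  · simp
  · refine Finset.sum_congr rfl fun i _ => ?_
    rw [← Finset.sum_filter]
    congr 1
    ext t
    simp

/-! ### Dependence on the main-channel gains -/

/-- Two gain sequences visit the same subchannels at the same times. -/
def SamePattern (h h' : Fin n → ℝ≥0) : Prop := ∀ t i, h t ∈ S.interval i ↔ h' t ∈ S.interval i

/-- Such a function factors through the pattern of visited intervals, a measurable map into a finite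
set. -/
lemma measurable_of_samePattern {α : Type*} [MeasurableSpace α] {g : (Fin n → ℝ≥0) → α}
    (hg : ∀ h h', S.SamePattern h h' → g h = g h') : Measurable g := by
  classical
  let pat : (Fin n → ℝ≥0) → (Fin n → Fin S.d → Bool) :=
    fun h t i => decide (h t ∈ S.interval i)
  have hpat : Measurable pat := by
    refine measurable_pi_lambda _ fun t => measurable_pi_lambda _ fun i => ?_
    refine measurable_to_bool ?_
    have : (fun h : Fin n → ℝ≥0 => pat h t i) ⁻¹' {true} =
        (fun h : Fin n → ℝ≥0 => h t) ⁻¹' S.interval i := by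
      ext h
      simp [pat]
    rw [this]
    exact measurable_pi_apply t (S.measurableSet_interval i)
  have hfac : Function.FactorsThrough g pat := by
    intro h h' hh
    refine hg h h' fun t i => ?_
    have := congrFun (congrFun hh t) i
    simpa [pat] using this
  have hext : g = Function.extend pat g (fun _ => g 0) ∘ pat := by
    funext h
    exact (hfac.extend_apply _ h).symm
  rw [hext]
  exact (measurable_of_countable _).comp hpat

variable {S}

lemma SamePattern.uses {h h' : Fin n → ℝ≥0} (H : S.SamePattern h h') (i : Fin S.d) (t : Fin n) :
    S.uses h i t = S.uses h' i t := by
  classical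
  unfold PowerPartition.uses
  congr 1
  ext s
  simp [H s i]

lemma SamePattern.active {h h' : Fin n → ℝ≥0} (H : S.SamePattern h h') (i : Fin S.d) :
    S.active L h i = S.active L h' i := by
  ext t
  rw [mem_active, mem_active, H t i, H.uses]

lemma SamePattern.symbol {h h' : Fin n → ℝ≥0} (H : S.SamePattern h h') (t : Fin n) :
    S.symbol x h t = S.symbol x h' t := by
  by_cases hh : ∃ i, t ∈ S.active L h i
  · obtain ⟨i, hi⟩ := hh
    have hi' : t ∈ S.active L h' i := by rwa [← H.active]
    rw [S.symbol_of_mem hi, S.symbol_of_mem hi']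
    congr 2
    exact H.uses i t
  · rw [S.symbol_of_notMem (not_exists.1 hh), S.symbol_of_notMem fun i hi => hh ⟨i, by rwa [H.active]⟩]

lemma SamePattern.slotPower {h h' : Fin n → ℝ≥0} (H : S.SamePattern h h') (t : Fin n) :
    S.slotPower L h t = S.slotPower L h' t := by
  classical
  unfold PowerPartition.slotPower
  simp [H.active]

variable (S)

lemma measurable_symbol (x : (i : Fin S.d) → Fin (L i) → ℝ) (t : Fin n) :
    Measurable fun h : Fin n → ℝ≥0 => S.symbol x h t :=
  S.measurable_of_samePattern fun _ _ H => H.symbol t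

lemma measurable_slotPower (L : Fin S.d → ℕ) (t : Fin n) :
    Measurable fun h : Fin n → ℝ≥0 => S.slotPower L h t :=
  S.measurable_of_samePattern fun _ _ H => H.slotPower t

end PowerPartition

/-! ### Exponential moments of a single channel use -/

section Letter

/-- Joint law of the eavesdropper's gain and the noise in one channel use. -/
def letterLaw (μE : Measure ℝ≥0) (σ : ℝ≥0) : Measure (ℝ≥0 × ℝ) :=
  μE.prod (gaussianReal 0 (σ ^ 2))

instance (μE : Measure ℝ≥0) [IsProbabilityMeasure μE] (σ : ℝ≥0) :
    IsProbabilityMeasure (letterLaw μE σ) := by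
  unfold letterLaw; infer_instance

/-- Natural-logarithmic rate of the fast-fading channel with power `γ`. -/
def rateNat (μE : Measure ℝ≥0) (σ γ : ℝ≥0) : ℝ :=
  1 / 2 * ∫ h : ℝ≥0, Real.log (1 + (h : ℝ) ^ 2 * γ / (σ : ℝ) ^ 2) ∂μE

/-- Mean normalised squared gain. -/
def meanGain (μE : Measure ℝ≥0) (σ γ : ℝ≥0) : ℝ :=
  ∫ h : ℝ≥0, (h : ℝ) ^ 2 / ((σ : ℝ) ^ 2 + (h : ℝ) ^ 2 * γ) ∂μE

/-- A random variable that dominates the log-likelihood terms of one channel use. -/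
def letterDom (σ γ : ℝ≥0) (b : ℝ) (ω : ℝ≥0 × ℝ) : ℝ :=
  2 * Real.log (1 + (ω.1 : ℝ) ^ 2 * γ / (σ : ℝ) ^ 2) + 4 * (ω.2 ^ 2 / (σ : ℝ) ^ 2) + b

variable {μE : Measure ℝ≥0} {σ : ℝ≥0}

/-- The weight `u²/(4v)` removes only half of the Gaussian exponent `u²/(2v)`. -/
lemma integrable_exp_sq_gaussianReal {v : ℝ≥0} (hv : v ≠ 0) :
    Integrable (fun u : ℝ => Real.exp (1 / (4 * v) * u ^ 2)) (gaussianReal 0 v) := by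
  have hv' : (0 : ℝ) < v := by exact_mod_cast pos_iff_ne_zero.2 hv
  rw [gaussianReal_of_var_ne_zero _ hv,
    integrable_withDensity_iff (measurable_gaussianPDF _ _) (ae_of_all _ fun _ => gaussianPDF_lt_top)]
  have h1 : (fun u : ℝ => Real.exp (1 / (4 * v) * u ^ 2) * (gaussianPDF 0 v u).toReal) =
      fun u => (√(2 * Real.pi * v))⁻¹ * Real.exp (-(1 / (4 * v)) * u ^ 2) := by
    funext u
    rw [toReal_gaussianPDF, gaussianPDFReal, mul_left_comm, ← Real.exp_add]
    congr 2
    field_simp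
    ring
  rw [h1]
  exact (integrable_exp_neg_mul_sq (by positivity)).const_mul _

lemma log_snr_nonneg (h γ : ℝ≥0) : 0 ≤ Real.log (1 + (h : ℝ) ^ 2 * γ / (σ : ℝ) ^ 2) :=
  Real.log_nonneg (by linarith [show 0 ≤ (h : ℝ) ^ 2 * γ / (σ : ℝ) ^ 2 by positivity])

lemma letterDom_nonneg {γ : ℝ≥0} {b : ℝ} (hb : 0 ≤ b) (ω : ℝ≥0 × ℝ) :
    0 ≤ letterDom σ γ b ω := by
  unfold letterDom
  have := log_snr_nonneg (σ := σ) ω.1 γ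
  positivity

lemma measurable_letterDom (γ : ℝ≥0) (b : ℝ) : Measurable (letterDom σ γ b) := by
  unfold letterDom
  fun_prop

lemma integrable_gain (hE : Integrable (fun h : ℝ≥0 => (h : ℝ) ^ 2) μE) (hσ : 0 < σ) (γ : ℝ≥0) :
    Integrable (fun h : ℝ≥0 => (h : ℝ) ^ 2 / ((σ : ℝ) ^ 2 + (h : ℝ) ^ 2 * γ)) μE := by
  have hσ' : (0 : ℝ) < σ := hσ
  refine (hE.div_const ((σ : ℝ) ^ 2)).mono' (Measurable.aestronglyMeasurable (by fun_prop)) (ae_of_all _ fun h => ?_)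
  rw [Real.norm_of_nonneg (by positivity)]
  gcongr
  linarith [show 0 ≤ (h : ℝ) ^ 2 * γ by positivity]

lemma integrable_log_snr (hE : Integrable (fun h : ℝ≥0 => (h : ℝ) ^ 2) μE) (γ : ℝ≥0) :
    Integrable (fun h : ℝ≥0 => Real.log (1 + (h : ℝ) ^ 2 * γ / (σ : ℝ) ^ 2)) μE := by
  refine ((hE.mul_const (γ : ℝ)).div_const ((σ : ℝ) ^ 2)).mono' (Measurable.aestronglyMeasurable (by fun_prop))
    (ae_of_all _ fun h => ?_)
  rw [Real.norm_of_nonneg (log_snr_nonneg h γ)]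
  have := Real.log_le_sub_one_of_pos (x := 1 + (h : ℝ) ^ 2 * γ / (σ : ℝ) ^ 2) (by positivity)
  linarith

lemma meanGain_nonneg (γ : ℝ≥0) : 0 ≤ meanGain μE σ γ :=
  integral_nonneg fun h => by positivity

/-- This is `1 - 1/x ≤ log x` at `x = 1 + h²γ/σ²`, integrated. It makes the mean log-ratio
nonnegative for every symbol, and lets the number of slots used be replaced by the planned length.
-/
lemma mul_meanGain_le_rateNat (hE : Integrable (fun h : ℝ≥0 => (h : ℝ) ^ 2) μE) (hσ : 0 < σ)
    (γ : ℝ≥0) : γ * meanGain μE σ γ / 2 ≤ rateNat μE σ γ := by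
  have hσ' : (0 : ℝ) < σ := hσ
  unfold meanGain rateNat
  have : γ * ∫ h : ℝ≥0, (h : ℝ) ^ 2 / ((σ : ℝ) ^ 2 + (h : ℝ) ^ 2 * γ) ∂μE ≤
      ∫ h : ℝ≥0, Real.log (1 + (h : ℝ) ^ 2 * γ / (σ : ℝ) ^ 2) ∂μE := by
    rw [← integral_const_mul]
    refine integral_mono ((integrable_gain hE hσ γ).const_mul _) (integrable_log_snr hE γ)
      fun h => ?_
    have h1 := Real.one_sub_inv_le_log_of_pos (x := 1 + (h : ℝ) ^ 2 * γ / (σ : ℝ) ^ 2)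
      (by positivity)
    refine le_trans (le_of_eq ?_) h1
    field_simp
    ring
  linarith

/-- Split `(hs+u)² ≤ 2h²s² + 2u²`; the denominator dominates both `h²γ` and `σ²`, so the signal part
is bounded independently of the gain. -/
lemma sq_div_le {γ : ℝ≥0} {a s : ℝ} (hσ : 0 < σ) (hs : |s| ≤ a) (h0 : γ = 0 → s = 0)
    (ω : ℝ≥0 × ℝ) :
    (ω.1 * s + ω.2) ^ 2 / ((σ : ℝ) ^ 2 + (ω.1 : ℝ) ^ 2 * γ) ≤
      2 * a ^ 2 / γ + 2 * (ω.2 ^ 2 / (σ : ℝ) ^ 2) := by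
  obtain ⟨h, u⟩ := ω
  have hσ' : (0 : ℝ) < σ := hσ
  have hd : (σ : ℝ) ^ 2 ≤ (σ : ℝ) ^ 2 + (h : ℝ) ^ 2 * γ := by
    linarith [show 0 ≤ (h : ℝ) ^ 2 * γ by positivity]
  have hd0 : 0 < (σ : ℝ) ^ 2 + (h : ℝ) ^ 2 * γ := by positivity
  have h1 : (h * s + u) ^ 2 ≤ 2 * ((h : ℝ) ^ 2 * s ^ 2) + 2 * u ^ 2 := by
    nlinarith [sq_nonneg (h * s - u)]
  have h2 : 2 * u ^ 2 / ((σ : ℝ) ^ 2 + (h : ℝ) ^ 2 * γ) ≤ 2 * (u ^ 2 / (σ : ℝ) ^ 2) := by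
    rw [← mul_div_assoc]
    gcongr
  have h3 : 2 * ((h : ℝ) ^ 2 * s ^ 2) / ((σ : ℝ) ^ 2 + (h : ℝ) ^ 2 * γ) ≤ 2 * a ^ 2 / γ := by
    -- At zero power the symbol vanishes, and `2a²/γ` is `0` by the convention for division by zero.
    by_cases hγ : γ = 0
    · simp [h0 hγ, hγ]
    · have hγ' : (0 : ℝ) < γ := by exact_mod_cast pos_iff_ne_zero.2 hγ
      rw [div_le_div_iff₀ hd0 hγ']
      have : s ^ 2 ≤ a ^ 2 := sq_le_sq' (abs_le.1 hs).1 (abs_le.1 hs).2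
      nlinarith [mul_le_mul_of_nonneg_left this (by positivity : 0 ≤ (h : ℝ) ^ 2 * γ),
        mul_nonneg (sq_nonneg a) (sq_nonneg (σ : ℝ))]
  calc _ ≤ (2 * ((h : ℝ) ^ 2 * s ^ 2) + 2 * u ^ 2) / ((σ : ℝ) ^ 2 + (h : ℝ) ^ 2 * γ) := by gcongr
    _ ≤ _ := by rw [add_div]; exact add_le_add h3 h2

/-- Bound valid for each of the log-likelihood terms of one channel use. -/
lemma terms_le_letterDom {γ : ℝ≥0} {a s : ℝ} (hσ : 0 < σ) (hs : |s| ≤ a) (h0 : γ = 0 → s = 0)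
    (ω : ℝ≥0 × ℝ) :
    |(ω.1 * s + ω.2) ^ 2 / ((σ : ℝ) ^ 2 + (ω.1 : ℝ) ^ 2 * γ)| + |ω.2 ^ 2 / (σ : ℝ) ^ 2| +
      2 * |Real.log (1 + (ω.1 : ℝ) ^ 2 * γ / (σ : ℝ) ^ 2)| ≤ letterDom σ γ (2 * a ^ 2 / γ) ω := by
  have h1 := sq_div_le hσ hs h0 ω
  have h2 := log_snr_nonneg (σ := σ) ω.1 γ
  have h3 : 0 ≤ ω.2 ^ 2 / (σ : ℝ) ^ 2 := by positivity
  rw [abs_of_nonneg (by positivity), abs_of_nonneg h3, abs_of_nonneg h2]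
  unfold letterDom
  linarith

variable [IsProbabilityMeasure μE]

/-- With exponent `1/16` the noise enters as `u²/(4σ²)`, below the Gaussian threshold `u²/(2σ²)`,
and the gain enters as a power `1/8` of `1 + h²γ/σ²`, which the second moment controls. -/
lemma integrable_exp_letterDom (hE : Integrable (fun h : ℝ≥0 => (h : ℝ) ^ 2) μE) (hσ : 0 < σ)
    (γ : ℝ≥0) (b : ℝ) :
    Integrable (fun ω => Real.exp (1 / 16 * letterDom σ γ b ω)) (letterLaw μE σ) := by
  have h1 : Integrable (fun h : ℝ≥0 =>
      Real.exp (1 / 8 * Real.log (1 + (h : ℝ) ^ 2 * γ / (σ : ℝ) ^ 2))) μE := by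
    have hi : Integrable (fun h : ℝ≥0 => 1 + (h : ℝ) ^ 2 * (γ / (σ : ℝ) ^ 2)) μE :=
      (integrable_const 1).add (hE.mul_const _)
    refine hi.mono' (Measurable.aestronglyMeasurable (by fun_prop)) (ae_of_all _ fun h => ?_)
    rw [Real.norm_of_nonneg (Real.exp_pos _).le, ← mul_div_assoc]
    have h0 : 0 ≤ (h : ℝ) ^ 2 * γ / (σ : ℝ) ^ 2 := by positivity
    calc _ ≤ Real.exp (Real.log (1 + (h : ℝ) ^ 2 * γ / (σ : ℝ) ^ 2)) := by
          rw [Real.exp_le_exp]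
          linarith [log_snr_nonneg (σ := σ) h γ]
      _ = _ := Real.exp_log (by linarith)
  have h2 := integrable_exp_sq_gaussianReal (v := σ ^ 2) (by positivity)
  have h3 := (h1.mul_prod h2).const_mul (Real.exp (b / 16))
  refine h3.congr (ae_of_all _ fun ω => ?_)
  simp only [letterDom]
  rw [← Real.exp_add, ← Real.exp_add]
  congr 1
  push_cast
  field_simp
  ring

/-- Exponential moment bound, uniform over all functions of one channel use that are dominated by
`letterDom`. -/
lemma exists_letter_mgf_bound (hE : Integrable (fun h : ℝ≥0 => (h : ℝ) ^ 2) μE) (hσ : 0 < σ)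
    (γ : ℝ≥0) {b : ℝ} (hb : 0 ≤ b) :
    Integrable (letterDom σ γ b) (letterLaw μE σ) ∧
    ∃ V : ℝ, 0 ≤ V ∧ ∀ l : ℝ, 0 ≤ l → l ≤ 1 / 32 → ∀ f : ℝ≥0 × ℝ → ℝ, Measurable f →
      (∀ ω, |f ω| ≤ letterDom σ γ b ω) →
      ∫⁻ ω, ENNReal.ofReal (Real.exp (l * f ω)) ∂(letterLaw μE σ)
        ≤ ENNReal.ofReal (Real.exp (l * ∫ ω, f ω ∂(letterLaw μE σ) + l ^ 2 * V)) := by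
  obtain ⟨h1, V, hV, h⟩ := exists_mgf_bound (letterLaw μE σ) (θ := 1 / 16) (by norm_num)
    (letterDom_nonneg (σ := σ) (γ := γ) hb) (measurable_letterDom γ b)
    (integrable_exp_letterDom hE hσ γ b)
  exact ⟨h1, V, hV, fun l hl hl' => h l hl (by linarith)⟩

/-- This limits the effect of the unsent part of a codeword: energy `γ` per missing symbol shifts
the mean of the normalised output power by at most one. -/
lemma mul_meanGain_le_one (hE : Integrable (fun h : ℝ≥0 => (h : ℝ) ^ 2) μE) (hσ : 0 < σ)
    (γ : ℝ≥0) : γ * meanGain μE σ γ ≤ 1 := by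
  have hσ' : (0 : ℝ) < σ := hσ
  unfold meanGain
  rw [← integral_const_mul]
  calc _ ≤ ∫ _ : ℝ≥0, (1 : ℝ) ∂μE := by
        refine integral_mono ((integrable_gain hE hσ γ).const_mul _) (integrable_const 1) fun h => ?_
        simp only
        rw [← mul_div_assoc, div_le_one (by positivity)]
        nlinarith
    _ = 1 := by simp

lemma integral_sq_gaussianReal (v : ℝ≥0) : ∫ u, u ^ 2 ∂(gaussianReal 0 v) = v := by
  have h := variance_id_gaussianReal (μ := 0) (v := v)
  rw [variance_eq_sub (memLp_id_gaussianReal 2)] at h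
  simpa using h

lemma integrable_sq_gaussianReal (v : ℝ≥0) : Integrable (fun u => u ^ 2) (gaussianReal 0 v) :=
  (memLp_id_gaussianReal 2).integrable_sq

lemma integral_letterLaw_fst (f : ℝ≥0 → ℝ) :
    ∫ ω, f ω.1 ∂(letterLaw μE σ) = ∫ h, f h ∂μE := by
  unfold letterLaw
  rw [integral_fun_fst]
  simp

lemma integral_letterLaw_noise_sq (hσ : 0 < σ) :
    ∫ ω, ω.2 ^ 2 / (σ : ℝ) ^ 2 ∂(letterLaw μE σ) = 1 := by
  have hσ' : (σ : ℝ) ≠ 0 := by exact_mod_cast hσ.ne'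
  unfold letterLaw
  rw [integral_fun_snd (fun u : ℝ => u ^ 2 / (σ : ℝ) ^ 2), integral_div,
    integral_sq_gaussianReal]
  simp [hσ']

lemma integrable_letter_sq (hE : Integrable (fun h : ℝ≥0 => (h : ℝ) ^ 2) μE) (hσ : 0 < σ)
    {γ : ℝ≥0} {s : ℝ} (h0 : γ = 0 → s = 0) :
    Integrable (fun ω : ℝ≥0 × ℝ => (ω.1 * s + ω.2) ^ 2 / ((σ : ℝ) ^ 2 + (ω.1 : ℝ) ^ 2 * γ))
      (letterLaw μE σ) := by
  refine (exists_letter_mgf_bound hE hσ γ (b := 2 * |s| ^ 2 / γ) (by positivity)).1.mono'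
    (Measurable.aestronglyMeasurable (by fun_prop)) (ae_of_all _ fun ω => ?_)
  have := terms_le_letterDom hσ (le_refl |s|) h0 ω
  rw [Real.norm_eq_abs]
  linarith [abs_nonneg (ω.2 ^ 2 / (σ : ℝ) ^ 2),
    abs_nonneg (Real.log (1 + (ω.1 : ℝ) ^ 2 * γ / (σ : ℝ) ^ 2))]

/-- Given the gain, the second moment of the output is `h²s² + σ² = (σ² + h²γ) + h²(s² - γ)`. -/
lemma integral_letter_sq (hE : Integrable (fun h : ℝ≥0 => (h : ℝ) ^ 2) μE) (hσ : 0 < σ)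
    {γ : ℝ≥0} {s : ℝ} (h0 : γ = 0 → s = 0) :
    ∫ ω, (ω.1 * s + ω.2) ^ 2 / ((σ : ℝ) ^ 2 + (ω.1 : ℝ) ^ 2 * γ) ∂(letterLaw μE σ) =
      1 + (s ^ 2 - γ) * meanGain μE σ γ := by
  have hσ' : (0 : ℝ) < σ := hσ
  have hi := integrable_letter_sq hE hσ h0
  unfold letterLaw at hi ⊢
  rw [integral_prod _ hi]
  have h1 : ∀ h : ℝ≥0, ∫ u, (h * s + u) ^ 2 / ((σ : ℝ) ^ 2 + (h : ℝ) ^ 2 * γ)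
      ∂(gaussianReal 0 (σ ^ 2)) =
      1 + (s ^ 2 - γ) * ((h : ℝ) ^ 2 / ((σ : ℝ) ^ 2 + (h : ℝ) ^ 2 * γ)) := by
    intro h
    rw [integral_div]
    have h2 : ∀ u : ℝ, (h * s + u) ^ 2 = ((h * s) ^ 2 + 2 * (h * s) * u) + u ^ 2 := fun u => by ring
    have hid : Integrable (fun u : ℝ => u) (gaussianReal 0 (σ ^ 2)) :=
      (memLp_id_gaussianReal 1).integrable le_rfl
    have hid2 : ∫ u : ℝ, u ∂(gaussianReal 0 (σ ^ 2)) = 0 := integral_id_gaussianReal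
    simp_rw [h2]
    have hi1 : Integrable (fun u : ℝ => (h * s) ^ 2 + 2 * (h * s) * u) (gaussianReal 0 (σ ^ 2)) :=
      (integrable_const _).add (hid.const_mul _)
    rw [integral_add hi1 (integrable_sq_gaussianReal _),
      integral_add (integrable_const _) (hid.const_mul _), integral_const_mul, hid2,
      integral_sq_gaussianReal]
    simp
    field_simp
    ring
  simp_rw [h1]
  rw [integral_add (integrable_const _) ((integrable_gain hE hσ γ).const_mul _),
    integral_const_mul]
  simp [meanGain]

end Letter

/-! ### The auxiliary output density -/

section OutPDF

/-- Mixture of the output density for a Gaussian input of power `γ` and a Cauchy density, which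
accounts for symbols of large amplitude. -/
def outPDF (κ : ℝ) (σ γ h : ℝ≥0) (z : ℝ) : ℝ :=
  (1 - κ) * gaussianPDFReal 0 (σ ^ 2 + h ^ 2 * γ) z + κ * cauchyPDFReal 0 σ z

/-- Log-likelihood ratio between the channel with input `s` and the auxiliary output density. -/
def infoDensity (κ : ℝ) (σ γ : ℝ≥0) (s : ℝ) (h : ℝ≥0) (z : ℝ) : ℝ :=
  Real.log (gaussianPDFReal (h * s) (σ ^ 2) z / outPDF κ σ γ h z)

variable {μE : Measure ℝ≥0} {σ : ℝ≥0} {κ : ℝ}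

lemma measurable_gaussianPDFReal_comp {α : Type*} [MeasurableSpace α] {m z : α → ℝ} {v : α → ℝ≥0}
    (hm : Measurable m) (hv : Measurable v) (hz : Measurable z) :
    Measurable fun a => gaussianPDFReal (m a) (v a) (z a) :=
  measurable_uncurry_gaussianPDFReal.comp (hm.prodMk (hv.prodMk hz))

lemma measurable_outPDF_comp {α : Type*} [MeasurableSpace α] {γ h : α → ℝ≥0} {z : α → ℝ}
    (hγ : Measurable γ) (hh : Measurable h) (hz : Measurable z) :
    Measurable fun a => outPDF κ σ (γ a) (h a) (z a) := by
  unfold outPDF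
  refine Measurable.add (Measurable.const_mul ?_ _) (Measurable.const_mul ?_ _)
  · exact measurable_gaussianPDFReal_comp measurable_const (by fun_prop) hz
  · exact (measurable_cauchyPDFReal 0 σ).comp hz

lemma measurable_infoDensity_comp {α : Type*} [MeasurableSpace α] {γ h : α → ℝ≥0} {s z : α → ℝ}
    (hγ : Measurable γ) (hs : Measurable s) (hh : Measurable h) (hz : Measurable z) :
    Measurable fun a => infoDensity κ σ (γ a) (s a) (h a) (z a) := by
  unfold infoDensity
  exact Real.measurable_log.comp (Measurable.div
    (measurable_gaussianPDFReal_comp (by fun_prop) measurable_const hz)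
    (measurable_outPDF_comp hγ hh hz))

lemma outPDF_pos (hσ : 0 < σ) (h0 : 0 < κ) (h1 : κ < 1) (γ h : ℝ≥0) (z : ℝ) :
    0 < outPDF κ σ γ h z := by
  unfold outPDF
  have := gaussianPDFReal_pos 0 (σ ^ 2 + h ^ 2 * γ) z (by positivity)
  have := cauchyPDF_pos 0 hσ.ne' z
  have : 0 < 1 - κ := by linarith
  positivity

lemma lintegral_outPDF (hσ : 0 < σ) (h0 : 0 < κ) (h1 : κ < 1) (γ h : ℝ≥0) :
    ∫⁻ z, ENNReal.ofReal (outPDF κ σ γ h z) = 1 := by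
  have hv : σ ^ 2 + h ^ 2 * γ ≠ 0 := by positivity
  have hi1 := (integrable_gaussianPDFReal 0 (σ ^ 2 + h ^ 2 * γ)).const_mul (1 - κ)
  have hi2 := (integrable_cauchyPDFReal 0 (γ := σ)).const_mul κ
  have hi : Integrable fun z => outPDF κ σ γ h z := hi1.add hi2
  rw [← ofReal_integral_eq_lintegral_ofReal hi
    (ae_of_all _ fun z => (outPDF_pos hσ h0 h1 γ h z).le)]
  unfold outPDF
  rw [integral_add hi1 hi2, integral_const_mul, integral_const_mul,
    integral_gaussianPDFReal_eq_one _ hv, integral_cauchyPDFReal_eq_one _ hσ.ne']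
  simp

lemma log_gaussianPDFReal_div (m z : ℝ) {v v' : ℝ≥0} (hv : 0 < v) (hv' : 0 < v') :
    Real.log (gaussianPDFReal m v z / gaussianPDFReal 0 v' z) =
      1 / 2 * Real.log v' - 1 / 2 * Real.log v - (z - m) ^ 2 / (2 * v) + z ^ 2 / (2 * v') := by
  have hv1 : (0 : ℝ) < v := hv
  have hv2 : (0 : ℝ) < v' := hv'
  have hp := Real.pi_pos
  rw [gaussianPDFReal, gaussianPDFReal, Real.log_div (by positivity) (by positivity),
    Real.log_mul (by positivity) (by positivity), Real.log_mul (by positivity) (by positivity),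
    Real.log_exp, Real.log_exp, Real.log_inv, Real.log_inv, Real.log_sqrt (by positivity),
    Real.log_sqrt (by positivity), Real.log_mul (x := 2 * Real.pi) (by positivity) (by positivity),
    Real.log_mul (x := 2 * Real.pi) (by positivity) (by positivity)]
  ring

/-- The variance of the reference density carries a factor `α`: `α = 1` serves the smooth bounds, `α
= 1 + δ` the product typical sets. -/
lemma log_gaussian_ratio_mul (hσ : 0 < σ) {α : ℝ≥0} (hα : 0 < α) (γ h : ℝ≥0)
    (s z : ℝ) :
    Real.log (gaussianPDFReal (h * s) (σ ^ 2) z / gaussianPDFReal 0 (α * (σ ^ 2 + h ^ 2 * γ)) z) =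
      1 / 2 * Real.log α + (1 / 2 * Real.log (1 + (h : ℝ) ^ 2 * γ / (σ : ℝ) ^ 2) -
        (z - h * s) ^ 2 / (2 * (σ : ℝ) ^ 2) +
        z ^ 2 / ((σ : ℝ) ^ 2 + (h : ℝ) ^ 2 * γ) / (2 * α)) := by
  have hσ' : (0 : ℝ) < σ := hσ
  have hα' : (0 : ℝ) < α := hα
  have hv : 0 < (σ : ℝ) ^ 2 + (h : ℝ) ^ 2 * γ := by positivity
  have e1 : 1 + (h : ℝ) ^ 2 * γ / (σ : ℝ) ^ 2 = ((σ : ℝ) ^ 2 + (h : ℝ) ^ 2 * γ) / (σ : ℝ) ^ 2 := by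
    field_simp
  rw [log_gaussianPDFReal_div _ _ (by positivity) (by positivity)]
  push_cast
  rw [Real.log_mul (by positivity) (by positivity), e1,
    Real.log_div (by positivity) (by positivity)]
  have e2 : z ^ 2 / (2 * ((α : ℝ) * ((σ : ℝ) ^ 2 + (h : ℝ) ^ 2 * γ))) =
      z ^ 2 / ((σ : ℝ) ^ 2 + (h : ℝ) ^ 2 * γ) / (2 * α) := by
    rw [div_div]; congr 1; ring
  rw [e2]
  ring

lemma log_gaussian_ratio (hσ : 0 < σ) (γ h : ℝ≥0) (s u : ℝ) :
    Real.log (gaussianPDFReal (h * s) (σ ^ 2) (h * s + u) /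
      gaussianPDFReal 0 (σ ^ 2 + h ^ 2 * γ) (h * s + u)) =
      1 / 2 * Real.log (1 + (h : ℝ) ^ 2 * γ / (σ : ℝ) ^ 2) - 1 / 2 * (u ^ 2 / (σ : ℝ) ^ 2) +
        1 / 2 * ((h * s + u) ^ 2 / ((σ : ℝ) ^ 2 + (h : ℝ) ^ 2 * γ)) := by
  have h := log_gaussian_ratio_mul hσ one_pos γ h s (h * s + u)
  simp only [one_mul, NNReal.coe_one, Real.log_one, mul_zero, zero_add, add_sub_cancel_left] at h
  rw [h]
  ring

/-- Dropping the Cauchy component costs only `-log(1-κ)`. This bound is sharp in the mean and is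
used for moderate symbols. -/
lemma infoDensity_le_gaussian (hσ : 0 < σ) (h0 : 0 < κ) (h1 : κ < 1) (γ h : ℝ≥0) (s u : ℝ) :
    infoDensity κ σ γ s h (h * s + u) ≤ -Real.log (1 - κ) +
      (1 / 2 * Real.log (1 + (h : ℝ) ^ 2 * γ / (σ : ℝ) ^ 2) - 1 / 2 * (u ^ 2 / (σ : ℝ) ^ 2) +
        1 / 2 * ((h * s + u) ^ 2 / ((σ : ℝ) ^ 2 + (h : ℝ) ^ 2 * γ))) := by
  have hw := gaussianPDFReal_pos (h * s) (σ ^ 2) (h * s + u) (by positivity)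
  have hg := gaussianPDFReal_pos 0 (σ ^ 2 + h ^ 2 * γ) (h * s + u) (by positivity)
  have hc := cauchyPDF_pos 0 hσ.ne' (h * s + u)
  have hk : 0 < 1 - κ := by linarith
  rw [← log_gaussian_ratio hσ, ← Real.log_inv, ← Real.log_mul (by positivity) (by positivity)]
  unfold infoDensity
  refine Real.log_le_log (div_pos hw (outPDF_pos hσ h0 h1 _ _ _)) ?_
  rw [inv_mul_eq_div, div_div, mul_comm _ (1 - κ)]
  refine div_le_div_of_nonneg_left hw.le (by positivity) ?_
  unfold outPDF
  linarith [mul_pos h0 hc]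

/-- The Cauchy density decays only quadratically, so after centring at `hs` the ratio grows
polynomially in `s` and `h`, while the Gaussian factor of the channel absorbs the noise. This bound
is used for large symbols. -/
lemma infoDensity_le_cauchy (hσ : 0 < σ) (h0 : 0 < κ) (h1 : κ < 1) (γ h : ℝ≥0) (s u : ℝ) :
    infoDensity κ σ γ s h (h * s + u) ≤
      Real.log (10 / κ) + Real.log (1 + s ^ 2) + Real.log (1 + (h : ℝ) ^ 2 / (σ : ℝ) ^ 2) := by
  have hσ' : (0 : ℝ) < σ := hσ
  have hp := Real.pi_pos
  have hw := gaussianPDFReal_pos (h * s) (σ ^ 2) (h * s + u) (by positivity)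
  have hg := gaussianPDFReal_pos 0 (σ ^ 2 + h ^ 2 * γ) (h * s + u) (by positivity)
  have hc := cauchyPDF_pos 0 hσ.ne' (h * s + u)
  rw [← Real.log_mul (by positivity) (by positivity),
    ← Real.log_mul (by positivity) (by positivity)]
  unfold infoDensity
  have hpos := outPDF_pos hσ h0 h1 γ h (h * s + u)
  refine Real.log_le_log (div_pos hw hpos) ?_
  rw [div_le_iff₀ hpos]
  have hle : κ * cauchyPDFReal 0 σ (h * s + u) ≤ outPDF κ σ γ h (h * s + u) := by
    unfold outPDF
    nlinarith
  refine le_trans ?_ (mul_le_mul_of_nonneg_left hle (by positivity))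
  rw [gaussianPDFReal, cauchyPDFReal_def]
  push_cast
  simp only [add_sub_cancel_left, sub_zero]
  set x : ℝ := u ^ 2 / (2 * (σ : ℝ) ^ 2) with hx
  have hx0 : 0 ≤ x := by positivity
  have hu : u ^ 2 = 2 * (σ : ℝ) ^ 2 * x := by rw [hx]; field_simp
  have hex : Real.exp (-u ^ 2 / (2 * (σ : ℝ) ^ 2)) = Real.exp (-x) := by rw [hx, neg_div]
  have he1 : Real.exp (-x) ≤ 1 := Real.exp_le_one_iff.2 (by linarith)
  have he2 : x * Real.exp (-x) ≤ 1 := by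
    rw [Real.exp_neg, ← div_eq_mul_inv, div_le_one (Real.exp_pos _)]
    linarith [Real.add_one_le_exp x]
  have hsq : (√(2 * Real.pi * (σ : ℝ) ^ 2))⁻¹ ≤ (2 * (σ : ℝ))⁻¹ := by
    refine inv_anti₀ (by positivity) (Real.le_sqrt_of_sq_le ?_)
    nlinarith [Real.pi_gt_three, sq_pos_of_pos hσ']
  have hD : 0 < (h * s + u) ^ 2 + (σ : ℝ) ^ 2 := by positivity
  have hz : (h * s + u) ^ 2 + (σ : ℝ) ^ 2 ≤
      2 * ((h : ℝ) ^ 2 * s ^ 2) + (σ : ℝ) ^ 2 * (1 + 4 * x) := by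
    nlinarith [sq_nonneg (h * s - u)]
  have key : Real.exp (-x) * ((h * s + u) ^ 2 + (σ : ℝ) ^ 2) ≤
      5 * (σ : ℝ) ^ 2 * ((1 + s ^ 2) * (1 + (h : ℝ) ^ 2 / (σ : ℝ) ^ 2)) := by
    have e0 := Real.exp_pos (-x)
    have a1 : Real.exp (-x) * ((h * s + u) ^ 2 + (σ : ℝ) ^ 2) ≤
        Real.exp (-x) * (2 * ((h : ℝ) ^ 2 * s ^ 2) + (σ : ℝ) ^ 2 * (1 + 4 * x)) :=
      mul_le_mul_of_nonneg_left hz e0.le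
    have a2 : Real.exp (-x) * (2 * ((h : ℝ) ^ 2 * s ^ 2)) ≤ 2 * ((h : ℝ) ^ 2 * s ^ 2) :=
      mul_le_of_le_one_left (by positivity) he1
    have a3 : Real.exp (-x) * (1 + 4 * x) ≤ 5 := by linarith
    have a4 : (σ : ℝ) ^ 2 * (Real.exp (-x) * (1 + 4 * x)) ≤ (σ : ℝ) ^ 2 * 5 :=
      mul_le_mul_of_nonneg_left a3 (by positivity)
    have a5 : 5 * (σ : ℝ) ^ 2 * ((1 + s ^ 2) * (1 + (h : ℝ) ^ 2 / (σ : ℝ) ^ 2)) =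
        5 * (1 + s ^ 2) * ((σ : ℝ) ^ 2 + (h : ℝ) ^ 2) := by field_simp
    rw [a5]
    nlinarith [mul_nonneg (sq_nonneg (h : ℝ)) (sq_nonneg s), sq_nonneg (h : ℝ),
      mul_nonneg (sq_nonneg (σ : ℝ)) (sq_nonneg s)]
  rw [hex]
  have hpi : Real.pi < 4 := Real.pi_lt_four
  -- The factor 5 comes from `e⁻ˣ ≤ 1` and `x e⁻ˣ ≤ 1`; then `5σ²/(2σ) = 10σ/4`, and `1/4 ≤ 1/π`
  -- yields the constant 10.
  calc (√(2 * Real.pi * (σ : ℝ) ^ 2))⁻¹ * Real.exp (-x)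
      ≤ (2 * (σ : ℝ))⁻¹ * Real.exp (-x) :=
        mul_le_mul_of_nonneg_right hsq (Real.exp_pos _).le
    _ = (2 * (σ : ℝ))⁻¹ * (Real.exp (-x) * ((h * s + u) ^ 2 + (σ : ℝ) ^ 2)) *
          ((h * s + u) ^ 2 + (σ : ℝ) ^ 2)⁻¹ := by field_simp
    _ ≤ (2 * (σ : ℝ))⁻¹ * (5 * (σ : ℝ) ^ 2 * ((1 + s ^ 2) * (1 + (h : ℝ) ^ 2 / (σ : ℝ) ^ 2))) *
          ((h * s + u) ^ 2 + (σ : ℝ) ^ 2)⁻¹ := by gcongr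
    _ = 10 * (4 : ℝ)⁻¹ * (σ * ((1 + s ^ 2) * (1 + (h : ℝ) ^ 2 / (σ : ℝ) ^ 2)) *
          ((h * s + u) ^ 2 + (σ : ℝ) ^ 2)⁻¹) := by field_simp; ring
    _ ≤ 10 * Real.pi⁻¹ * (σ * ((1 + s ^ 2) * (1 + (h : ℝ) ^ 2 / (σ : ℝ) ^ 2)) *
          ((h * s + u) ^ 2 + (σ : ℝ) ^ 2)⁻¹) := by
        refine mul_le_mul_of_nonneg_right ?_ (by positivity)
        exact mul_le_mul_of_nonneg_left (inv_anti₀ hp hpi.le) (by norm_num)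
    _ = _ := by field_simp

variable [IsProbabilityMeasure μE]

/-- For `0 ≤ l ≤ 1`, Bernoulli's inequality `(1+y)^l ≤ 1 + ly` replaces the exponential moment of
the logarithm by the second moment of the gain. -/
lemma lintegral_exp_log_gain_le (hE : Integrable (fun h : ℝ≥0 => (h : ℝ) ^ 2) μE) {l : ℝ}
    (hl0 : 0 ≤ l) (hl1 : l ≤ 1) (c : ℝ) :
    ∫⁻ ω, ENNReal.ofReal (Real.exp (l * (c + Real.log (1 + (ω.1 : ℝ) ^ 2 / (σ : ℝ) ^ 2))))
      ∂(letterLaw μE σ) ≤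
      ENNReal.ofReal (Real.exp (l * (c + ∫ h : ℝ≥0, (h : ℝ) ^ 2 / (σ : ℝ) ^ 2 ∂μE))) := by
  have hpt : ∀ h : ℝ≥0, Real.exp (l * (c + Real.log (1 + (h : ℝ) ^ 2 / (σ : ℝ) ^ 2))) ≤
      Real.exp (l * c) * (1 + l * ((h : ℝ) ^ 2 / (σ : ℝ) ^ 2)) := by
    intro h
    have h0 : 0 ≤ (h : ℝ) ^ 2 / (σ : ℝ) ^ 2 := by positivity
    rw [mul_add, Real.exp_add, mul_comm l (Real.log _), Real.exp_mul (Real.log _),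
      Real.exp_log (by linarith)]
    gcongr
    exact rpow_one_add_le_one_add_mul_self (by linarith) hl0 hl1
  have hi : Integrable (fun h : ℝ≥0 => Real.exp (l * c) * (1 + l * ((h : ℝ) ^ 2 / (σ : ℝ) ^ 2)))
      μE := ((integrable_const 1).add ((hE.div_const _).const_mul l)).const_mul _
  unfold letterLaw
  calc _ ≤ ∫⁻ ω, ENNReal.ofReal (Real.exp (l * c) * (1 + l * ((ω.1 : ℝ) ^ 2 / (σ : ℝ) ^ 2)))
        ∂(μE.prod (gaussianReal 0 (σ ^ 2))) :=
        lintegral_mono fun ω => ENNReal.ofReal_le_ofReal (hpt ω.1)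
    _ = ∫⁻ h : ℝ≥0, ENNReal.ofReal (Real.exp (l * c) * (1 + l * ((h : ℝ) ^ 2 / (σ : ℝ) ^ 2)))
        ∂μE := by
        rw [lintegral_prod _ (by fun_prop)]
        simp
    _ = ENNReal.ofReal (∫ h : ℝ≥0, Real.exp (l * c) * (1 + l * ((h : ℝ) ^ 2 / (σ : ℝ) ^ 2)) ∂μE) :=
        (ofReal_integral_eq_lintegral_ofReal hi (ae_of_all _ fun h => by positivity)).symm
    _ ≤ _ := by
        refine ENNReal.ofReal_le_ofReal ?_
        rw [integral_const_mul, integral_add (integrable_const 1) ((hE.div_const _).const_mul l),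
          integral_const_mul, mul_add l, Real.exp_add]
        gcongr
        simp only [integral_const, probReal_univ, smul_eq_mul, mul_one]
        linarith [Real.add_one_le_exp (l * ∫ h : ℝ≥0, (h : ℝ) ^ 2 / (σ : ℝ) ^ 2 ∂μE)]

/-- Exponential moments of the log-likelihood ratio of one channel use, uniformly over all
inputs. -/
lemma exists_info_mgf_bound (hE : Integrable (fun h : ℝ≥0 => (h : ℝ) ^ 2) μE) (hσ : 0 < σ)
    {τ : ℝ} (hτ : 0 < τ) : ∃ κ : ℝ, 0 < κ ∧ κ < 1 ∧ ∀ γ : ℝ≥0, ∃ l₀ > (0 : ℝ), ∀ l : ℝ, 0 < l →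
      l ≤ l₀ → ∀ s : ℝ, (γ = 0 → s = 0) →
      ∫⁻ ω, ENNReal.ofReal (Real.exp (l * infoDensity κ σ γ s ω.1 (ω.1 * s + ω.2)))
        ∂(letterLaw μE σ) ≤
      ENNReal.ofReal (Real.exp (l * (rateNat μE σ γ + (s ^ 2 - γ) * meanGain μE σ γ / 2 +
        τ * (1 + s ^ 2)))) := by
  have hκ1 : Real.exp (-(τ / 2)) < 1 := Real.exp_lt_one_iff.2 (by linarith)
  -- This weight makes the loss `-log(1-κ)` equal to `τ/2`, half of the slack, and does not depend
  -- on `γ`.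
  refine ⟨1 - Real.exp (-(τ / 2)), by linarith, by linarith [Real.exp_pos (-(τ / 2))], fun γ => ?_⟩
  set κ := 1 - Real.exp (-(τ / 2)) with hκ
  have h0 : 0 < κ := by linarith
  have h1 : κ < 1 := by linarith [Real.exp_pos (-(τ / 2))]
  have hlogκ : -Real.log (1 - κ) = τ / 2 := by
    rw [hκ, sub_sub_cancel, Real.log_exp, neg_neg]
  set m := ∫ h : ℝ≥0, (h : ℝ) ^ 2 / (σ : ℝ) ^ 2 ∂μE with hm
  -- Above the amplitude `a`, the logarithmic cost of the Cauchy bound is covered by `τ(1+s²)`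
  -- alone.
  obtain ⟨a, ha0, ha⟩ : ∃ a : ℝ, 0 ≤ a ∧ ∀ s : ℝ, a < |s| →
      Real.log (10 / κ) + Real.log (1 + s ^ 2) + m ≤ τ * (1 + s ^ 2) := by
    have hlo : ∀ᶠ x : ℝ in atTop, Real.log x ≤ τ / 2 * x := by
      filter_upwards [Real.isLittleO_log_id_atTop.bound (show 0 < τ / 2 by positivity),
        eventually_ge_atTop 1] with x hx hx1
      rw [Real.norm_eq_abs, Real.norm_eq_abs, id, abs_of_nonneg (Real.log_nonneg hx1),
        abs_of_nonneg (by linarith)] at hx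
      exact hx
    have hlin : ∀ᶠ x : ℝ in atTop, Real.log (10 / κ) + m ≤ τ / 2 * x :=
      (tendsto_id.const_mul_atTop (show 0 < τ / 2 by positivity)).eventually_ge_atTop _
    obtain ⟨A, hA⟩ := eventually_atTop.1 (hlo.and hlin)
    refine ⟨max A 1, by positivity, fun s hs => ?_⟩
    have h1s : 1 < |s| := (le_max_right _ _).trans_lt hs
    have : A ≤ 1 + s ^ 2 := by
      rw [← sq_abs]
      nlinarith [(le_max_left A 1).trans hs.le]
    obtain ⟨b1, b2⟩ := hA _ this
    linarith
  obtain ⟨hFi, V, hV, hmgf⟩ := exists_letter_mgf_bound hE hσ γ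
    (b := 2 * a ^ 2 / γ) (by positivity)
  -- The second entry gives `lV ≤ τ/2`: the second-order term of the moment bound uses the other
  -- half of the slack.
  refine ⟨min (1 / 32) (τ / (2 * (V + 1))), by positivity, fun l hl hl0 s hs0 => ?_⟩
  by_cases hs : |s| ≤ a
  · have hlV : l * V ≤ τ / 2 := by
      have : l ≤ τ / (2 * (V + 1)) := hl0.trans (min_le_right _ _)
      rw [le_div_iff₀ (by positivity)] at this
      nlinarith
    set f : ℝ≥0 × ℝ → ℝ := fun ω =>
      1 / 2 * Real.log (1 + (ω.1 : ℝ) ^ 2 * γ / (σ : ℝ) ^ 2) - 1 / 2 * (ω.2 ^ 2 / (σ : ℝ) ^ 2) +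
        1 / 2 * ((ω.1 * s + ω.2) ^ 2 / ((σ : ℝ) ^ 2 + (ω.1 : ℝ) ^ 2 * γ)) with hf
    have hfm : Measurable f := by fun_prop
    have hfb : ∀ ω, |f ω| ≤ letterDom σ γ (2 * a ^ 2 / γ) ω := by
      intro ω
      refine le_trans ?_ (terms_le_letterDom hσ hs hs0 ω)
      rw [hf]
      simp only
      generalize Real.log (1 + (ω.1 : ℝ) ^ 2 * γ / (σ : ℝ) ^ 2) = A
      generalize ω.2 ^ 2 / (σ : ℝ) ^ 2 = B
      generalize (ω.1 * s + ω.2) ^ 2 / ((σ : ℝ) ^ 2 + (ω.1 : ℝ) ^ 2 * γ) = C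
      rw [abs_le]
      constructor <;> linarith [neg_abs_le A, neg_abs_le B, neg_abs_le C, le_abs_self A,
        le_abs_self B, le_abs_self C, abs_nonneg A, abs_nonneg B, abs_nonneg C]
    have hfint : ∫ ω, f ω ∂(letterLaw μE σ) =
        rateNat μE σ γ + (s ^ 2 - γ) * meanGain μE σ γ / 2 := by
      have i1 : Integrable (fun ω : ℝ≥0 × ℝ =>
          1 / 2 * Real.log (1 + (ω.1 : ℝ) ^ 2 * γ / (σ : ℝ) ^ 2)) (letterLaw μE σ) :=
        ((integrable_log_snr hE γ).comp_fst _).const_mul _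
      have i2 : Integrable (fun ω : ℝ≥0 × ℝ => 1 / 2 * (ω.2 ^ 2 / (σ : ℝ) ^ 2))
          (letterLaw μE σ) :=
        (((integrable_sq_gaussianReal _).div_const _).comp_snd _).const_mul _
      have i3 := (integrable_letter_sq hE hσ hs0).const_mul (1 / 2)
      have i12 : Integrable (fun ω : ℝ≥0 × ℝ =>
          1 / 2 * Real.log (1 + (ω.1 : ℝ) ^ 2 * γ / (σ : ℝ) ^ 2) -
            1 / 2 * (ω.2 ^ 2 / (σ : ℝ) ^ 2)) (letterLaw μE σ) := i1.sub i2
      rw [integral_add i12 i3, integral_sub i1 i2, integral_const_mul,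
        integral_const_mul, integral_const_mul, integral_letter_sq hE hσ hs0,
        integral_letterLaw_noise_sq hσ,
        integral_letterLaw_fst (fun h : ℝ≥0 => Real.log (1 + (h : ℝ) ^ 2 * γ / (σ : ℝ) ^ 2)),
        rateNat]
      ring
    calc _ ≤ ∫⁻ ω, ENNReal.ofReal (Real.exp (l * (τ / 2))) *
          ENNReal.ofReal (Real.exp (l * f ω)) ∂(letterLaw μE σ) := by
          refine lintegral_mono fun ω => ?_
          rw [← ENNReal.ofReal_mul (Real.exp_pos _).le, ← Real.exp_add, ← mul_add]
          refine ENNReal.ofReal_le_ofReal (Real.exp_le_exp.2 (mul_le_mul_of_nonneg_left ?_ hl.le))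
          rw [← hlogκ]
          exact infoDensity_le_gaussian hσ h0 h1 γ ω.1 s ω.2
      _ ≤ ENNReal.ofReal (Real.exp (l * (τ / 2))) *
          ENNReal.ofReal (Real.exp (l * ∫ ω, f ω ∂(letterLaw μE σ) + l ^ 2 * V)) := by
          rw [lintegral_const_mul' _ _ ENNReal.ofReal_ne_top]
          gcongr
          exact hmgf l hl.le (hl0.trans (min_le_left _ _)) f hfm hfb
      _ ≤ _ := by
          rw [← ENNReal.ofReal_mul (Real.exp_pos _).le, ← Real.exp_add, hfint]
          refine ENNReal.ofReal_le_ofReal (Real.exp_le_exp.2 ?_)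
          nlinarith [mul_le_mul_of_nonneg_left hlV hl.le, mul_nonneg hl.le
            (mul_nonneg hτ.le (sq_nonneg s))]
  · refine le_trans (lintegral_mono fun ω => ENNReal.ofReal_le_ofReal (Real.exp_le_exp.2
      (mul_le_mul_of_nonneg_left (infoDensity_le_cauchy hσ h0 h1 γ ω.1 s ω.2) hl.le))) ?_
    refine (lintegral_exp_log_gain_le hE hl.le
      (hl0.trans ((min_le_left _ _).trans (by norm_num))) _).trans ?_
    refine ENNReal.ofReal_le_ofReal (Real.exp_le_exp.2 (mul_le_mul_of_nonneg_left ?_ hl.le))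
    -- The remaining part `r + (s²-γ)m/2` of the target is nonnegative, so it may be added to the
    -- bound of the tail case.
    have b1 := ha s (not_le.1 hs)
    have b2 := mul_meanGain_le_rateNat (μE := μE) hE hσ γ
    have b3 := mul_nonneg (sq_nonneg s) (meanGain_nonneg (μE := μE) (σ := σ) γ)
    linarith

end OutPDF

/-! ### Admissible codebooks -/

section Codebook

variable {μT μE : Measure ℝ≥0} {P : ℝ≥0}

lemma measurable_eveDensity {S : PowerPartition μT P} {σE : ℝ≥0} {n : ℕ} {L : Fin S.d → ℕ}
    {C : (i : Fin S.d) → Finset (Fin (L i) → ℝ)} (x : Codeword S C) :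
    Measurable (eveDensity S σE C (n := n) x) := by
  unfold eveDensity
  refine Finset.measurable_prod _ fun t _ => ENNReal.measurable_ofReal.comp
    (measurable_gaussianPDFReal_comp ?_ measurable_const (by fun_prop))
  refine Measurable.mul (by fun_prop) ?_
  exact (S.measurable_symbol _ t).comp (by fun_prop)

lemma PowerPartition.IsCodebook.nonempty {S : PowerPartition μT P} {L : Fin S.d → ℕ}
    {C : (i : Fin S.d) → Finset (Fin (L i) → ℝ)} (hC : S.IsCodebook C) :
    Nonempty (Codeword S C) :=
  ⟨fun i => ⟨(hC i).1.choose, (hC i).1.choose_spec⟩⟩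

lemma PowerPartition.IsCodebook.symbol_eq_zero {S : PowerPartition μT P} {L : Fin S.d → ℕ}
    {C : (i : Fin S.d) → Finset (Fin (L i) → ℝ)} (hC : S.IsCodebook C) (x : Codeword S C) {n : ℕ}
    {g : Fin n → ℝ≥0} {t : Fin n} {i : Fin S.d} (ht : t ∈ S.active L g i) (hp : S.power i = 0) :
    S.symbol (fun i => (x i).1) g t = 0 := by
  rw [S.symbol_of_mem ht]
  have h1 := (hC i).2 _ (x i).2
  rw [hp] at h1
  simp only [NNReal.coe_zero, mul_zero] at h1
  have h2 := Finset.sum_eq_zero_iff_of_nonneg (s := Finset.univ)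
    (f := fun j => (x i).1 j ^ 2) (fun _ _ => sq_nonneg _)
  exact pow_eq_zero_iff two_ne_zero |>.1
    (h2.1 (le_antisymm h1 (Finset.sum_nonneg fun _ _ => sq_nonneg _)) _ (Finset.mem_univ _))

/-- At zero power the moment bounds require a zero symbol; this holds both for subchannels of power
zero and for idle slots. -/
lemma PowerPartition.IsCodebook.slotPower_symbol {S : PowerPartition μT P} {L : Fin S.d → ℕ}
    {C : (i : Fin S.d) → Finset (Fin (L i) → ℝ)} (hC : S.IsCodebook C) (x : Codeword S C) {n : ℕ}
    (g : Fin n → ℝ≥0) (t : Fin n) (hp : S.slotPower L g t = 0) :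
    S.symbol (fun i => (x i).1) g t = 0 := by
  by_cases h : ∃ i, t ∈ S.active L g i
  · obtain ⟨i, hi⟩ := h
    rw [S.slotPower_of_mem hi] at hp
    exact hC.symbol_eq_zero x hi hp
  · exact S.symbol_of_notMem (not_exists.1 h)

/-- The sum is the number of slots times `r - γm/2`, plus the energy sent times `m/2 + τ`. Both
coefficients are nonnegative, so slots and energy can be bounded separately by `Lᵢ` and `Lᵢγᵢ`; the
terms `γm/2` then cancel. -/
lemma sum_active_rate_le (S : PowerPartition μT P) {σE : ℝ≥0} (hσ : 0 < σE)
    (hE : Integrable (fun h : ℝ≥0 => (h : ℝ) ^ 2) μE) {L : Fin S.d → ℕ}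
    {C : (i : Fin S.d) → Finset (Fin (L i) → ℝ)} (hC : S.IsCodebook C) (x : Codeword S C) {n : ℕ}
    (g : Fin n → ℝ≥0) {τ : ℝ} (hτ : 0 ≤ τ) (i : Fin S.d) :
    ∑ t ∈ S.active L g i, (rateNat μE σE (S.power i) +
      (S.symbol (fun i => (x i).1) g t ^ 2 - S.power i) * meanGain μE σE (S.power i) / 2 +
        τ * S.symbol (fun i => (x i).1) g t ^ 2) ≤
      L i * (rateNat μE σE (S.power i) + τ * S.power i) := by
  have h1 : ∑ t ∈ S.active L g i, S.symbol (fun i => (x i).1) g t ^ 2 ≤ L i * S.power i :=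
    (S.sum_symbol_sq_le i).trans ((hC i).2 _ (x i).2)
  have h2 : ((S.active L g i).card : ℝ) ≤ L i := by exact_mod_cast S.card_active_le i
  have h3 := meanGain_nonneg (μE := μE) (σ := σE) (S.power i)
  have h4 := mul_meanGain_le_rateNat hE hσ (S.power i)
  have h5 : ∑ t ∈ S.active L g i, (rateNat μE σE (S.power i) +
      (S.symbol (fun i => (x i).1) g t ^ 2 - S.power i) * meanGain μE σE (S.power i) / 2 +
        τ * S.symbol (fun i => (x i).1) g t ^ 2) =
      (S.active L g i).card * (rateNat μE σE (S.power i) -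
        S.power i * meanGain μE σE (S.power i) / 2) +
      (∑ t ∈ S.active L g i, S.symbol (fun i => (x i).1) g t ^ 2) *
        (meanGain μE σE (S.power i) / 2 + τ) := by
    rw [Finset.sum_mul, ← nsmul_eq_mul, ← Finset.sum_const, ← Finset.sum_add_distrib]
    exact Finset.sum_congr rfl fun t _ => by ring
  rw [h5]
  have h6 := mul_le_mul_of_nonneg_right h1 (show 0 ≤ meanGain μE σE (S.power i) / 2 + τ by linarith)
  have h7 := mul_le_mul_of_nonneg_right h2 (sub_nonneg.2 h4)
  linarith

end Codebook

/-! ### Integration over the eavesdropper's outputs -/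

section Output

variable {μT μE : Measure ℝ≥0} {n : ℕ}

/-- The substitution `z = hs + u` turns integrals over the reference measure into expectations over
gain and noise, whose law does not involve the symbol. -/
lemma lintegral_letter {σ : ℝ≥0} (hσ : 0 < σ) (s : ℝ) {φ : ℝ≥0 → ℝ → ℝ≥0∞}
    (hφ : Measurable (Function.uncurry φ)) :
    ∫⁻ h : ℝ≥0, (∫⁻ z, φ h z * gaussianPDF (h * s) (σ ^ 2) z) ∂μE =
      ∫⁻ ω, φ ω.1 (ω.1 * s + ω.2) ∂(letterLaw μE σ) := by
  unfold letterLaw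
  have hm : Measurable fun ω : ℝ≥0 × ℝ => φ ω.1 (ω.1 * s + ω.2) :=
    hφ.comp (by fun_prop : Measurable fun ω : ℝ≥0 × ℝ => (ω.1, ω.1 * s + ω.2))
  rw [lintegral_prod _ hm.aemeasurable]
  refine lintegral_congr fun h => ?_
  have hφh : Measurable (φ h) := hφ.comp (measurable_const.prodMk measurable_id)
  have h1 : ∫⁻ u, φ h (h * s + u) ∂(gaussianReal 0 (σ ^ 2)) =
      ∫⁻ z, φ h z ∂(gaussianReal (h * s) (σ ^ 2)) := by
    have := gaussianReal_map_const_add (μ := 0) (v := σ ^ 2) ((h : ℝ) * s)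
    rw [zero_add] at this
    rw [← this, lintegral_map hφh (by fun_prop)]
  simp only
  rw [h1, gaussianReal_of_var_ne_zero _ (by positivity),
    lintegral_withDensity_eq_lintegral_mul _ (measurable_gaussianPDF _ _) hφh]
  refine lintegral_congr fun z => ?_
  simp [mul_comm]

variable [IsProbabilityMeasure μT] [IsProbabilityMeasure μE]

lemma lintegral_refMeasure {f : EveOutput n → ℝ≥0∞} (hf : Measurable f) :
    ∫⁻ q, f q ∂(refMeasure μT μE n) = ∫⁻ g, (∫⁻ h, (∫⁻ z, f (z, g, h))
      ∂(Measure.pi fun _ : Fin n => μE)) ∂(Measure.pi fun _ : Fin n => μT) := by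
  unfold refMeasure
  rw [lintegral_prod_symm' _ hf, lintegral_prod _ hf.lintegral_prod_left'.aemeasurable]

lemma lintegral_output_prod {ψ : Fin n → ℝ≥0 → ℝ → ℝ≥0∞}
    (hψ : ∀ t, Measurable (Function.uncurry (ψ t))) :
    ∫⁻ h : Fin n → ℝ≥0, (∫⁻ z : Fin n → ℝ, ∏ t, ψ t (h t) (z t)) ∂(Measure.pi fun _ : Fin n => μE) =
      ∏ t, ∫⁻ h, (∫⁻ z, ψ t h z) ∂μE := by
  have h1 : ∀ h : Fin n → ℝ≥0, ∫⁻ z : Fin n → ℝ, ∏ t, ψ t (h t) (z t) =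
      ∏ t, ∫⁻ z, ψ t (h t) z := fun h =>
    lintegral_pi_prod volume (fun t => ψ t (h t)) fun t =>
      (hψ t).comp (measurable_const.prodMk measurable_id)
  simp_rw [h1]
  exact lintegral_pi_prod μE (fun t h => ∫⁻ z, ψ t h z) fun t => (hψ t).lintegral_prod_right'

variable {P : ℝ≥0} {S : PowerPartition μT P} {σE : ℝ≥0} {L : Fin S.d → ℕ}
  {C : (i : Fin S.d) → Finset (Fin (L i) → ℝ)}

lemma lintegral_eveDensity (hσ : 0 < σE) (x : Codeword S C) :
    ∫⁻ q, eveDensity S σE C (n := n) x q ∂(refMeasure μT μE n) = 1 := by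
  rw [lintegral_refMeasure (measurable_eveDensity x)]
  unfold eveDensity
  have h1 : ∀ g : Fin n → ℝ≥0, ∫⁻ h : Fin n → ℝ≥0, (∫⁻ z : Fin n → ℝ,
      ∏ t, gaussianPDF ((h t : ℝ) * S.symbol (fun i => (x i).1) g t) (σE ^ 2) (z t))
      ∂(Measure.pi fun _ : Fin n => μE) = 1 := by
    intro g
    rw [lintegral_output_prod (ψ := fun t h z => gaussianPDF ((h : ℝ) *
      S.symbol (fun i => (x i).1) g t) (σE ^ 2) z) fun t => ENNReal.measurable_ofReal.comp
        (measurable_gaussianPDFReal_comp (by fun_prop) measurable_const (by fun_prop))]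
    refine Finset.prod_eq_one fun t _ => ?_
    simp_rw [lintegral_gaussianPDF_eq_one _ (show σE ^ 2 ≠ 0 by positivity)]
    simp
  simp only
  simp_rw [h1]
  simp

/-- Chernoff bound for the eavesdropper's channel, conditionally on the main-channel gains. -/
lemma lintegral_eveDensity_le_exp (hσ : 0 < σE) (x : Codeword S C) {B : Set (EveOutput n)}
    (hB : MeasurableSet B) {φ : (Fin n → ℝ≥0) → Fin n → ℝ≥0 → ℝ → ℝ}
    (hφ : ∀ g t, Measurable (Function.uncurry (φ g t))) {c : (Fin n → ℝ≥0) → ℝ}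
    {l r : ℝ} (hl : 0 ≤ l) {b : (Fin n → ℝ≥0) → Fin n → ℝ}
    (hBφ : ∀ q ∈ B, c q.2.1 ≤ ∑ t, φ q.2.1 t (q.2.2 t) (q.1 t))
    (hmgf : ∀ g t, ∫⁻ ω, ENNReal.ofReal (Real.exp (l * φ g t ω.1
      (ω.1 * S.symbol (fun i => (x i).1) g t + ω.2))) ∂(letterLaw μE σE) ≤
        ENNReal.ofReal (Real.exp (l * b g t)))
    (hr : ∀ q ∈ B, l * (∑ t, b q.2.1 t - c q.2.1) ≤ -r) :
    ∫⁻ q in B, eveDensity S σE C x q ∂(refMeasure μT μE n) ≤ ENNReal.ofReal (Real.exp (-r)) := by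
  rw [← lintegral_indicator hB, lintegral_refMeasure ((measurable_eveDensity x).indicator hB)]
  have hg : ∀ g : Fin n → ℝ≥0, ∫⁻ h : Fin n → ℝ≥0, (∫⁻ z : Fin n → ℝ,
      B.indicator (eveDensity S σE C x) (z, g, h)) ∂(Measure.pi fun _ : Fin n => μE) ≤
        ENNReal.ofReal (Real.exp (-r)) := by
    intro g
    -- If no output in `B` has main-channel gains `g`, the fibre contributes nothing. Hence the
    -- exponent need only be controlled for gain sequences occurring in `B`.
    by_cases hex : ∃ q ∈ B, q.2.1 = g
    · obtain ⟨q₀, hq₀, rfl⟩ := hex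
      have hr₀ := hr q₀ hq₀
      generalize q₀.2.1 = g at hr₀
      have hpt : ∀ (h : Fin n → ℝ≥0) (z : Fin n → ℝ),
          B.indicator (eveDensity S σE C x) (z, g, h) ≤
          ENNReal.ofReal (Real.exp (-(l * c g))) *
            ∏ t, (ENNReal.ofReal (Real.exp (l * φ g t (h t) (z t))) *
              gaussianPDF ((h t : ℝ) * S.symbol (fun i => (x i).1) g t) (σE ^ 2) (z t)) := by
        intro h z
        by_cases hm : (z, g, h) ∈ B
        · rw [Set.indicator_of_mem hm, Finset.prod_mul_distrib, ← mul_assoc]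
          refine le_mul_of_one_le_left zero_le ?_
          rw [← ENNReal.ofReal_prod_of_nonneg fun t _ => (Real.exp_pos _).le, ← Real.exp_sum,
            ← ENNReal.ofReal_mul (Real.exp_pos _).le, ← Real.exp_add, ENNReal.one_le_ofReal,
            Real.one_le_exp_iff, ← Finset.mul_sum]
          have := mul_le_mul_of_nonneg_left (hBφ _ hm) hl
          simp only at this
          linarith
        · rw [Set.indicator_of_notMem hm]
          exact zero_le
      calc _ ≤ ∫⁻ h : Fin n → ℝ≥0, (∫⁻ z : Fin n → ℝ, ENNReal.ofReal (Real.exp (-(l * c g))) *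
            ∏ t, (ENNReal.ofReal (Real.exp (l * φ g t (h t) (z t))) *
              gaussianPDF ((h t : ℝ) * S.symbol (fun i => (x i).1) g t) (σE ^ 2) (z t)))
              ∂(Measure.pi fun _ : Fin n => μE) :=
            lintegral_mono fun h => lintegral_mono fun z => hpt h z
        _ = ENNReal.ofReal (Real.exp (-(l * c g))) * ∏ t, ∫⁻ ω, ENNReal.ofReal (Real.exp
            (l * φ g t ω.1 (ω.1 * S.symbol (fun i => (x i).1) g t + ω.2)))
              ∂(letterLaw μE σE) := by
            simp_rw [lintegral_const_mul' _ _ (ENNReal.ofReal_ne_top)]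
            have hm : ∀ t, Measurable (Function.uncurry fun (h : ℝ≥0) (z : ℝ) =>
                ENNReal.ofReal (Real.exp (l * φ g t h z))) := fun t =>
              ENNReal.measurable_ofReal.comp (Real.measurable_exp.comp ((hφ g t).const_mul l))
            rw [lintegral_output_prod (ψ := fun t h z => ENNReal.ofReal (Real.exp (l * φ g t h z)) *
              gaussianPDF ((h : ℝ) * S.symbol (fun i => (x i).1) g t) (σE ^ 2) z)
              fun t => (hm t).mul (ENNReal.measurable_ofReal.comp
                (measurable_gaussianPDFReal_comp (by fun_prop) measurable_const (by fun_prop)))]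
            congr 1
            exact Finset.prod_congr rfl fun t _ => lintegral_letter hσ _ (hm t)
        _ ≤ ENNReal.ofReal (Real.exp (-(l * c g))) *
              ∏ t, ENNReal.ofReal (Real.exp (l * b g t)) := by
            gcongr with t
            exact hmgf g t
        _ ≤ _ := by
            rw [← ENNReal.ofReal_prod_of_nonneg fun t _ => (Real.exp_pos _).le, ← Real.exp_sum,
              ← ENNReal.ofReal_mul (Real.exp_pos _).le, ← Real.exp_add, ← Finset.mul_sum]
            exact ENNReal.ofReal_le_ofReal (Real.exp_le_exp.2 (by linarith))
    · have : ∀ (h : Fin n → ℝ≥0) (z : Fin n → ℝ),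
          B.indicator (eveDensity S σE C x) (z, g, h) = 0 := fun h z =>
        Set.indicator_of_notMem (fun hm => hex ⟨_, hm, rfl⟩) _
      simp [this]
  calc _ ≤ ∫⁻ _ : Fin n → ℝ≥0, ENNReal.ofReal (Real.exp (-r))
        ∂(Measure.pi fun _ : Fin n => μT) := lintegral_mono hg
    _ = _ := by simp

end Output

/-! ### The smooth max-information of the multiplexing scheme -/

section Smooth

variable {μT μE : Measure ℝ≥0} [IsProbabilityMeasure μT] [IsProbabilityMeasure μE] {P : ℝ≥0}

/-- This normalises the reference output densities. Each factor may depend on the entire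
main-channel gain sequence, as the slot power does. -/
lemma lintegral_prod_densities {n : ℕ} {f : (Fin n → ℝ≥0) → Fin n → ℝ≥0 → ℝ → ℝ≥0∞}
    (hf : ∀ t, Measurable fun p : (Fin n → ℝ≥0) × ℝ≥0 × ℝ => f p.1 t p.2.1 p.2.2)
    (h1 : ∀ g t h, ∫⁻ z, f g t h z = 1) :
    ∫⁻ q, ∏ t, f q.2.1 t (q.2.2 t) (q.1 t) ∂(refMeasure μT μE n) = 1 := by
  have hm : Measurable fun q : EveOutput n => ∏ t, f q.2.1 t (q.2.2 t) (q.1 t) :=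
    Finset.measurable_prod _ fun t _ => (hf t).comp (by fun_prop :
      Measurable fun q : EveOutput n => (q.2.1, q.2.2 t, q.1 t))
  rw [lintegral_refMeasure hm]
  have h2 : ∀ g : Fin n → ℝ≥0, ∫⁻ h : Fin n → ℝ≥0, (∫⁻ z : Fin n → ℝ,
      ∏ t, f g t (h t) (z t)) ∂(Measure.pi fun _ : Fin n => μE) = 1 := by
    intro g
    rw [lintegral_output_prod (ψ := fun t h z => f g t h z) fun t => (hf t).comp (by fun_prop :
      Measurable fun p : ℝ≥0 × ℝ => (g, p.1, p.2))]
    simp [h1]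
  simp only
  simp_rw [h2]
  simp

/-- Non-asymptotic bound on the smooth max-information of the scheme. -/
lemma exists_smoothMaxInfo_le (S : PowerPartition μT P) {σE : ℝ≥0} (hσ : 0 < σE)
    (hE : Integrable (fun h : ℝ≥0 => (h : ℝ) ^ 2) μE) {τ : ℝ} (hτ : 0 < τ) :
    ∃ c > (0 : ℝ), ∀ (n : ℕ) (L : Fin S.d → ℕ) (C : (i : Fin S.d) → Finset (Fin (L i) → ℝ)),
      S.IsCodebook C →
      smoothMaxInfo (refMeasure μT μE n) (eveDensity S σE C) (Real.exp (-c * n)) ≤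
        (((∑ i, L i * (rateNat μE σE (S.power i) + τ * S.power i) + n * (2 * τ)) / Real.log 2 : ℝ)
          : EReal) := by
  obtain ⟨κ, hκ0, hκ1, hκ⟩ := exists_info_mgf_bound (μE := μE) hE hσ hτ
  choose l₀ hl₀ hmgf using hκ
  -- One Chernoff parameter serves the finitely many powers and the power `0` of idle slots.
  obtain ⟨l, hl, hl0, hli⟩ : ∃ l : ℝ, 0 < l ∧ l ≤ l₀ 0 ∧ ∀ i, l ≤ l₀ (S.power i) := by
    have hev : ∀ γ, ∀ᶠ l in 𝓝[>] (0 : ℝ), l ≤ l₀ γ := fun γ =>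
      (Ioc_mem_nhdsGT (hl₀ γ) : _) |> fun h => mem_of_superset h fun l hl => hl.2
    have h1 : ∀ᶠ l in 𝓝[>] (0 : ℝ), 0 < l := eventually_mem_nhdsWithin
    exact (h1.and ((hev 0).and (eventually_all.2 fun i => hev (S.power i)))).exists
  refine ⟨l * τ, by positivity, fun n L C hC => ?_⟩
  have := hC.nonempty
  -- Of the `2τ` per slot, one `τ` pays for the moment bound and the other produces the exponent
  -- `lτ` of the error probability.
  set E : ℝ := ∑ i, L i * (rateNat μE σE (S.power i) + τ * S.power i) + n * (2 * τ) with hEdef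
  set info : Codeword S C → EveOutput n → ℝ := fun x q =>
    ∑ t, infoDensity κ σE (S.slotPower L q.2.1 t) (S.symbol (fun i => (x i).1) q.2.1 t)
      (q.2.2 t) (q.1 t) with hinfo
  have hinfom : ∀ x, Measurable (info x) := by
    intro x
    refine Finset.measurable_sum _ fun t _ => measurable_infoDensity_comp ?_ ?_ (by fun_prop)
      (by fun_prop)
    · exact (S.measurable_slotPower L t).comp (by fun_prop)
    · exact (S.measurable_symbol _ t).comp (by fun_prop)
  set T : Set (Codeword S C × EveOutput n) := {p | info p.1 p.2 ≤ E} with hT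
  have hTm : ∀ x, MeasurableSet {q | (x, q) ∈ T} := fun x =>
    measurableSet_le (hinfom x) measurable_const
  have hTtyp : IsTypical (refMeasure μT μE n) (eveDensity S σE C) (Real.exp (-(l * τ) * n)) T := by
    refine isTypical_of_compl (Real.exp_pos _).le hTm (lintegral_eveDensity hσ) fun x => ?_
    rw [neg_mul]
    refine lintegral_eveDensity_le_exp hσ x (hTm x).compl (φ := fun g t h z =>
      infoDensity κ σE (S.slotPower L g t) (S.symbol (fun i => (x i).1) g t) h z)
      (c := fun _ => E) (l := l) (b := fun g t => rateNat μE σE (S.slotPower L g t) +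
        (S.symbol (fun i => (x i).1) g t ^ 2 - S.slotPower L g t) *
          meanGain μE σE (S.slotPower L g t) / 2 +
        τ * (1 + S.symbol (fun i => (x i).1) g t ^ 2)) ?_ hl.le ?_ ?_ ?_
    · exact fun g t => measurable_infoDensity_comp measurable_const measurable_const
        measurable_fst measurable_snd
    · intro q hq
      exact (not_le.1 (show ¬ info x q ≤ E from hq)).le
    · intro g t
      refine hmgf _ l hl ?_ _ (hC.slotPower_symbol x g t)
      by_cases h : ∃ i, t ∈ S.active L g i
      · obtain ⟨i, hi⟩ := h
        rw [S.slotPower_of_mem hi]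
        exact hli i
      · rw [S.slotPower_of_notMem (not_exists.1 h)]
        exact hl0
    · intro q _
      have h1 := S.sum_le_of_active (L := L) (hT := q.2.1)
        (Φ := fun t => rateNat μE σE (S.slotPower L q.2.1 t) +
          (S.symbol (fun i => (x i).1) q.2.1 t ^ 2 - S.slotPower L q.2.1 t) *
            meanGain μE σE (S.slotPower L q.2.1 t) / 2 +
          τ * (1 + S.symbol (fun i => (x i).1) q.2.1 t ^ 2))
        (ψ := fun i t => rateNat μE σE (S.power i) +
          (S.symbol (fun i => (x i).1) q.2.1 t ^ 2 - S.power i) *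
            meanGain μE σE (S.power i) / 2 + τ * S.symbol (fun i => (x i).1) q.2.1 t ^ 2)
        (c := τ) (fun i t ht => by simp only [S.slotPower_of_mem ht]; linarith)
        (fun t ht => by
          simp only [S.slotPower_of_notMem ht, S.symbol_of_notMem ht]
          simp [rateNat])
      have h2 : ∑ i, ∑ t ∈ S.active L q.2.1 i, (rateNat μE σE (S.power i) +
          (S.symbol (fun i => (x i).1) q.2.1 t ^ 2 - S.power i) *
            meanGain μE σE (S.power i) / 2 + τ * S.symbol (fun i => (x i).1) q.2.1 t ^ 2) ≤
          ∑ i, L i * (rateNat μE σE (S.power i) + τ * S.power i) :=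
        Finset.sum_le_sum fun i _ => sum_active_rate_le S hσ hE hC x q.2.1 hτ.le i
      have h3 := mul_le_mul_of_nonneg_left (h1.trans (add_le_add_right h2 _)) hl.le
      rw [mul_sub, hEdef]
      linarith
  refine (smoothMaxInfo_le_maxInfoOn hTtyp).trans ?_
  have hQ : ∫⁻ q, ∏ t, ENNReal.ofReal (outPDF κ σE (S.slotPower L q.2.1 t) (q.2.2 t) (q.1 t))
      ∂(refMeasure μT μE n) = 1 :=
    lintegral_prod_densities (f := fun g t h z =>
      ENNReal.ofReal (outPDF κ σE (S.slotPower L g t) h z))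
      (fun t => ENNReal.measurable_ofReal.comp (measurable_outPDF_comp
        ((S.measurable_slotPower L t).comp measurable_fst) (by fun_prop) (by fun_prop)))
      (fun g t h => lintegral_outPDF hσ hκ0 hκ1 _ _)
  have hle := maxInfoOn_le_logb (μ := refMeasure μT μE n) (w := eveDensity S σE C) (T := T)
    (Real.exp_pos E) hQ.le (fun x q hq => by
      rw [← ENNReal.ofReal_prod_of_nonneg fun t _ => (outPDF_pos hσ hκ0 hκ1 _ _ _).le,
        ← ENNReal.ofReal_mul (Real.exp_pos _).le]
      unfold eveDensity gaussianPDF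
      rw [← ENNReal.ofReal_prod_of_nonneg fun t _ => gaussianPDFReal_nonneg _ _ _]
      refine ENNReal.ofReal_le_ofReal ?_
      have h1 : ∀ t, gaussianPDFReal ((q.2.2 t : ℝ) * S.symbol (fun i => (x i).1) q.2.1 t)
          (σE ^ 2) (q.1 t) = Real.exp (infoDensity κ σE (S.slotPower L q.2.1 t)
            (S.symbol (fun i => (x i).1) q.2.1 t) (q.2.2 t) (q.1 t)) *
            outPDF κ σE (S.slotPower L q.2.1 t) (q.2.2 t) (q.1 t) := by
        intro t
        have ho := outPDF_pos hσ hκ0 hκ1 (S.slotPower L q.2.1 t) (q.2.2 t) (q.1 t)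
        rw [infoDensity, Real.exp_log (div_pos (gaussianPDFReal_pos _ _ _ (by positivity)) ho),
          div_mul_cancel₀ _ ho.ne']
      simp_rw [h1]
      rw [Finset.prod_mul_distrib, ← Real.exp_sum]
      refine mul_le_mul_of_nonneg_right (Real.exp_le_exp.2 hq)
        (Finset.prod_nonneg fun t _ => (outPDF_pos hσ hκ0 hκ1 _ _ _).le))
  rwa [Real.logb, Real.log_exp] at hle

end Smooth

/-! ### Asymptotic rates -/

section Rates

variable {μT μE : Measure ℝ≥0} {P : ℝ≥0}

lemma integral_logb_snr {σ : ℝ≥0} (γ : ℝ≥0) :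
    ∫ h : ℝ≥0, Real.logb 2 (1 + (h : ℝ) ^ 2 * γ / (σ : ℝ) ^ 2) ∂μE =
      2 * rateNat μE σ γ / Real.log 2 := by
  unfold rateNat Real.logb
  rw [integral_div]
  ring

lemma PowerPartition.IsPlan.eventually_sum_le {S : PowerPartition μT P} {len : ℕ → Fin S.d → ℕ}
    (h : S.IsPlan len) (A : Fin S.d → ℝ) {η : ℝ} (hη : 0 < η) :
    ∀ᶠ n : ℕ in atTop, ∑ i, len n i * A i ≤ n * (∑ i, S.prob i * A i + η) := by
  have h1 : Tendsto (fun n : ℕ => ∑ i, (len n i : ℝ) / n * A i) atTop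
      (𝓝 (∑ i, S.prob i * A i)) :=
    tendsto_finsetSum _ fun i _ => (h i).mul_const _
  filter_upwards [h1.eventually_le_const (show ∑ i, S.prob i * A i < ∑ i, S.prob i * A i + η by
    linarith), eventually_gt_atTop 0] with n hn hn0
  have hn0' : (0 : ℝ) < n := by exact_mod_cast hn0
  have h2 := mul_le_mul_of_nonneg_left hn hn0'.le
  refine le_trans (le_of_eq ?_) h2
  rw [Finset.mul_sum]
  refine Finset.sum_congr rfl fun i _ => ?_
  field_simp

variable [IsProbabilityMeasure μT] [IsProbabilityMeasure μE]

lemma fadingRate_alloc (S : PowerPartition μT P) {σE : ℝ≥0}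
    (hE : Integrable (fun h : ℝ≥0 => (h : ℝ) ^ 2) μE) :
    fadingRate μT μE σE S.alloc = (∑ i, S.prob i * rateNat μE σE (S.power i)) / Real.log 2 := by
  have h1 : ∀ h : ℝ≥0 × ℝ≥0,
      Real.logb 2 (1 + (S.alloc h.1 : ℝ) * (h.2 : ℝ) ^ 2 / (σE : ℝ) ^ 2) =
      ∑ i, (S.interval i).indicator (fun _ => (1 : ℝ)) h.1 *
        (Real.log (1 + (h.2 : ℝ) ^ 2 * S.power i / (σE : ℝ) ^ 2) / Real.log 2) := by
    intro h
    by_cases hex : ∃ i, h.1 ∈ S.interval i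
    · obtain ⟨i, hi⟩ := hex
      rw [Finset.sum_eq_single i, Set.indicator_of_mem hi, one_mul, S.alloc_of_mem hi,
        mul_comm (S.power i : ℝ)]
      · rfl
      · intro j _ hj
        rw [Set.indicator_of_notMem (fun hj' => hj (S.eq_of_mem_interval hj' hi)), zero_mul]
      · simp
    · rw [not_exists] at hex
      rw [S.alloc_of_notMem hex, Finset.sum_eq_zero fun i _ => by
        rw [Set.indicator_of_notMem (hex i), zero_mul]]
      simp
  unfold fadingRate
  simp_rw [h1]
  have hi1 : ∀ i, Integrable ((S.interval i).indicator (fun _ => (1 : ℝ))) μT := fun i =>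
    (integrable_const 1).indicator (S.measurableSet_interval i)
  rw [integral_finsetSum _ fun i _ => (hi1 i).mul_prod ((integrable_log_snr hE _).div_const _),
    Finset.mul_sum, Finset.sum_div]
  refine Finset.sum_congr rfl fun i _ => ?_
  rw [integral_prod_mul (f := (S.interval i).indicator fun _ => (1 : ℝ)) (g := fun h : ℝ≥0 =>
    Real.log (1 + (h : ℝ) ^ 2 * S.power i / (σE : ℝ) ^ 2) / Real.log 2), integral_indicator_const _ (S.measurableSet_interval i), integral_div,
    rateNat, PowerPartition.prob]
  simp
  ring

/-- Exponentially small smoothing. -/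
theorem exists_smoothMaxInfo_exp_le (S : PowerPartition μT P) {σE : ℝ≥0} (hσ : 0 < σE)
    (hE : Integrable (fun h : ℝ≥0 => (h : ℝ) ^ 2) μE) {len : ℕ → Fin S.d → ℕ} (hl : S.IsPlan len)
    {η : ℝ} (hη : 0 < η) : ∃ c > (0 : ℝ), ∀ᶠ n : ℕ in atTop,
      ∀ C : (i : Fin S.d) → Finset (Fin (len n i) → ℝ), S.IsCodebook C →
        smoothMaxInfo (refMeasure μT μE n) (eveDensity S σE C) (Real.exp (-c * n)) / (n : EReal)
          ≤ ((fadingRate μT μE σE S.alloc + η : ℝ) : EReal) := by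
  have hlog : 0 < Real.log 2 := Real.log_pos one_lt_two
  set G : ℝ := ∑ i, S.prob i * S.power i with hG
  have hG0 : 0 ≤ G := Finset.sum_nonneg fun i _ => mul_nonneg (S.prob_nonneg i) (by positivity)
  -- The losses per slot add up to `τ(G+3)`: energy gives `τG`, the one-shot bound `2τ`, and the
  -- deviation of the lengths from their limits `τ`.
  set τ : ℝ := η * Real.log 2 / (G + 3) with hτdef
  have hτ : 0 < τ := by positivity
  have hτG : τ * (G + 3) = η * Real.log 2 := by rw [hτdef]; field_simp
  obtain ⟨c, hc, hmain⟩ := exists_smoothMaxInfo_le (μE := μE) S hσ hE hτ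
  refine ⟨c, hc, ?_⟩
  filter_upwards [hl.eventually_sum_le (fun i => rateNat μE σE (S.power i) + τ * S.power i) hτ,
    eventually_gt_atTop 0] with n hn hn0 C hC
  refine div_natCast_le hn0 (hmain n _ C hC) ?_
  rw [fadingRate_alloc S hE, div_le_iff₀ hlog]
  have h1 : ∑ i, S.prob i * (rateNat μE σE (S.power i) + τ * S.power i) =
      ∑ i, S.prob i * rateNat μE σE (S.power i) + τ * G := by
    rw [hG, Finset.mul_sum, ← Finset.sum_add_distrib]
    exact Finset.sum_congr rfl fun i _ => by ring
  rw [h1] at hn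
  have h2 : (n : ℝ) * ((∑ i, S.prob i * rateNat μE σE (S.power i)) / Real.log 2 + η) *
      Real.log 2 = n * (∑ i, S.prob i * rateNat μE σE (S.power i) + η * Real.log 2) := by
    field_simp
  rw [h2, ← hτG]
  linarith

/-- A positive sequence of exponential rate zero eventually exceeds `e^(-cn)`, and enlarging the
smoothing parameter preserves `Q`. -/
lemma eventually_of_exists_exp_smoothing {Q : ℕ → ℝ → Prop}
    (hQ : ∀ n ε ε', ε ≤ ε' → Q n ε → Q n ε')
    (h : ∃ c > (0 : ℝ), ∀ᶠ n : ℕ in atTop, Q n (Real.exp (-c * n))) {ε : ℕ → ℝ}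
    (hε : ∀ n, 0 < ε n) (hlim : Tendsto (fun n => Real.log (ε n) / n) atTop (𝓝 0)) :
    ∀ᶠ n : ℕ in atTop, Q n (ε n) := by
  obtain ⟨c, hc, h⟩ := h
  filter_upwards [h, hlim.eventually_const_le (show -c < 0 by linarith), eventually_gt_atTop 0]
    with n hn hn1 hn0
  refine hQ n _ _ ?_ hn
  have hn0' : (0 : ℝ) < n := by exact_mod_cast hn0
  rw [le_div_iff₀ hn0'] at hn1
  exact (Real.le_log_iff_exp_le (hε n)).1 hn1

end Rates

/-! ### Max-information on the product typical sets -/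

section ProductTypical

variable {μT μE : Measure ℝ≥0} {P : ℝ≥0}

/-- On a typical block the accumulated log-likelihood ratio is bounded by its length. -/
lemma sum_block_le {n : ℕ} {σ p : ℝ≥0} {δ δ' δ'' : ℝ} (hσ : 0 < σ) (hδ : 0 < δ)
    {A : Finset (Fin n)} {s : Fin n → ℝ} {h : Fin n → ℝ≥0} {z : Fin n → ℝ}
    (H : BlockTypical μE σ p δ δ' δ'' A s h z) :
    ∑ t ∈ A, (1 / 2 * Real.log (1 + (h t : ℝ) ^ 2 * p / (σ : ℝ) ^ 2) -
        (z t - h t * s t) ^ 2 / (2 * (σ : ℝ) ^ 2) +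
        z t ^ 2 / ((σ : ℝ) ^ 2 + (h t : ℝ) ^ 2 * p) / (2 * (1 + δ))) ≤
      A.card * (rateNat μE σ p + (δ' + δ'' * Real.log 2) / 2) := by
  have hσ' : (0 : ℝ) < σ := hσ
  have hlog : 0 < Real.log 2 := Real.log_pos one_lt_two
  obtain ⟨h1, h2, h3⟩ := H
  rw [integral_logb_snr] at h3
  have h4 := (abs_le.1 h3).2
  have e1 : ∑ t ∈ A, Real.logb 2 (1 + (h t : ℝ) ^ 2 * p / (σ : ℝ) ^ 2) =
      (∑ t ∈ A, Real.log (1 + (h t : ℝ) ^ 2 * p / (σ : ℝ) ^ 2)) / Real.log 2 := by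
    rw [Finset.sum_div]; rfl
  rw [e1, sub_le_iff_le_add, div_le_iff₀ hlog] at h4
  have h4' : ∑ t ∈ A, Real.log (1 + (h t : ℝ) ^ 2 * p / (σ : ℝ) ^ 2) ≤
      A.card * (δ'' * Real.log 2 + 2 * rateNat μE σ p) := by
    refine h4.trans (le_of_eq ?_)
    field_simp
  rw [Finset.sum_add_distrib, Finset.sum_sub_distrib, ← Finset.mul_sum, ← Finset.sum_div,
    ← Finset.sum_div]
  have h5 : (∑ t ∈ A, z t ^ 2 / ((σ : ℝ) ^ 2 + (h t : ℝ) ^ 2 * p)) / (2 * (1 + δ)) ≤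
      A.card / 2 := by
    rw [div_le_div_iff₀ (by positivity) (by norm_num)]
    linarith
  have h6 : A.card * (1 - δ') / 2 ≤ (∑ t ∈ A, (z t - h t * s t) ^ 2) / (2 * (σ : ℝ) ^ 2) := by
    rw [div_le_div_iff₀ (by norm_num) (by positivity)]
    linarith
  linarith

variable [IsProbabilityMeasure μT] [IsProbabilityMeasure μE]

/-- Compare with the Gaussian of variance `(1+δ)(σ²+h²γ)`. Each slot pays `½ log(1+δ)`, and the
inflation brings the output-power term of a block of length `k` down to `k/2`, offsetting the noise
term up to `kδ'/2`. -/
lemma maxInfoOn_productTypicalSet_le (S : PowerPartition μT P) {σE : ℝ≥0} (hσ : 0 < σE)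
    (hE : Integrable (fun h : ℝ≥0 => (h : ℝ) ^ 2) μE) {δ δ' δ'' : ℝ} (hδ : 0 < δ) (hδ' : 0 < δ')
    (hδ'' : 0 < δ'') {n : ℕ} {L : Fin S.d → ℕ} {C : (i : Fin S.d) → Finset (Fin (L i) → ℝ)}
    (hC : S.IsCodebook C) :
    maxInfoOn (refMeasure μT μE n) (eveDensity S σE C)
      (productTypicalSet S σE C μE δ δ' δ'') ≤
      (((n * (1 / 2 * Real.log (1 + δ)) + ∑ i, L i * (rateNat μE σE (S.power i) +
        (δ' + δ'' * Real.log 2) / 2)) / Real.log 2 : ℝ) : EReal) := by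
  have := hC.nonempty
  have hlog : 0 < Real.log 2 := Real.log_pos one_lt_two
  have hσ' : (0 : ℝ) < σE := hσ
  set α : ℝ≥0 := ⟨1 + δ, by linarith⟩ with hα
  have hα0 : 0 < α := by
    rw [← NNReal.coe_pos]; show (0 : ℝ) < 1 + δ; linarith
  have hαc : (α : ℝ) = 1 + δ := rfl
  set E : ℝ := n * (1 / 2 * Real.log (1 + δ)) + ∑ i, L i * (rateNat μE σE (S.power i) +
        (δ' + δ'' * Real.log 2) / 2) with hEdef
  have hQ : ∫⁻ q, ∏ t, gaussianPDF 0 (α * (σE ^ 2 + q.2.2 t ^ 2 * S.slotPower L q.2.1 t)) (q.1 t)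
      ∂(refMeasure μT μE n) = 1 :=
    lintegral_prod_densities (f := fun g t h z =>
      gaussianPDF 0 (α * (σE ^ 2 + h ^ 2 * S.slotPower L g t)) z)
      (fun t => by
        have hs : Measurable fun p : (Fin n → ℝ≥0) × ℝ≥0 × ℝ => S.slotPower L p.1 t :=
          (S.measurable_slotPower L t).comp measurable_fst
        exact ENNReal.measurable_ofReal.comp
          (measurable_gaussianPDFReal_comp measurable_const (by fun_prop) (by fun_prop)))
      (fun g t h => lintegral_gaussianPDF_eq_one _ (by positivity))
  have hle := maxInfoOn_le_logb (μ := refMeasure μT μE n) (w := eveDensity S σE C)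
    (T := productTypicalSet S σE C μE δ δ' δ'') (Real.exp_pos E) hQ.le (fun x q hq => by
      have hg : ∀ t, 0 < gaussianPDFReal 0
          (α * (σE ^ 2 + q.2.2 t ^ 2 * S.slotPower L q.2.1 t)) (q.1 t) := fun t =>
        gaussianPDFReal_pos _ _ _ (by positivity)
      unfold eveDensity gaussianPDF
      rw [← ENNReal.ofReal_prod_of_nonneg fun t _ => (hg t).le,
        ← ENNReal.ofReal_mul (Real.exp_pos _).le,
        ← ENNReal.ofReal_prod_of_nonneg fun t _ => gaussianPDFReal_nonneg _ _ _]
      refine ENNReal.ofReal_le_ofReal ?_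
      set s := S.symbol (fun i => (x i).1) q.2.1 with hs
      set Φ : Fin n → ℝ := fun t => Real.log (gaussianPDFReal ((q.2.2 t : ℝ) * s t) (σE ^ 2) (q.1 t)
        / gaussianPDFReal 0 (α * (σE ^ 2 + q.2.2 t ^ 2 * S.slotPower L q.2.1 t)) (q.1 t)) with hΦ
      have h1 : ∀ t, gaussianPDFReal ((q.2.2 t : ℝ) * s t) (σE ^ 2) (q.1 t) = Real.exp (Φ t) *
            gaussianPDFReal 0 (α * (σE ^ 2 + q.2.2 t ^ 2 * S.slotPower L q.2.1 t)) (q.1 t) := by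
        intro t
        rw [hΦ]
        simp only
        rw [Real.exp_log (div_pos (gaussianPDFReal_pos _ _ _ (by positivity)) (hg t)),
          div_mul_cancel₀ _ (hg t).ne']
      simp_rw [h1]
      rw [Finset.prod_mul_distrib, ← Real.exp_sum]
      refine mul_le_mul_of_nonneg_right (Real.exp_le_exp.2 ?_)
        (Finset.prod_nonneg fun t _ => (hg t).le)
      refine (S.sum_le_of_active (L := L) (hT := q.2.1) (Φ := Φ) (c := 1 / 2 * Real.log (1 + δ))
        (ψ := fun i t => 1 / 2 * Real.log (1 + (q.2.2 t : ℝ) ^ 2 * S.power i / (σE : ℝ) ^ 2) -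
          (q.1 t - q.2.2 t * s t) ^ 2 / (2 * (σE : ℝ) ^ 2) +
          q.1 t ^ 2 / ((σE : ℝ) ^ 2 + (q.2.2 t : ℝ) ^ 2 * S.power i) / (2 * (1 + δ)))
        (fun i t ht => ?_) (fun t ht => ?_)).trans ?_
      · rw [hΦ]
        simp only
        rw [log_gaussian_ratio_mul hσ hα0, S.slotPower_of_mem ht, hαc]
      · rw [hΦ]
        simp only
        rw [log_gaussian_ratio_mul hσ hα0, S.slotPower_of_notMem ht, hs, S.symbol_of_notMem ht, hαc]
        -- The typical set places no condition on idle slots; since the inflated variance exceeds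
        -- `σ²`, the quadratic terms there have the favourable sign for every `z`.
        have : q.1 t ^ 2 / (σE : ℝ) ^ 2 / (2 * (1 + δ)) ≤ q.1 t ^ 2 / (2 * (σE : ℝ) ^ 2) := by
          rw [div_div]
          refine div_le_div_of_nonneg_left (sq_nonneg _) (by positivity) ?_
          nlinarith [sq_pos_of_pos hσ']
        simp
        linarith
      · rw [hEdef]
        refine add_le_add_right (Finset.sum_le_sum fun i _ => ?_) _
        refine (sum_block_le hσ hδ (hq i)).trans ?_
        refine mul_le_mul_of_nonneg_right (by exact_mod_cast S.card_active_le i) ?_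
        have h3 := mul_meanGain_le_rateNat hE hσ (S.power i)
        have h4 := mul_nonneg (S.power i).2 (meanGain_nonneg (μE := μE) (σ := σE) (S.power i))
        have h5 := mul_pos hδ'' hlog
        have h6 : 0 ≤ rateNat μE σE (S.power i) := le_trans (div_nonneg h4 (by norm_num)) h3
        linarith)
  rwa [Real.logb, Real.log_exp] at hle

theorem eventually_maxInfoOn_productTypicalSet_le (S : PowerPartition μT P) {σE : ℝ≥0}
    (hσ : 0 < σE) (hE : Integrable (fun h : ℝ≥0 => (h : ℝ) ^ 2) μE) {len : ℕ → Fin S.d → ℕ}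
    (hl : S.IsPlan len) {δ δ' δ'' : ℝ} (hδ : 0 < δ) (hδ' : 0 < δ') (hδ'' : 0 < δ'')
    {η : ℝ} (hη : 0 < η) : ∀ᶠ n : ℕ in atTop,
      ∀ C : (i : Fin S.d) → Finset (Fin (len n i) → ℝ), S.IsCodebook C →
        maxInfoOn (refMeasure μT μE n) (eveDensity S σE C)
            (productTypicalSet S σE C μE δ δ' δ'') / (n : EReal)
          ≤ ((fadingRate μT μE σE S.alloc
            + (Real.logb 2 ((1 + δ) * Real.exp δ') + δ'') / 2 + η : ℝ) : EReal) := by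
  have hlog : 0 < Real.log 2 := Real.log_pos one_lt_two
  filter_upwards [hl.eventually_sum_le (fun i => rateNat μE σE (S.power i) +
    (δ' + δ'' * Real.log 2) / 2) (mul_pos hη hlog), eventually_gt_atTop 0] with n hn hn0 C hC
  refine div_natCast_le hn0 (maxInfoOn_productTypicalSet_le S hσ hE hδ hδ' hδ'' hC) ?_
  rw [fadingRate_alloc S hE, div_le_iff₀ hlog, Real.logb,
    Real.log_mul (by positivity) (Real.exp_pos _).ne', Real.log_exp]
  have h1 : ∑ i, S.prob i * (rateNat μE σE (S.power i) + (δ' + δ'' * Real.log 2) / 2) =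
      ∑ i, S.prob i * rateNat μE σE (S.power i) +
        (∑ i, S.prob i) * ((δ' + δ'' * Real.log 2) / 2) := by
    rw [Finset.sum_mul, ← Finset.sum_add_distrib]
    exact Finset.sum_congr rfl fun i _ => by ring
  have h2 : (∑ i, S.prob i) * ((δ' + δ'' * Real.log 2) / 2) ≤ (δ' + δ'' * Real.log 2) / 2 :=
    mul_le_of_le_one_left (by positivity) S.sum_prob_le_one
  have h3 : (n : ℝ) * ((∑ i, S.prob i * rateNat μE σE (S.power i)) / Real.log 2 +
      ((Real.log (1 + δ) + δ') / Real.log 2 + δ'') / 2 + η) * Real.log 2 =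
      n * (∑ i, S.prob i * rateNat μE σE (S.power i) + (Real.log (1 + δ) + δ') / 2 +
        δ'' * Real.log 2 / 2 + η * Real.log 2) := by
    field_simp
    ring
  rw [h3]
  rw [h1] at hn
  have h4 := mul_le_mul_of_nonneg_left h2 (show (0 : ℝ) ≤ n by positivity)
  linarith

end ProductTypical

/-! ### Typicality of the product typical sets -/

section Typicality

variable {μT μE : Measure ℝ≥0} {P : ℝ≥0} (S : PowerPartition μT P) (σE : ℝ≥0)

/-- Admissible codebooks with symbols of amplitude at most `a`, together with a choice of
codewords. -/
abbrev BoundedInput (len : ℕ → Fin S.d → ℕ) (a : ℝ) (n : ℕ) : Type :=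
  {p : (C : (i : Fin S.d) → Finset (Fin (len n i) → ℝ)) × Codeword S C //
    S.IsCodebook p.1 ∧ ∀ i, ∀ y ∈ p.1 i, ∀ j, |y j| ≤ a}

/-- Probability that the eavesdropper's output lies in `B`. -/
def outputProb (μE : Measure ℝ≥0) {len : ℕ → Fin S.d → ℕ} {a : ℝ} {n : ℕ}
    (p : BoundedInput S len a n) (B : Set (EveOutput n)) : ℝ≥0∞ :=
  ∫⁻ q in B, eveDensity S σE p.1.1 p.1.2 q ∂(refMeasure μT μE n)

/-- The symbols sent for a given sequence of main-channel gains. -/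
def BoundedInput.sent {S : PowerPartition μT P} {len : ℕ → Fin S.d → ℕ} {a : ℝ} {n : ℕ}
    (p : BoundedInput S len a n) (g : Fin n → ℝ≥0) (t : Fin n) : ℝ :=
  S.symbol (fun i => (p.1.2 i).1) g t

/-- Event that a block sum exceeds a multiple of the block length. -/
def blockExcess {len : ℕ → Fin S.d → ℕ} {a : ℝ} (f : ℝ → ℝ≥0 → ℝ → ℝ) (m : ℝ) (i : Fin S.d)
    {n : ℕ} (p : BoundedInput S len a n) : Set (EveOutput n) :=
  {q | (S.active (len n) q.2.1 i).card * m <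
    ∑ t ∈ S.active (len n) q.2.1 i, f (p.sent q.2.1 t) (q.2.2 t) (q.1 t)}

variable {σE} {len : ℕ → Fin S.d → ℕ} {a : ℝ}

lemma measurable_card_active {n : ℕ} (L : Fin S.d → ℕ) (i : Fin S.d) :
    Measurable fun q : EveOutput n => ((S.active L q.2.1 i).card : ℝ) := by
  have : Measurable fun g : Fin n → ℝ≥0 => ((S.active L g i).card : ℝ) :=
    S.measurable_of_samePattern fun _ _ H => by rw [H.active]
  exact this.comp (by fun_prop)

lemma measurableSet_blockExcess {f : ℝ → ℝ≥0 → ℝ → ℝ}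
    (hf : Measurable fun p : ℝ × ℝ≥0 × ℝ => f p.1 p.2.1 p.2.2) (m : ℝ) (i : Fin S.d) {n : ℕ}
    (p : BoundedInput S len a n) : MeasurableSet (blockExcess S f m i p) := by
  classical
  refine measurableSet_lt ((measurable_card_active S _ i).mul_const m) ?_
  have h1 : ∀ q : EveOutput n, ∑ t ∈ S.active (len n) q.2.1 i,
      f (p.sent q.2.1 t) (q.2.2 t) (q.1 t) =
      ∑ t, (if t ∈ S.active (len n) q.2.1 i then 1 else 0) *
        f (p.sent q.2.1 t) (q.2.2 t) (q.1 t) := by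
    intro q
    simp
  simp_rw [h1]
  refine Finset.measurable_sum _ fun t _ => Measurable.mul ?_ ?_
  · have : Measurable fun g : Fin n → ℝ≥0 =>
        if t ∈ S.active (len n) g i then (1 : ℝ) else 0 :=
      S.measurable_of_samePattern fun _ _ H => by rw [H.active]
    exact this.comp (by fun_prop)
  · have : Measurable fun q : EveOutput n => p.sent q.2.1 t :=
      (S.measurable_symbol _ t).comp (by fun_prop)
    exact hf.comp (this.prodMk (by fun_prop : Measurable fun q : EveOutput n =>
      (q.2.2 t, q.1 t)))

lemma abs_sent_le {n : ℕ} (p : BoundedInput S len a n) {i : Fin S.d} {g : Fin n → ℝ≥0}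
    {t : Fin n} (ht : t ∈ S.active (len n) g i) : |p.sent g t| ≤ a := by
  rw [BoundedInput.sent, S.symbol_of_mem ht]
  exact p.2.2 i _ (p.1.2 i).2 _

lemma sum_sent_sq_le {n : ℕ} (p : BoundedInput S len a n) (i : Fin S.d) (g : Fin n → ℝ≥0) :
    ∑ t ∈ S.active (len n) g i, p.sent g t ^ 2 ≤ len n i * S.power i :=
  (S.sum_symbol_sq_le i).trans ((p.2.1 i).2 _ (p.1.2 i).2)

variable [IsProbabilityMeasure μT] [IsProbabilityMeasure μE]

/-- Whatever the codewords, the received word and the eavesdropper's gains integrate to one for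
fixed main-channel gains, whose law is thus the product law. -/
lemma outputProb_gains (hσ : 0 < σE) {n : ℕ} (p : BoundedInput S len a n)
    {G : Set (Fin n → ℝ≥0)} (hG : MeasurableSet G) :
    outputProb S σE μE p {q | q.2.1 ∈ G} ≤ (Measure.pi fun _ : Fin n => μT) G := by
  have hB : MeasurableSet {q : EveOutput n | q.2.1 ∈ G} := by
    exact (measurable_fst.comp measurable_snd) hG
  have hint : ∀ g : Fin n → ℝ≥0, ∫⁻ h : Fin n → ℝ≥0, (∫⁻ z : Fin n → ℝ,
      eveDensity S σE p.1.1 p.1.2 (z, g, h)) ∂(Measure.pi fun _ : Fin n => μE) = 1 := by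
    intro g
    unfold eveDensity
    simp only
    rw [lintegral_output_prod (ψ := fun t h z => gaussianPDF ((h : ℝ) *
      S.symbol (fun i => (p.1.2 i).1) g t) (σE ^ 2) z) fun t => ENNReal.measurable_ofReal.comp
        (measurable_gaussianPDFReal_comp (by fun_prop) measurable_const (by fun_prop))]
    refine Finset.prod_eq_one fun t _ => ?_
    simp_rw [lintegral_gaussianPDF_eq_one _ (show σE ^ 2 ≠ 0 by positivity)]
    simp
  unfold outputProb
  rw [← lintegral_indicator hB, lintegral_refMeasure ((measurable_eveDensity _).indicator hB),
    ← lintegral_indicator_one hG]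
  refine lintegral_mono fun g => ?_
  by_cases hg : g ∈ G
  · rw [Set.indicator_of_mem hg, Pi.one_apply, ← hint g]
    exact lintegral_mono fun h => lintegral_mono fun z => Set.indicator_le_self _ _ _
  · have : ∀ (h : Fin n → ℝ≥0) (z : Fin n → ℝ), ({q : EveOutput n | q.2.1 ∈ G}).indicator
        (eveDensity S σE p.1.1 p.1.2) (z, g, h) = 0 := fun h z =>
      Set.indicator_of_notMem (show (z, g, h) ∉ {q : EveOutput n | q.2.1 ∈ G} from hg) _
    simp [this]

open Classical in
/-- A subchannel is rarely used much less often than expected. -/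
lemma exists_pi_totalUses_lt_le (i : Fin S.d) {τ : ℝ} (hτ : 0 < τ) :
    ∃ c > (0 : ℝ), ∀ n : ℕ, (Measure.pi fun _ : Fin n => μT)
      {g | (S.totalUses g i : ℝ) < n * (S.prob i - τ)} ≤ ENNReal.ofReal (Real.exp (-c * n)) := by
  set I := S.interval i with hI
  -- The negative sign turns the lower tail of the use count into an upper deviation of a sum.
  set f : ℝ≥0 → ℝ := fun h => -I.indicator (fun _ => (1 : ℝ)) h with hf
  have hfm : Measurable f :=
    (measurable_const.indicator (S.measurableSet_interval i)).neg
  obtain ⟨-, V, hV, hmgf⟩ := exists_mgf_bound μT (F := fun _ => 1) (θ := 1) one_pos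
    (fun _ => zero_le_one) measurable_const (integrable_const _)
  have hfb : ∀ h, |f h| ≤ 1 := by
    intro h
    rw [hf]
    simp only [abs_neg]
    by_cases hh : h ∈ I <;> simp [hh]
  have hfi : ∫ h, f h ∂μT = -S.prob i := by
    rw [hf, integral_neg, integral_indicator_const _ (S.measurableSet_interval i)]
    simp [PowerPartition.prob]
  set l : ℝ := min (1 / 2) (τ / (2 * (V + 1))) with hl
  have hl0 : 0 < l := by positivity
  have hlV : l * V ≤ τ / 2 := by
    have : l ≤ τ / (2 * (V + 1)) := min_le_right _ _
    rw [le_div_iff₀ (by positivity)] at this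
    nlinarith
  refine ⟨l * (τ / 2), by positivity, fun n => ?_⟩
  have hGm : MeasurableSet {g : Fin n → ℝ≥0 | (S.totalUses g i : ℝ) < n * (S.prob i - τ)} := by
    have : Measurable fun g : Fin n → ℝ≥0 => (S.totalUses g i : ℝ) :=
      S.measurable_of_samePattern fun g g' H => by
        unfold PowerPartition.totalUses
        congr 2
        ext t
        simp [H t i]
    exact measurableSet_lt this measurable_const
  rw [← lintegral_indicator_one hGm]
  calc _ ≤ ∫⁻ g : Fin n → ℝ≥0, ENNReal.ofReal (Real.exp (l * (n * (S.prob i - τ)))) *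
        ∏ t, ENNReal.ofReal (Real.exp (l * f (g t))) ∂(Measure.pi fun _ : Fin n => μT) := by
        refine lintegral_mono fun g => ?_
        by_cases hg : g ∈ {g : Fin n → ℝ≥0 | (S.totalUses g i : ℝ) < n * (S.prob i - τ)}
        · rw [Set.indicator_of_mem hg, Pi.one_apply,
            ← ENNReal.ofReal_prod_of_nonneg fun t _ => (Real.exp_pos _).le, ← Real.exp_sum,
            ← ENNReal.ofReal_mul (Real.exp_pos _).le, ← Real.exp_add, ENNReal.one_le_ofReal,
            Real.one_le_exp_iff, ← Finset.mul_sum, ← mul_add]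
          refine mul_nonneg hl0.le ?_
          have h1 : ∑ t, f (g t) = -(S.totalUses g i : ℝ) := by
            rw [hf, Finset.sum_neg_distrib, PowerPartition.totalUses, Finset.card_filter]
            push_cast
            congr 1
          rw [h1]
          have : (S.totalUses g i : ℝ) < n * (S.prob i - τ) := hg
          linarith
        · rw [Set.indicator_of_notMem hg]
          exact zero_le
    _ = ENNReal.ofReal (Real.exp (l * (n * (S.prob i - τ)))) *
        (∫⁻ h, ENNReal.ofReal (Real.exp (l * f h)) ∂μT) ^ n := by
        rw [lintegral_const_mul' _ _ ENNReal.ofReal_ne_top,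
          lintegral_pi_prod μT (fun _ h => ENNReal.ofReal (Real.exp (l * f h)))
            fun _ => by fun_prop]
        simp
    _ ≤ ENNReal.ofReal (Real.exp (l * (n * (S.prob i - τ)))) *
        (ENNReal.ofReal (Real.exp (l * -S.prob i + l ^ 2 * V))) ^ n := by
        gcongr
        rw [← hfi]
        exact hmgf l hl0.le (min_le_left _ _) f hfm hfb
    _ ≤ _ := by
        rw [← ENNReal.ofReal_pow (Real.exp_pos _).le, ← Real.exp_nat_mul,
          ← ENNReal.ofReal_mul (Real.exp_pos _).le, ← Real.exp_add]
        refine ENNReal.ofReal_le_ofReal (Real.exp_le_exp.2 ?_)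
        have := mul_le_mul_of_nonneg_left hlV (show 0 ≤ l * n by positivity)
        linarith

/-- Block sums rarely exceed their mean by a fixed amount per symbol. -/
lemma expSmall_blockExcess (hσ : 0 < σE)
    (hE : Integrable (fun h : ℝ≥0 => (h : ℝ) ^ 2) μE) (hl : S.IsPlan len) (a : ℝ) (i : Fin S.d)
    {f : ℝ → ℝ≥0 → ℝ → ℝ} (hf : Measurable fun p : ℝ × ℝ≥0 × ℝ => f p.1 p.2.1 p.2.2)
    {m k d : ℝ} (hk : 0 ≤ k) (hk1 : k * S.power i ≤ 1) (hd : 0 < d)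
    (hfb : ∀ s, |s| ≤ a → (S.power i = 0 → s = 0) → ∀ ω : ℝ≥0 × ℝ,
      |f s ω.1 (ω.1 * s + ω.2)| ≤ letterDom σE (S.power i) (2 * a ^ 2 / S.power i) ω)
    (hfi : ∀ s, |s| ≤ a → (S.power i = 0 → s = 0) →
      ∫ ω : ℝ≥0 × ℝ, f s ω.1 (ω.1 * s + ω.2) ∂(letterLaw μE σE) ≤ m + k * (s ^ 2 - S.power i)) :
    ExpSmall fun n (p : BoundedInput S len a n) =>
      outputProb S σE μE p (blockExcess S f (m + d) i p) := by
  classical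
  -- A subchannel of probability zero almost surely has an empty block, on which the strict
  -- inequality reads `0 < 0`.
  rcases (S.prob_nonneg i).eq_or_lt with hp | hp
  · refine ExpSmall.zero.mono (Eventually.of_forall fun n p => ?_)
    have hsub : blockExcess S f (m + d) i p ⊆
        {q | q.2.1 ∈ ⋃ t : Fin n, Function.eval t ⁻¹' S.interval i} := by
      intro q hq
      by_contra hcon
      simp only [Set.mem_ofPred_eq, Set.mem_iUnion, Set.mem_preimage, not_exists] at hcon
      have hemp : S.active (len n) q.2.1 i = ∅ := by
        refine Finset.eq_empty_of_forall_notMem fun t ht => hcon t (S.mem_active.1 ht).1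
      simp [blockExcess, hemp] at hq
    refine (lintegral_mono_set hsub).trans ((outputProb_gains S hσ p (MeasurableSet.iUnion fun t =>
      (measurable_pi_apply t) (S.measurableSet_interval i))).trans (le_of_eq ?_))
    refine measure_iUnion_null fun t => ?_
    refine (Measure.quasiMeasurePreserving_eval (fun _ : Fin n => μT) t).preimage_null ?_
    exact (measureReal_eq_zero_iff).1 hp.symm
  set q₀ := S.prob i with hq₀
  -- The energy bound concerns the whole codeword, although only `N` symbols are sent. The excess is
  -- at most `len - N ≤ 2nτ ≤ nq₀d/8`, while half of the margin gives `Nd/2 ≥ nq₀d/4`; the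
  -- difference `nq₀d/8` fixes the exponent.
  set τ : ℝ := min (q₀ / 2) (q₀ * d / 16) with hτ
  have hτ0 : 0 < τ := by positivity
  have hτ1 : τ ≤ q₀ / 2 := min_le_left _ _
  have hτ2 : τ ≤ q₀ * d / 16 := min_le_right _ _
  set B₁ : (n : ℕ) → Set (EveOutput n) := fun n =>
    {q | (n : ℝ) * (q₀ - τ) ≤ (S.active (len n) q.2.1 i).card} with hB₁
  set B₂ : (n : ℕ) → Set (Fin n → ℝ≥0) := fun n =>
    {g | (S.totalUses g i : ℝ) < n * (q₀ - τ)} with hB₂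
  have hB₁m : ∀ n, MeasurableSet (B₁ n) := fun n =>
    measurableSet_le measurable_const (measurable_card_active S _ i)
  have hB₂m : ∀ n, MeasurableSet (B₂ n) := fun n => by
    have : Measurable fun g : Fin n → ℝ≥0 => (S.totalUses g i : ℝ) :=
      S.measurable_of_samePattern fun g g' H => by
        unfold PowerPartition.totalUses
        congr 2
        ext t
        simp [H t i]
    exact measurableSet_lt this measurable_const
  have hlen : ∀ᶠ n : ℕ in atTop, (n : ℝ) * (q₀ - τ) ≤ len n i ∧ (len n i : ℝ) ≤ n * (q₀ + τ) := by
    filter_upwards [(hl i).eventually_const_le (show q₀ - τ < q₀ by linarith),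
      (hl i).eventually_le_const (show q₀ < q₀ + τ by linarith), eventually_gt_atTop 0]
      with n h1 h2 h3
    have h3' : (0 : ℝ) < n := by exact_mod_cast h3
    rw [le_div_iff₀ h3'] at h1
    rw [div_le_iff₀ h3'] at h2
    exact ⟨by linarith, by linarith⟩
  have hrare : ExpSmall fun n (p : BoundedInput S len a n) =>
      outputProb S σE μE p {q | q.2.1 ∈ B₂ n} := by
    obtain ⟨c, hc, h⟩ := exists_pi_totalUses_lt_le S i hτ0
    exact ⟨c, hc, Eventually.of_forall fun n p =>
      (outputProb_gains S hσ p (hB₂m n)).trans (h n)⟩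
  have hchern : ExpSmall fun n (p : BoundedInput S len a n) =>
      outputProb S σE μE p (blockExcess S f (m + d) i p ∩ B₁ n) := by
    obtain ⟨-, V, hV, hmgf⟩ := exists_letter_mgf_bound hE hσ (S.power i)
      (b := 2 * a ^ 2 / S.power i) (by positivity)
    set l : ℝ := min (1 / 32) (d / (2 * (V + 1))) with hldef
    have hl0 : 0 < l := by positivity
    have hlV : l * V ≤ d / 2 := by
      have : l ≤ d / (2 * (V + 1)) := min_le_right _ _
      rw [le_div_iff₀ (by positivity)] at this
      nlinarith
    refine ⟨l * (q₀ * d / 8), by positivity, ?_⟩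
    filter_upwards [hlen] with n hn p
    rw [neg_mul]
    refine lintegral_eveDensity_le_exp hσ p.1.2
      ((measurableSet_blockExcess S hf _ i p).inter (hB₁m n)) (φ := fun g t h z =>
        if t ∈ S.active (len n) g i then f (p.sent g t) h z else 0)
      (c := fun g => (S.active (len n) g i).card * (m + d)) (l := l)
      (b := fun g t => if t ∈ S.active (len n) g i then
        m + k * (p.sent g t ^ 2 - S.power i) + l * V else 0) ?_ hl0.le ?_ ?_ ?_
    · intro g t
      by_cases ht : t ∈ S.active (len n) g i
      · simp only [ht, if_true]
        exact hf.comp (measurable_const.prodMk measurable_id)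
      · simp only [ht, if_false]
        exact measurable_const
    · intro q hq
      have h1 : (S.active (len n) q.2.1 i).card * (m + d) <
        ∑ t ∈ S.active (len n) q.2.1 i, f (p.sent q.2.1 t) (q.2.2 t) (q.1 t) := hq.1
      rw [← Finset.sum_filter]
      simpa using h1.le
    · intro g t
      by_cases ht : t ∈ S.active (len n) g i
      · simp only [ht, if_true]
        have hs := abs_sent_le S p ht
        have hs0 : S.power i = 0 → p.sent g t = 0 := fun h0 =>
          p.2.1.symbol_eq_zero p.1.2 ht h0
        refine (hmgf l hl0.le (min_le_left _ _) (fun ω => f (p.sent g t) ω.1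
          (ω.1 * p.sent g t + ω.2)) (hf.comp (by fun_prop : Measurable fun ω : ℝ≥0 × ℝ =>
            (p.sent g t, ω.1, (ω.1 : ℝ) * p.sent g t + ω.2)))
          (hfb _ hs hs0)).trans ?_
        refine ENNReal.ofReal_le_ofReal (Real.exp_le_exp.2 ?_)
        have := mul_le_mul_of_nonneg_left (hfi _ hs hs0) hl0.le
        linarith
      · simp [ht]
    · intro q hq
      have hcard : (n : ℝ) * (q₀ - τ) ≤ (S.active (len n) q.2.1 i).card := hq.2
      have hsum := sum_sent_sq_le S p i q.2.1
      have hle : ((S.active (len n) q.2.1 i).card : ℝ) ≤ len n i := by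
        exact_mod_cast S.card_active_le i
      rw [← Finset.sum_filter]
      simp only [Finset.filter_univ_mem]
      set N : ℝ := ((S.active (len n) q.2.1 i).card : ℝ) with hN
      have e1 : ∑ t ∈ S.active (len n) q.2.1 i,
          (m + k * (p.sent q.2.1 t ^ 2 - S.power i) + l * V) =
          N * (m - k * S.power i + l * V) +
            k * ∑ t ∈ S.active (len n) q.2.1 i, p.sent q.2.1 t ^ 2 := by
        rw [hN, Finset.mul_sum, ← nsmul_eq_mul, ← Finset.sum_const, ← Finset.sum_add_distrib]
        exact Finset.sum_congr rfl fun t _ => by ring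
      rw [e1, mul_assoc l (q₀ * d / 8), ← mul_neg]
      refine mul_le_mul_of_nonneg_left ?_ hl0.le
      have h1 := mul_le_mul_of_nonneg_left hsum hk
      have h2 : (len n i - N) * (k * S.power i) ≤ (len n i - N) * 1 :=
        mul_le_mul_of_nonneg_left hk1 (by linarith)
      have hn0 : (0 : ℝ) ≤ n := by positivity
      have hN0 : 0 ≤ N := by positivity
      have h3 := mul_le_mul_of_nonneg_left hlV hN0
      have h4 := mul_le_mul_of_nonneg_left hτ1 hn0
      have h5 := mul_le_mul_of_nonneg_left hτ2 hn0
      have h6 : n * (q₀ / 2) * (d / 2) ≤ N * (d / 2) :=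
        mul_le_mul_of_nonneg_right (by linarith) (by linarith)
      linarith [hn.2]
  refine (hchern.add hrare).mono ?_
  filter_upwards [hlen] with n hn p
  refine (lintegral_mono_set ?_).trans (lintegral_union_le _ _ _)
  intro q hq
  by_cases hq1 : q ∈ B₁ n
  · exact Or.inl ⟨hq, hq1⟩
  · refine Or.inr ?_
    have h1 : ((S.active (len n) q.2.1 i).card : ℝ) < n * (q₀ - τ) := not_le.1 hq1
    rw [S.card_active, Nat.cast_min, min_lt_iff] at h1
    rcases h1 with h1 | h1
    · exact h1
    · linarith [hn.1]

/-- The complement is a union over subchannels of four upper deviations, the two-sided logarithmic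
condition giving two of them. Only the output power has a mean depending on the symbol, so only
there is `k` nonzero. -/
theorem exists_isTypical_productTypicalSet (hσ : 0 < σE)
    (hE : Integrable (fun h : ℝ≥0 => (h : ℝ) ^ 2) μE) (hl : S.IsPlan len)
    {δ δ' δ'' : ℝ} (hδ : 0 < δ) (hδ' : 0 < δ') (hδ'' : 0 < δ'') (a : ℝ) :
    ∃ c > (0 : ℝ), ∀ᶠ n : ℕ in atTop,
      ∀ C : (i : Fin S.d) → Finset (Fin (len n i) → ℝ), S.IsCodebook C →
        (∀ i, ∀ x ∈ C i, ∀ j, |x j| ≤ a) →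
        IsTypical (refMeasure μT μE n) (eveDensity S σE C) (Real.exp (-c * n))
          (productTypicalSet S σE C μE δ δ' δ'') := by
  have hσ' : (0 : ℝ) < σE := hσ
  have hlog2 : (1 / 2 : ℝ) ≤ Real.log 2 := by linarith [Real.log_two_gt_d9]
  have hlog : 0 < Real.log 2 := by linarith
  set f₁ : Fin S.d → ℝ → ℝ≥0 → ℝ → ℝ := fun i _ h z =>
    z ^ 2 / ((σE : ℝ) ^ 2 + (h : ℝ) ^ 2 * S.power i) with hf₁
  set f₂ : ℝ → ℝ≥0 → ℝ → ℝ := fun s h z => -((z - h * s) ^ 2 / (σE : ℝ) ^ 2) with hf₂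
  set f₃ : Fin S.d → ℝ → ℝ≥0 → ℝ → ℝ := fun i _ h _ =>
    Real.logb 2 (1 + (h : ℝ) ^ 2 * S.power i / (σE : ℝ) ^ 2) with hf₃
  set f₄ : Fin S.d → ℝ → ℝ≥0 → ℝ → ℝ := fun i s h z => -f₃ i s h z with hf₄
  set M : Fin S.d → ℝ := fun i =>
    ∫ g : ℝ≥0, Real.logb 2 (1 + (g : ℝ) ^ 2 * S.power i / (σE : ℝ) ^ 2) ∂μE with hM
  have hm₁ : ∀ i, Measurable fun p : ℝ × ℝ≥0 × ℝ => f₁ i p.1 p.2.1 p.2.2 := fun i => by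
    simp only [hf₁]; fun_prop
  have hm₂ : Measurable fun p : ℝ × ℝ≥0 × ℝ => f₂ p.1 p.2.1 p.2.2 := by
    simp only [hf₂]; fun_prop
  have hm₃ : ∀ i, Measurable fun p : ℝ × ℝ≥0 × ℝ => f₃ i p.1 p.2.1 p.2.2 := fun i => by
    simp only [hf₃, Real.logb]; fun_prop
  have hm₄ : ∀ i, Measurable fun p : ℝ × ℝ≥0 × ℝ => f₄ i p.1 p.2.1 p.2.2 := fun i =>
    (hm₃ i).neg
  have hlogb : ∀ (i : Fin S.d) (h : ℝ≥0),
      |Real.logb 2 (1 + (h : ℝ) ^ 2 * S.power i / (σE : ℝ) ^ 2)| ≤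
      2 * |Real.log (1 + (h : ℝ) ^ 2 * S.power i / (σE : ℝ) ^ 2)| := by
    intro i h
    rw [Real.logb, abs_div, abs_of_pos hlog, div_le_iff₀ hlog]
    nlinarith [abs_nonneg (Real.log (1 + (h : ℝ) ^ 2 * S.power i / (σE : ℝ) ^ 2))]
  have h₁ : ∀ i, ExpSmall fun n (p : BoundedInput S len a n) =>
      outputProb S σE μE p (blockExcess S (f₁ i) (1 + δ) i p) := fun i =>
    expSmall_blockExcess S hσ hE hl a i (hm₁ i) (m := 1) (k := meanGain μE σE (S.power i))
      (meanGain_nonneg _) (by rw [mul_comm]; exact mul_meanGain_le_one hE hσ _) hδ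
      (fun s hs h0 ω => by
        have := terms_le_letterDom hσ hs h0 ω
        simp only [hf₁]
        linarith [abs_nonneg (ω.2 ^ 2 / (σE : ℝ) ^ 2),
          abs_nonneg (Real.log (1 + (ω.1 : ℝ) ^ 2 * S.power i / (σE : ℝ) ^ 2))])
      (fun s hs h0 => by
        simp only [hf₁]
        rw [integral_letter_sq hE hσ h0]
        linarith)
  have h₂ : ∀ i, ExpSmall fun n (p : BoundedInput S len a n) =>
      outputProb S σE μE p (blockExcess S f₂ (-1 + δ') i p) := fun i =>
    expSmall_blockExcess S hσ hE hl a i hm₂ (m := -1) (k := 0) le_rfl (by simp) hδ'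
      (fun s hs h0 ω => by
        have := terms_le_letterDom hσ hs h0 ω
        simp only [hf₂, add_sub_cancel_left, abs_neg]
        linarith [abs_nonneg ((ω.1 * s + ω.2) ^ 2 / ((σE : ℝ) ^ 2 + (ω.1 : ℝ) ^ 2 * S.power i)),
          abs_nonneg (Real.log (1 + (ω.1 : ℝ) ^ 2 * S.power i / (σE : ℝ) ^ 2))])
      (fun s hs h0 => by
        simp only [hf₂, add_sub_cancel_left]
        rw [integral_neg, integral_letterLaw_noise_sq hσ]
        simp)
  have hint₃ : ∀ i, ∫ ω : ℝ≥0 × ℝ, Real.logb 2 (1 + (ω.1 : ℝ) ^ 2 * S.power i / (σE : ℝ) ^ 2)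
      ∂(letterLaw μE σE) = M i := fun i =>
    integral_letterLaw_fst fun h : ℝ≥0 =>
      Real.logb 2 (1 + (h : ℝ) ^ 2 * S.power i / (σE : ℝ) ^ 2)
  have hb₃ : ∀ i s, |s| ≤ a → (S.power i = 0 → s = 0) → ∀ ω : ℝ≥0 × ℝ,
      |Real.logb 2 (1 + (ω.1 : ℝ) ^ 2 * S.power i / (σE : ℝ) ^ 2)| ≤
        letterDom σE (S.power i) (2 * a ^ 2 / S.power i) ω := fun i s hs h0 ω => by
    have := terms_le_letterDom hσ hs h0 ω
    have := hlogb i ω.1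
    linarith [abs_nonneg ((ω.1 * s + ω.2) ^ 2 / ((σE : ℝ) ^ 2 + (ω.1 : ℝ) ^ 2 * S.power i)),
      abs_nonneg (ω.2 ^ 2 / (σE : ℝ) ^ 2)]
  have h₃ : ∀ i, ExpSmall fun n (p : BoundedInput S len a n) =>
      outputProb S σE μE p (blockExcess S (f₃ i) (M i + δ'') i p) := fun i =>
    expSmall_blockExcess S hσ hE hl a i (hm₃ i) (k := 0) le_rfl (by simp) hδ''
      (fun s hs h0 ω => hb₃ i s hs h0 ω)
      (fun s hs h0 => by simp only [hf₃]; rw [hint₃]; simp)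
  have h₄ : ∀ i, ExpSmall fun n (p : BoundedInput S len a n) =>
      outputProb S σE μE p (blockExcess S (f₄ i) (-M i + δ'') i p) := fun i =>
    expSmall_blockExcess S hσ hE hl a i (hm₄ i) (k := 0) le_rfl (by simp) hδ''
      (fun s hs h0 ω => by simp only [hf₄, hf₃, abs_neg]; exact hb₃ i s hs h0 ω)
      (fun s hs h0 => by simp only [hf₄, hf₃]; rw [integral_neg, hint₃]; simp)
  set bad : (n : ℕ) → BoundedInput S len a n → Fin S.d → Set (EveOutput n) := fun n p i =>
    ((blockExcess S (f₁ i) (1 + δ) i p ∪ blockExcess S f₂ (-1 + δ') i p) ∪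
      blockExcess S (f₃ i) (M i + δ'') i p) ∪ blockExcess S (f₄ i) (-M i + δ'') i p with hbad
  have hbad_small : ExpSmall fun n (p : BoundedInput S len a n) =>
      outputProb S σE μE p (⋃ i, bad n p i) := by
    refine (ExpSmall.sum Finset.univ fun i _ => (((h₁ i).add (h₂ i)).add (h₃ i)).add (h₄ i)).mono
      (Eventually.of_forall fun n p => ?_)
    refine (lintegral_iUnion_le _ _).trans ?_
    rw [tsum_fintype]
    refine Finset.sum_le_sum fun i _ => ?_
    refine (lintegral_union_le _ _ _).trans (add_le_add_left ?_ _)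
    refine (lintegral_union_le _ _ _).trans (add_le_add_left ?_ _)
    exact lintegral_union_le _ _ _
  have hset : ∀ {n : ℕ} (p : BoundedInput S len a n),
      {q | (p.1.2, q) ∈ productTypicalSet S σE p.1.1 μE δ δ' δ''}ᶜ = ⋃ i, bad n p i := by
    intro n p
    ext q
    simp only [Set.mem_compl_iff, Set.mem_ofPred_eq, productTypicalSet, not_forall, Set.mem_iUnion]
    refine exists_congr fun i => ?_
    have e1 : q ∈ blockExcess S (f₁ i) (1 + δ) i p ↔
        ¬ ∑ t ∈ S.active (len n) q.2.1 i, q.1 t ^ 2 /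
          ((σE : ℝ) ^ 2 + (q.2.2 t : ℝ) ^ 2 * S.power i) ≤
          (S.active (len n) q.2.1 i).card * (1 + δ) := by
      rw [not_le]
      rfl
    have e2 : q ∈ blockExcess S f₂ (-1 + δ') i p ↔
        ¬ (S.active (len n) q.2.1 i).card * ((σE : ℝ) ^ 2 * (1 - δ')) ≤
          ∑ t ∈ S.active (len n) q.2.1 i, (q.1 t - q.2.2 t * p.sent q.2.1 t) ^ 2 := by
      rw [not_le]
      simp only [blockExcess, hf₂, Set.mem_ofPred_eq]
      rw [Finset.sum_neg_distrib, ← Finset.sum_div, lt_neg, div_lt_iff₀ (by positivity)]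
      constructor <;> intro h <;> linarith
    have e3 : q ∈ blockExcess S (f₃ i) (M i + δ'') i p ∪
        blockExcess S (f₄ i) (-M i + δ'') i p ↔
        ¬ |∑ t ∈ S.active (len n) q.2.1 i,
            Real.logb 2 (1 + (q.2.2 t : ℝ) ^ 2 * S.power i / (σE : ℝ) ^ 2) -
          (S.active (len n) q.2.1 i).card * M i| ≤ (S.active (len n) q.2.1 i).card * δ'' := by
      rw [not_le, lt_abs]
      simp only [blockExcess, hf₄, hf₃, Set.mem_union, Set.mem_ofPred_eq, Finset.sum_neg_distrib]
      refine or_congr ?_ ?_ <;> constructor <;> intro h <;> linarith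
    have : q ∈ bad n p i ↔ (q ∈ blockExcess S (f₁ i) (1 + δ) i p ∨
        q ∈ blockExcess S f₂ (-1 + δ') i p) ∨ q ∈ blockExcess S (f₃ i) (M i + δ'') i p ∪
        blockExcess S (f₄ i) (-M i + δ'') i p := by
      simp only [hbad, Set.mem_union, or_assoc]
    rw [this, e1, e2, e3, BlockTypical, not_and_or, not_and_or, or_assoc]
    rfl
  have hbad_meas : ∀ {n : ℕ} (p : BoundedInput S len a n), MeasurableSet (⋃ i, bad n p i) := fun {n} p =>
    MeasurableSet.iUnion fun i => (((measurableSet_blockExcess S (hm₁ i) _ i p).union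
      (measurableSet_blockExcess S hm₂ _ i p)).union
      (measurableSet_blockExcess S (hm₃ i) _ i p)).union (measurableSet_blockExcess S (hm₄ i) _ i p)
  obtain ⟨c, hc, h⟩ := hbad_small
  refine ⟨c, hc, h.mono fun n hn C hC hCa => ?_⟩
  refine isTypical_of_compl (Real.exp_pos _).le (fun x => ?_) (lintegral_eveDensity hσ) fun x => ?_
  · rw [← MeasurableSet.compl_iff, hset ⟨⟨C, x⟩, hC, hCa⟩]
    exact hbad_meas _
  · have hb : outputProb S σE μE ⟨⟨C, x⟩, hC, hCa⟩
        (⋃ i, bad n (⟨⟨C, x⟩, hC, hCa⟩ : BoundedInput S len a n) i) ≤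
        ENNReal.ofReal (Real.exp (-c * n)) := hn ⟨⟨C, x⟩, hC, hCa⟩
    rw [← hset] at hb
    exact hb

end Typicality

/-! ### Convergence of power allocations -/

section Limits

variable {μT μE : Measure ℝ≥0}

lemma integrable_power {P : ℝ≥0} {γ : ℝ≥0 → ℝ≥0} (hγ : Measurable γ)
    (hP : ∫⁻ h, (γ h : ℝ≥0∞) ∂μT ≤ P) :
    Integrable (fun h => (γ h : ℝ)) μT ∧ ∫ h, (γ h : ℝ) ∂μT ≤ P := by
  have hfin : ∫⁻ h, (γ h : ℝ≥0∞) ∂μT ≠ ⊤ := ne_top_of_le_ne_top ENNReal.coe_ne_top hP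
  have hm : AEMeasurable (fun h => (γ h : ℝ≥0∞)) μT := by fun_prop
  refine ⟨integrable_toReal_of_lintegral_ne_top hm hfin, ?_⟩
  have h1 := integral_toReal hm (ae_of_all _ fun _ => ENNReal.coe_lt_top)
  simp only [ENNReal.coe_toReal] at h1
  rw [h1]
  exact ENNReal.toReal_le_of_le_ofReal P.2 (by simpa using hP)

/-- Fatou's lemma along an almost everywhere convergent subsequence. The limit allocation thereby
inherits the power constraint without its being assumed. -/
lemma lintegral_le_of_tendstoInMeasure {P : ℝ≥0} {γ : ℝ≥0 → ℝ≥0} {γk : ℕ → ℝ≥0 → ℝ≥0}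
    (hγk : ∀ k, Measurable (γk k)) (hP : ∀ k, ∫⁻ h, (γk k h : ℝ≥0∞) ∂μT ≤ P)
    (hlim : TendstoInMeasure μT γk atTop γ) : ∫⁻ h, (γ h : ℝ≥0∞) ∂μT ≤ P := by
  obtain ⟨ns, -, hns⟩ := hlim.exists_seq_tendsto_ae
  calc ∫⁻ h, (γ h : ℝ≥0∞) ∂μT = ∫⁻ h, liminf (fun k => (γk (ns k) h : ℝ≥0∞)) atTop ∂μT := by
        refine lintegral_congr_ae (hns.mono fun h hh => ?_)
        exact ((ENNReal.tendsto_coe.2 hh).liminf_eq).symm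
    _ ≤ liminf (fun k => ∫⁻ h, (γk (ns k) h : ℝ≥0∞) ∂μT) atTop :=
        lintegral_liminf_le fun k => (hγk _).coe_nnreal_ennreal
    _ ≤ P := liminf_le_of_le (by isBoundedDefault) fun b hb => by
        obtain ⟨k, hk⟩ := hb.exists
        exact hk.trans (hP _)

/-- Apply `log y ≤ y - 1` at `y = τ(1+x)`: the logarithm lies below a line of arbitrarily small
slope. -/
lemma log_one_add_le_mul_add {τ x : ℝ} (hτ : 0 < τ) (hx : 0 ≤ x) :
    Real.log (1 + x) ≤ τ * x + (τ - 1 - Real.log τ) := by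
  have h := Real.log_le_sub_one_of_pos (x := τ * (1 + x)) (by positivity)
  rw [Real.log_mul hτ.ne' (by positivity)] at h
  linarith

lemma log_one_add_le_of_le {x y r : ℝ} (hy : 0 ≤ y) (hr : 0 ≤ r) (hx : 0 ≤ x) (h : x ≤ y + r) :
    Real.log (1 + x) ≤ Real.log (1 + y) + r := by
  have h1 : 1 + x ≤ (1 + y) * Real.exp r := by
    nlinarith [Real.add_one_le_exp r, mul_nonneg hy hr]
  calc Real.log (1 + x) ≤ Real.log ((1 + y) * Real.exp r) :=
        Real.log_le_log (by positivity) h1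
    _ = _ := by rw [Real.log_mul (by positivity) (Real.exp_pos _).ne', Real.log_exp]

lemma integrable_log_power [SFinite μT] [SFinite μE] {σ : ℝ≥0} (hE : Integrable (fun h : ℝ≥0 => (h : ℝ) ^ 2) μE)
    {γ : ℝ≥0 → ℝ≥0} (hγ : Measurable γ) (hγi : Integrable (fun h => (γ h : ℝ)) μT) :
    Integrable (fun h : ℝ≥0 × ℝ≥0 => Real.log (1 + (γ h.1 : ℝ) * (h.2 : ℝ) ^ 2 / (σ : ℝ) ^ 2))
      (μT.prod μE) := by
  refine (hγi.mul_prod (hE.div_const ((σ : ℝ) ^ 2))).mono'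
    (Measurable.aestronglyMeasurable (by fun_prop)) (ae_of_all _ fun h => ?_)
  have h0 : 0 ≤ (γ h.1 : ℝ) * (h.2 : ℝ) ^ 2 / (σ : ℝ) ^ 2 := by positivity
  rw [Real.norm_of_nonneg (Real.log_nonneg (by linarith)), ← mul_div_assoc]
  linarith [Real.log_le_sub_one_of_pos
    (x := 1 + (γ h.1 : ℝ) * (h.2 : ℝ) ^ 2 / (σ : ℝ) ^ 2) (by linarith)]

lemma fadingRate_eq {σE : ℝ≥0} (γ : ℝ≥0 → ℝ≥0) : fadingRate μT μE σE γ =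
    (∫ h, Real.log (1 + (γ h.1 : ℝ) * (h.2 : ℝ) ^ 2 / (σE : ℝ) ^ 2) ∂(μT.prod μE)) /
      (2 * Real.log 2) := by
  unfold fadingRate Real.logb
  rw [integral_div]
  ring

variable [IsProbabilityMeasure μT] [IsProbabilityMeasure μE]

/-- Upper semicontinuity of the fading rate along power allocations with bounded mean that
converge in measure. -/
lemma eventually_fadingRate_le {σE : ℝ≥0}
    (hE : Integrable (fun h : ℝ≥0 => (h : ℝ) ^ 2) μE) {P : ℝ≥0} {γ : ℝ≥0 → ℝ≥0}
    (hγ : Measurable γ) {γk : ℕ → ℝ≥0 → ℝ≥0} (hγk : ∀ k, Measurable (γk k))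
    (hP : ∀ k, ∫⁻ h, (γk k h : ℝ≥0∞) ∂μT ≤ P) (hlim : TendstoInMeasure μT γk atTop γ)
    {η : ℝ} (hη : 0 < η) :
    ∀ᶠ k in atTop, fadingRate μT μE σE (γk k) ≤ fadingRate μT μE σE γ + η := by
  have hlog : 0 < Real.log 2 := Real.log_pos one_lt_two
  obtain ⟨hγi, -⟩ := integrable_power hγ (lintegral_le_of_tendstoInMeasure hγk hP hlim)
  set y : ℝ≥0 → ℝ := fun h => (h : ℝ) ^ 2 / (σE : ℝ) ^ 2 with hy
  have hy0 : ∀ h, 0 ≤ y h := fun h => by positivity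
  have hyi : Integrable y μE := hE.div_const _
  set m : ℝ := ∫ h, y h ∂μE with hm
  have hm0 : 0 ≤ m := integral_nonneg hy0
  -- The allowance `2η log 2` is `4e`; three errors of at most `e` each occur below.
  set e : ℝ := η * Real.log 2 / 2 with he
  have he0 : 0 < e := by positivity
  set r : ℝ := e / (m + 1) with hr
  have hr0 : 0 < r := by positivity
  have hrm : r * m ≤ e := by
    rw [hr, div_mul_eq_mul_div, div_le_iff₀ (by positivity)]
    nlinarith
  set τ : ℝ := e / (P * m + 1) with hτ
  have hPm : 0 ≤ (P : ℝ) * m := mul_nonneg P.2 hm0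
  have hτ0 : 0 < τ := by positivity
  have hτm : τ * (P * m) ≤ e := by
    rw [hτ, div_mul_eq_mul_div, div_le_iff₀ (by positivity)]
    nlinarith
  set M : ℝ := τ - 1 - Real.log τ with hM
  have hM0 : 0 ≤ M := by linarith [Real.log_le_sub_one_of_pos hτ0]
  set D : ℕ → Set ℝ≥0 := fun k => {h | ENNReal.ofReal r ≤ edist (γk k h) (γ h)} with hD
  have hDm : ∀ k, MeasurableSet (D k) := fun k =>
    measurableSet_le measurable_const ((hγk k).edist hγ)
  have hDlim : Tendsto (fun k => M * μT.real (D k)) atTop (𝓝 0) := by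
    have h1 := hlim (ENNReal.ofReal r) (by simpa using hr0)
    have h2 := (ENNReal.tendsto_toReal ENNReal.zero_ne_top).comp h1
    have h3 := h2.const_mul M
    rw [ENNReal.toReal_zero, mul_zero] at h3
    exact h3
  filter_upwards [hDlim.eventually_le_const he0] with k hk
  obtain ⟨hki, hkP⟩ := integrable_power (hγk k) (hP k)
  have hpt : ∀ h : ℝ≥0 × ℝ≥0,
      Real.log (1 + (γk k h.1 : ℝ) * (h.2 : ℝ) ^ 2 / (σE : ℝ) ^ 2) ≤
      Real.log (1 + (γ h.1 : ℝ) * (h.2 : ℝ) ^ 2 / (σE : ℝ) ^ 2) + r * y h.2 +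
        τ * ((γk k h.1 : ℝ) * y h.2) + M * (D k).indicator (fun _ => (1 : ℝ)) h.1 := by
    intro h
    have a0 := hy0 h.2
    have a1 : 0 ≤ (γk k h.1 : ℝ) * y h.2 := mul_nonneg (by positivity) a0
    have a2 : 0 ≤ (γ h.1 : ℝ) * y h.2 := mul_nonneg (by positivity) a0
    have a3 : 0 ≤ r * y h.2 := by positivity
    have a4 : 0 ≤ τ * ((γk k h.1 : ℝ) * y h.2) := by positivity
    rw [mul_div_assoc, mul_div_assoc]
    -- Where the allocations differ by `r` or more, the line of slope `τ` bounds the logarithm and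
    -- its intercept is weighted by a vanishing measure. Elsewhere the argument grows by at most
    -- `ry`, and so does the logarithm.
    by_cases hD' : h.1 ∈ D k
    · rw [Set.indicator_of_mem hD']
      have b1 := log_one_add_le_mul_add hτ0 a1
      have b2 : 0 ≤ Real.log (1 + (γ h.1 : ℝ) * y h.2) := Real.log_nonneg (by linarith)
      simp only [hy] at *
      linarith
    · rw [Set.indicator_of_notMem hD', mul_zero]
      have b1 : edist (γk k h.1) (γ h.1) < ENNReal.ofReal r := not_le.1 hD'
      rw [edist_dist, ENNReal.ofReal_lt_ofReal_iff hr0, NNReal.dist_eq] at b1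
      have b2 := (abs_lt.1 b1).2
      have b3 := log_one_add_le_of_le a2 a3 a1 (by nlinarith)
      simp only [hy] at *
      linarith
  have i0 := integrable_log_power (σ := σE) hE (hγk k) hki
  have i1 := integrable_log_power (σ := σE) hE hγ hγi
  have i2 : Integrable (fun h : ℝ≥0 × ℝ≥0 => r * y h.2) (μT.prod μE) :=
    (hyi.comp_snd _).const_mul r
  have i3 : Integrable (fun h : ℝ≥0 × ℝ≥0 => τ * ((γk k h.1 : ℝ) * y h.2)) (μT.prod μE) :=
    (hki.mul_prod hyi).const_mul τ
  have i4 : Integrable (fun h : ℝ≥0 × ℝ≥0 => M * (D k).indicator (fun _ => (1 : ℝ)) h.1)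
      (μT.prod μE) := (((integrable_const (1 : ℝ)).indicator (hDm k)).comp_fst _).const_mul M
  have i12 : Integrable (fun h : ℝ≥0 × ℝ≥0 =>
      Real.log (1 + (γ h.1 : ℝ) * (h.2 : ℝ) ^ 2 / (σE : ℝ) ^ 2) + r * y h.2) (μT.prod μE) :=
    i1.add i2
  have i123 : Integrable (fun h : ℝ≥0 × ℝ≥0 =>
      Real.log (1 + (γ h.1 : ℝ) * (h.2 : ℝ) ^ 2 / (σE : ℝ) ^ 2) + r * y h.2 +
        τ * ((γk k h.1 : ℝ) * y h.2)) (μT.prod μE) := i12.add i3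
  have hint := integral_mono i0 (i123.add i4) hpt
  have j2 : ∫ h : ℝ≥0 × ℝ≥0, y h.2 ∂(μT.prod μE) = m := by
    rw [integral_fun_snd]; simp [hm]
  have j3 : ∫ h : ℝ≥0 × ℝ≥0, (γk k h.1 : ℝ) * y h.2 ∂(μT.prod μE) =
      (∫ h, (γk k h : ℝ) ∂μT) * m :=
    integral_prod_mul (fun h => (γk k h : ℝ)) y
  have j4 : ∫ h : ℝ≥0 × ℝ≥0, (D k).indicator (fun _ => (1 : ℝ)) h.1 ∂(μT.prod μE) =
      μT.real (D k) := by
    rw [integral_fun_fst, integral_indicator_const _ (hDm k)]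
    simp
  have hsum : ∫ h, (fun h : ℝ≥0 × ℝ≥0 =>
      Real.log (1 + (γ h.1 : ℝ) * (h.2 : ℝ) ^ 2 / (σE : ℝ) ^ 2) + r * y h.2 +
        τ * ((γk k h.1 : ℝ) * y h.2) + M * (D k).indicator (fun _ => (1 : ℝ)) h.1) h
        ∂(μT.prod μE) =
      ∫ h, Real.log (1 + (γ h.1 : ℝ) * (h.2 : ℝ) ^ 2 / (σE : ℝ) ^ 2) ∂(μT.prod μE) + r * m +
        τ * ((∫ h, (γk k h : ℝ) ∂μT) * m) + M * μT.real (D k) := by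
    rw [integral_add i123 i4, integral_add i12 i3, integral_add i1 i2, integral_const_mul,
      integral_const_mul, integral_const_mul, j2, j3, j4]
  have hint' := hint.trans (le_of_eq hsum)
  have hkm : τ * ((∫ h, (γk k h : ℝ) ∂μT) * m) ≤ τ * (P * m) :=
    mul_le_mul_of_nonneg_left (mul_le_mul_of_nonneg_right hkP hm0) hτ0.le
  rw [fadingRate_eq, fadingRate_eq, div_add' _ _ _ (by positivity)]
  refine div_le_div_of_nonneg_right ?_ (by positivity)
  have : η * (2 * Real.log 2) = 4 * e := by rw [he]; ring
  rw [this]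
  linarith

end Limits

/-! ### Approximation by step allocations -/

namespace PowerPartition

variable {μT : Measure ℝ≥0} {P : ℝ≥0}

lemma exists_mem_interval (S : PowerPartition μT P) {h : ℝ≥0}
    (hh : h ∈ Set.Ico (S.edge 0) (S.edge (Fin.last S.d))) : ∃ i, h ∈ S.interval i := by
  by_contra! hcon
  have hall : ∀ i : Fin (S.d + 1), S.edge i ≤ h :=
    Fin.induction hh.1 fun i hi => not_lt.1 fun hlt => hcon i ⟨hi, hlt⟩
  exact absurd hh.2 (not_lt.2 (hall _))

/-- The same partition with all powers multiplied by `c`. -/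
def scale (S : PowerPartition μT P) (c Q : ℝ≥0)
    (hc : (c : ℝ≥0∞) * ∫⁻ h, (S.alloc h : ℝ≥0∞) ∂μT ≤ Q) : PowerPartition μT Q where
  d := S.d
  edge := S.edge
  edge_strictMono := S.edge_strictMono
  covers := S.covers
  power i := c * S.power i
  power_le := by
    refine le_trans (le_of_eq ?_) hc
    rw [S.lintegral_alloc, Finset.mul_sum]
    refine Finset.sum_congr rfl fun i _ => ?_
    push_cast
    rw [mul_left_comm]

lemma alloc_scale (S : PowerPartition μT P) (c Q : ℝ≥0)
    (hc : (c : ℝ≥0∞) * ∫⁻ h, (S.alloc h : ℝ≥0∞) ∂μT ≤ Q) (h : ℝ≥0) :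
    (S.scale c Q hc).alloc h = c * S.alloc h := by
  by_cases hex : ∃ i, h ∈ S.interval i
  · obtain ⟨i, hi⟩ := hex
    rw [S.alloc_of_mem hi, (S.scale c Q hc).alloc_of_mem (i := i) hi]
    rfl
  · rw [not_exists] at hex
    rw [S.alloc_of_notMem hex, (S.scale c Q hc).alloc_of_notMem hex, mul_zero]

/-- The partition of `[0, b)` into `N` intervals of equal length. -/
def uniform [IsFiniteMeasure μT] {b : ℝ≥0} (hb : 0 < b) (hT : ∀ᵐ h ∂μT, h < b) {N : ℕ}
    (hN : 0 < N) (p : Fin N → ℝ≥0) :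
    PowerPartition μT (∑ i : Fin N, μT (Set.Ico ((i : ℝ≥0) * (b / N))
      (((i : ℕ) + 1 : ℕ) * (b / N))) * (p i : ℝ≥0∞)).toNNReal where
  d := N
  edge i := (i : ℕ) * (b / N)
  edge_strictMono i j hij := by
    have : (0 : ℝ≥0) < N := by exact_mod_cast hN
    have hij' : ((i : ℕ) : ℝ≥0) < (j : ℕ) := by exact_mod_cast hij
    have : 0 < b / N := by positivity
    simp only
    gcongr
  covers := by
    have : (N : ℝ≥0) ≠ 0 := by exact_mod_cast hN.ne'
    filter_upwards [hT] with h hh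
    simp only [Fin.val_zero, Nat.cast_zero, zero_mul, Fin.val_last, Set.mem_Ico, zero_le, true_and]
    rwa [mul_div_cancel₀ _ this]
  power := p
  power_le := by
    rw [ENNReal.coe_toNNReal]
    · rfl
    · exact (ENNReal.sum_lt_top.2 fun i _ =>
        ENNReal.mul_lt_top (measure_lt_top _ _) ENNReal.coe_lt_top).ne

variable [IsProbabilityMeasure μT]

/-- Integrable allocations are approximated in mean by step allocations. -/
lemma exists_step_lintegral_edist_le (hT : ∃ b : ℝ≥0, ∀ᵐ h ∂μT, h ≤ b) {γ : ℝ≥0 → ℝ≥0}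
    (hγ : Integrable (fun h => (γ h : ℝ)) μT) {e : ℝ≥0} (he : 0 < e) {r : ℝ} (hr : 0 < r) :
    ∃ (Q : ℝ≥0) (S : PowerPartition μT Q),
      (∀ i : Fin S.d, (S.edge i.succ : ℝ) - S.edge i.castSucc < r) ∧
      ∫⁻ h, edist (S.alloc h) (γ h) ∂μT ≤ 2 * e := by
  have he' : (0 : ℝ) < e := he
  obtain ⟨b, hb⟩ := hT
  obtain ⟨f, hf, hfi⟩ := hγ.exists_boundedContinuous_integral_sub_le he'
  obtain ⟨δ, hδ, hunif⟩ := Metric.uniformContinuousOn_iff.1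
    ((isCompact_Icc (a := (0 : ℝ≥0)) (b := b + 1)).uniformContinuousOn_of_continuous
      f.continuous.continuousOn) e he'
  obtain ⟨N, hN⟩ := exists_nat_gt (((b : ℝ) + 1) / min δ r)
  have hmin : 0 < min δ r := lt_min hδ hr
  have hN0 : (0 : ℝ) < N := lt_of_le_of_lt (by positivity) hN
  have hNpos : 0 < N := by exact_mod_cast hN0
  have hmesh : ((b : ℝ) + 1) / N < min δ r := by
    rw [div_lt_iff₀ hmin] at hN
    rw [div_lt_iff₀ hN0]
    linarith
  -- The intervals are half-open, so the range is enlarged to keep the endpoint `b` inside.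
  have hb1 : ∀ᵐ h ∂μT, h < b + 1 := hb.mono fun h hh => hh.trans_lt (by simp)
  set S := uniform (μT := μT) (b := b + 1) (by positivity) hb1 hNpos
    (fun i => (f ((i : ℕ) * ((b + 1) / N))).toNNReal) with hS
  have hlen : ∀ i : Fin S.d, (S.edge i.succ : ℝ) = S.edge i.castSucc + (b + 1) / N := by
    intro i
    have h1 : S.edge i.succ = ((i : ℕ) + 1 : ℕ) * ((b + 1) / N) := rfl
    have h2 : S.edge i.castSucc = (i : ℕ) * ((b + 1) / N) := rfl
    rw [h1, h2]
    push_cast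
    ring
  refine ⟨_, S, fun i => ?_, ?_⟩
  · rw [hlen, add_sub_cancel_left]
    exact hmesh.trans_le (min_le_right _ _)
  have hpt : ∀ᵐ h ∂μT, edist (S.alloc h) (γ h) ≤
      e + ENNReal.ofReal ‖(γ h : ℝ) - f h‖ := by
    filter_upwards [S.covers, hb] with h hh hhb
    obtain ⟨i, hi⟩ := S.exists_mem_interval hh
    rw [S.alloc_of_mem hi]
    have hpow : S.power i = (f (S.edge i.castSucc)).toNNReal := rfl
    have h1 : (S.edge i.castSucc : ℝ) ≤ h := by exact_mod_cast hi.1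
    have h2 : (h : ℝ) < S.edge i.castSucc + (b + 1) / N := by
      rw [← hlen]; exact_mod_cast hi.2
    have h3 : |f (S.edge i.castSucc) - f h| < e := by
      have := hunif (S.edge i.castSucc) ⟨zero_le, (hi.1.trans hhb).trans (by simp)⟩ h
        ⟨zero_le, hhb.trans (by simp)⟩ (by
          rw [NNReal.dist_eq, abs_lt]
          have := hmesh.trans_le (min_le_left _ _)
          constructor <;> linarith)
      rwa [Real.dist_eq] at this
    -- The approximant `f` may be negative; truncation at zero brings it no farther from the
    -- nonnegative `γ`.
    have h4 : |((f (S.edge i.castSucc)).toNNReal : ℝ) - γ h| ≤ |f (S.edge i.castSucc) - γ h| := by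
      rw [Real.coe_toNNReal']
      have := abs_max_sub_max_le_abs (f (S.edge i.castSucc)) (γ h : ℝ) 0
      rwa [max_eq_left (NNReal.coe_nonneg (γ h))] at this
    rw [hpow, edist_dist, NNReal.dist_eq]
    have h5 : (e : ℝ≥0∞) = ENNReal.ofReal e := by simp
    rw [h5, ← ENNReal.ofReal_add he'.le (norm_nonneg _)]
    refine ENNReal.ofReal_le_ofReal (h4.trans ?_)
    rw [Real.norm_eq_abs, abs_sub_comm (γ h : ℝ)]
    calc _ = |(f (S.edge i.castSucc) - f h) + (f h - γ h)| := by ring_nf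
      _ ≤ _ := (abs_add_le _ _).trans (by linarith)
  calc _ ≤ ∫⁻ h, (e + ENNReal.ofReal ‖(γ h : ℝ) - f h‖) ∂μT := lintegral_mono_ae hpt
    _ = e + ENNReal.ofReal (∫ h, ‖(γ h : ℝ) - f h‖ ∂μT) := by
        have hi : Integrable (fun h => ‖(γ h : ℝ) - f h‖) μT := (hγ.sub hfi).norm
        rw [lintegral_add_left measurable_const,
          ofReal_integral_eq_lintegral_ofReal hi (ae_of_all _ fun _ => norm_nonneg _)]
        simp
    _ ≤ e + e := by
        gcongr
        exact ENNReal.ofReal_le_of_le_toReal hf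
    _ = _ := (two_mul _).symm

/-- Allocations of mean at most `P` are approximated in mean by step allocations of mean at most
`P`. -/
lemma exists_lintegral_edist_le (hT : ∃ b : ℝ≥0, ∀ᵐ h ∂μT, h ≤ b) {γ : ℝ≥0 → ℝ≥0}
    (hγ : Measurable γ) (hP : ∫⁻ h, (γ h : ℝ≥0∞) ∂μT ≤ P) {e : ℝ≥0} (he : 0 < e) {r : ℝ}
    (hr : 0 < r) : ∃ S : PowerPartition μT P,
      (∀ i : Fin S.d, (S.edge i.succ : ℝ) - S.edge i.castSucc < r) ∧
      ∫⁻ h, edist (S.alloc h) (γ h) ∂μT ≤ 4 * e := by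
  obtain ⟨Q, S, hmesh, hS⟩ := exists_step_lintegral_edist_le hT (integrable_power hγ hP).1 he hr
  have hQ0 : P + 2 * e ≠ 0 := by positivity
  have hmean : ∫⁻ h, (S.alloc h : ℝ≥0∞) ∂μT ≤ (P + 2 * e : ℝ≥0) := by
    calc _ ≤ ∫⁻ h, ((γ h : ℝ≥0∞) + edist (S.alloc h) (γ h)) ∂μT := by
          refine lintegral_mono fun h => ?_
          rw [edist_nndist, ← ENNReal.coe_add, ENNReal.coe_le_coe, ← NNReal.coe_le_coe]
          push_cast
          rw [NNReal.dist_eq]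
          linarith [le_abs_self ((S.alloc h : ℝ) - γ h)]
      _ = ∫⁻ h, (γ h : ℝ≥0∞) ∂μT + ∫⁻ h, edist (S.alloc h) (γ h) ∂μT :=
          lintegral_add_left hγ.coe_nnreal_ennreal _
      _ ≤ _ := by
          push_cast
          exact add_le_add hP hS
  have hscale : ∀ c R : ℝ≥0, c * (P + 2 * e) = R →
      (c : ℝ≥0∞) * ∫⁻ h, (S.alloc h : ℝ≥0∞) ∂μT ≤ R := by
    rintro c _ rfl
    rw [ENNReal.coe_mul]
    exact mul_le_mul_right hmean _
  have hc := hscale (P / (P + 2 * e)) P (div_mul_cancel₀ _ hQ0)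
  have hc' := hscale (2 * e / (P + 2 * e)) (2 * e) (div_mul_cancel₀ _ hQ0)
  -- The step allocation has mean at most `P + 2e`, so the factor `P/(P+2e)` restores the
  -- constraint. What is removed, the fraction `2e/(P+2e)`, has mean at most `2e`.
  refine ⟨S.scale _ P hc, hmesh, ?_⟩
  have hcc : P / (P + 2 * e) + 2 * e / (P + 2 * e) = 1 := by
    rw [← add_div, div_self hQ0]
  calc _ ≤ ∫⁻ h, (((2 * e / (P + 2 * e) : ℝ≥0) : ℝ≥0∞) * S.alloc h + edist (S.alloc h) (γ h)) ∂μT := by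
        refine lintegral_mono fun h => (edist_triangle _ (S.alloc h) _).trans ?_
        gcongr
        rw [alloc_scale, edist_nndist, ← ENNReal.coe_mul, ENNReal.coe_le_coe, ← NNReal.coe_le_coe,
          coe_nndist, NNReal.dist_eq]
        have h1 : S.alloc h = P / (P + 2 * e) * S.alloc h + 2 * e / (P + 2 * e) * S.alloc h := by
          rw [← add_mul, hcc, one_mul]
        have h2 : (S.alloc h : ℝ) = ((P / (P + 2 * e) * S.alloc h : ℝ≥0) : ℝ) +
            ((2 * e / (P + 2 * e) * S.alloc h : ℝ≥0) : ℝ) := by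
          exact_mod_cast h1
        rw [abs_le]
        have h3 : (0 : ℝ) ≤ ((2 * e / (P + 2 * e) * S.alloc h : ℝ≥0) : ℝ) := NNReal.coe_nonneg _
        constructor <;> linarith
    _ = ((2 * e / (P + 2 * e) : ℝ≥0) : ℝ≥0∞) * ∫⁻ h, (S.alloc h : ℝ≥0∞) ∂μT +
        ∫⁻ h, edist (S.alloc h) (γ h) ∂μT := by
        rw [lintegral_add_left (S.measurable_alloc.coe_nnreal_ennreal.const_mul _),
          lintegral_const_mul _ S.measurable_alloc.coe_nnreal_ennreal]
    _ ≤ ((2 * e : ℝ≥0) : ℝ≥0∞) + 2 * e := add_le_add hc' hS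
    _ = _ := by push_cast; ring

/-- Approximation in mean with errors of order `1/(k+1)` gives convergence in measure by Markov's
inequality. -/
theorem exists_seq_tendstoInMeasure (hT : ∃ b : ℝ≥0, ∀ᵐ h ∂μT, h ≤ b) {γ : ℝ≥0 → ℝ≥0}
    (hγ : Measurable γ) (hP : ∫⁻ h, (γ h : ℝ≥0∞) ∂μT ≤ P) :
    ∃ S : ℕ → PowerPartition μT P,
      (∀ r > (0 : ℝ), ∀ᶠ k in atTop, ∀ i : Fin (S k).d,
        ((S k).edge i.succ : ℝ) - (S k).edge i.castSucc < r) ∧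
      TendstoInMeasure μT (fun k => (S k).alloc) atTop γ := by
  have hpos : ∀ k : ℕ, (0 : ℝ) < 1 / ((k : ℝ) + 1) := fun k => Nat.one_div_pos_of_nat
  choose S hmesh hS using fun k : ℕ => exists_lintegral_edist_le hT hγ hP
    (e := (1 / ((k : ℝ) + 1)).toNNReal) (by simpa using Nat.cast_add_one_pos (α := ℝ) k) (hpos k)
  refine ⟨S, fun r hr => ?_, ?_⟩
  · filter_upwards [(tendsto_one_div_add_atTop_nhds_zero_nat (𝕜 := ℝ)).eventually_le_const hr]
      with k hk i
    exact (hmesh k i).trans_le hk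
  intro e he
  -- Thresholds range over the extended reals, while Markov's inequality needs a finite one;
  -- distances are never infinite.
  by_cases het : e = ⊤
  · have : ∀ k, μT {x | e ≤ edist ((S k).alloc x) (γ x)} = 0 := fun k => by
      have hempty : {x | e ≤ edist ((S k).alloc x) (γ x)} = ∅ := by
        ext x
        simp [het, edist_ne_top]
      rw [hempty, measure_empty]
    simp [this]
  have hlim : Tendsto (fun k : ℕ => 4 * ((1 / ((k : ℝ) + 1)).toNNReal : ℝ≥0∞) / e) atTop
      (𝓝 0) := by
    have h1 := ENNReal.tendsto_ofReal (tendsto_one_div_add_atTop_nhds_zero_nat (𝕜 := ℝ))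
    rw [ENNReal.ofReal_zero] at h1
    have h2 := ENNReal.Tendsto.const_mul (a := 4) h1 (Or.inr (by simp))
    have h3 := ENNReal.Tendsto.div_const h2 (b := e) (Or.inr he.ne')
    rw [mul_zero, ENNReal.zero_div] at h3
    exact h3
  refine tendsto_of_tendsto_of_tendsto_of_le_of_le tendsto_const_nhds hlim (fun _ => zero_le)
    fun k => ?_
  refine (meas_ge_le_lintegral_div ((S k).measurable_alloc.edist hγ).aemeasurable he.ne' het).trans ?_
  gcongr
  exact hS k

end PowerPartition

end FadingWiretap

end

/-! ### Assembly of the three statements -/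

theorem mainTheorem7 (μT μE : Measure ℝ≥0) [IsProbabilityMeasure μT] [IsProbabilityMeasure μE]
    (hT : ∃ b : ℝ≥0, ∀ᵐ h ∂μT, h ≤ b)
    (hE : Integrable (fun h : ℝ≥0 => (h : ℝ) ^ 2) μE)
    (σE : ℝ≥0) (hσ : 0 < σE) (P : ℝ≥0) :
    -- (1) a fixed partition into `d` intervals, with the power allocation of the scheme
    (∀ (S : PowerPartition μT P) (len : ℕ → Fin S.d → ℕ), S.IsPlan len →
      -- (1a) smoothing parameter exponentially small in `n`
      (∀ η > (0 : ℝ), ∃ c > (0 : ℝ), ∀ᶠ n : ℕ in atTop,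
        ∀ C : (i : Fin S.d) → Finset (Fin (len n i) → ℝ), S.IsCodebook C →
          smoothMaxInfo (refMeasure μT μE n) (eveDensity S σE C) (Real.exp (-c * n)) / (n : EReal)
            ≤ ((fadingRate μT μE σE S.alloc + η : ℝ) : EReal)) ∧
      -- (1b) smoothing parameter of exponential rate zero: no loss in the limit
      (∀ ε : ℕ → ℝ, (∀ n, 0 < ε n) → Tendsto (fun n => Real.log (ε n) / n) atTop (𝓝 0) →
        ∀ η > (0 : ℝ), ∀ᶠ n : ℕ in atTop,
        ∀ C : (i : Fin S.d) → Finset (Fin (len n i) → ℝ), S.IsCodebook C →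
          smoothMaxInfo (refMeasure μT μE n) (eveDensity S σE C) (ε n) / (n : EReal)
            ≤ ((fadingRate μT μE σE S.alloc + η : ℝ) : EReal)) ∧
      -- (1c) the product typical sets
      (∀ δ > (0 : ℝ), ∀ δ' > (0 : ℝ), ∀ δ'' > (0 : ℝ),
        (∀ η > (0 : ℝ), ∀ᶠ n : ℕ in atTop,
          ∀ C : (i : Fin S.d) → Finset (Fin (len n i) → ℝ), S.IsCodebook C →
            maxInfoOn (refMeasure μT μE n) (eveDensity S σE C)
                (productTypicalSet S σE C μE δ δ' δ'') / (n : EReal)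
              ≤ ((fadingRate μT μE σE S.alloc
                + (Real.logb 2 ((1 + δ) * Real.exp δ') + δ'') / 2 + η : ℝ) : EReal)) ∧
        (∀ a : ℝ, ∃ c > (0 : ℝ), ∀ᶠ n : ℕ in atTop,
          ∀ C : (i : Fin S.d) → Finset (Fin (len n i) → ℝ), S.IsCodebook C →
            (∀ i, ∀ x ∈ C i, ∀ j, |x j| ≤ a) →
            IsTypical (refMeasure μT μE n) (eveDensity S σE C) (Real.exp (-c * n))
              (productTypicalSet S σE C μE δ δ' δ'')))) ∧
    -- (2) refining partitions, with step allocations converging to a power allocation `γ`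
    (∀ γ : ℝ≥0 → ℝ≥0, Measurable γ → ∀ S : ℕ → PowerPartition μT P,
      TendstoInMeasure μT (fun k => (S k).alloc) atTop γ →
      ∀ η > (0 : ℝ), ∀ᶠ k in atTop, ∀ len : ℕ → Fin (S k).d → ℕ, (S k).IsPlan len →
        ∃ c > (0 : ℝ), ∀ᶠ n : ℕ in atTop,
          ∀ C : (i : Fin (S k).d) → Finset (Fin (len n i) → ℝ), (S k).IsCodebook C →
            smoothMaxInfo (refMeasure μT μE n) (eveDensity (S k) σE C) (Real.exp (-c * n))
                / (n : EReal)
              ≤ ((fadingRate μT μE σE γ + η : ℝ) : EReal)) ∧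
    -- (3) every power allocation `γ` is such a limit, with intervals of vanishing length
    (∀ γ : ℝ≥0 → ℝ≥0, Measurable γ → ∫⁻ h, (γ h : ℝ≥0∞) ∂μT ≤ (P : ℝ≥0∞) →
      ∃ S : ℕ → PowerPartition μT P,
        (∀ r > (0 : ℝ), ∀ᶠ k in atTop, ∀ i : Fin (S k).d,
          ((S k).edge i.succ : ℝ) - (S k).edge i.castSucc < r) ∧
        TendstoInMeasure μT (fun k => (S k).alloc) atTop γ) := by
  refine ⟨fun S len hlen => ⟨fun η hη => exists_smoothMaxInfo_exp_le S hσ hE hlen hη,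
    fun ε hε hlim η hη => ?_, fun δ hδ δ' hδ' δ'' hδ'' => ⟨fun η hη =>
      eventually_maxInfoOn_productTypicalSet_le S hσ hE hlen hδ hδ' hδ'' hη, fun a =>
        exists_isTypical_productTypicalSet S hσ hE hlen hδ hδ' hδ'' a⟩⟩,
    fun γ hγ S hlim η hη => ?_, fun γ hγ hP => PowerPartition.exists_seq_tendstoInMeasure hT hγ hP⟩
  · refine eventually_of_exists_exp_smoothing (Q := fun n ε => ∀ C : (i : Fin S.d) →
      Finset (Fin (len n i) → ℝ), S.IsCodebook C →
        smoothMaxInfo (refMeasure μT μE n) (eveDensity S σE C) ε / (n : EReal) ≤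
          ((fadingRate μT μE σE S.alloc + η : ℝ) : EReal)) (fun n ε ε' hle h C hC => ?_)
      (exists_smoothMaxInfo_exp_le S hσ hE hlen hη) hε hlim
    exact (EReal.div_le_div_right_of_nonneg (by positivity) (smoothMaxInfo_anti hle)).trans (h C hC)
  -- Half of `η` goes to semicontinuity in `k`, the other half to the asymptotics in `n` for fixed
  -- `k`.
  · filter_upwards [eventually_fadingRate_le (σE := σE) hE hγ (fun k => (S k).measurable_alloc)
      (fun k => (S k).lintegral_alloc_le) hlim (half_pos hη)] with k hk len hlen
    obtain ⟨c, hc, h⟩ := exists_smoothMaxInfo_exp_le (S k) hσ hE hlen (half_pos hη)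
    refine ⟨c, hc, h.mono fun n hn C hC => (hn C hC).trans ?_⟩
    exact_mod_cast (by linarith : fadingRate μT μE σE (S k).alloc + η / 2 ≤
      fadingRate μT μE σE γ + η)
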